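/- **Conventions.** A *graph* has a vertex set $V$ and an edge set $E$ (loops and multiple edges allowed). A *branched 2-complex* $X$ is a graph $X_{(1)}$ (the 1-skeleton) together with a set of faces; each face $f$ is attached along an immersed (cyclically reduced, closed) edge path of length $\ell(f)>0$ and has an area $\mathrm{Area}(f)\in\mathbb Z_{>0}$. It is *standard* if all areas are $1$, and *finite* if it has finitely many cells. Set $\mathrm{Area}(X)=\sum_f\mathrm{Area}(f)$, $\chi(X_{(1)})=\#V-\#E$ and, if $\mathrm{Area}(X)>0$, $$\kappa(X)=\frac{\mathrm{Area}(X)+\chi(X_{(1)})}{\mathrm{Area}(X)}.$$ A *(branched) morphism* $\phi:Y\to X$ sends vertices to vertices, edges homeomorphically to edges, and each face $f$ to a face $\phi(f)$ by a map modelled on $z\mapsto z^{m}$, $m=m_\phi(f)\ge 1$, such that $\mathrm{Area}(f)=m_\phi(f)\,\mathrm{Area}(\phi(f))$. It is a *branched immersion* if it is injective on the link of every vertex. *Folding* $\phi$ means factoring it as $Y\xrightarrow{\phi_0}\bar Y\xrightarrow{\bar\phi}X$, where $\phi_0$ is onto, does not identify points of different components and is surjective on fundamental groups of the components of the 1-skeleta,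 and $\bar\phi$ is a branched immersion. The morphism $\phi$ is *essential* if, after folding, $\phi_0$ is a homotopy equivalence of 1-skeleta and a homeomorphism from the union of the open faces of $Y$ to that of $\bar Y$; it is an *essential equivalence* if, in addition, $\bar\phi$ is an isomorphism. A finite $X$ is *visibly irreducible* if none of the following holds: (i) some vertex has valence $0$ or $1$; (ii) some vertex has disconnected link; (iii) some edge is traversed exactly once by the boundaries of the faces; (iv) there is an essential equivalence $X'\to X$ that is not an isomorphism, where $X'$ is finite and all its vertices have valence at least $2$. A finite $X$ is *irreducible* if there is an essential equivalence $X'\to X$ from a finite visibly irreducible $X'$. A finite $X$ is a *surface* if the link of every vertex is a circle. For a finite $X$ let $\mathrm{Irred}(X)$ (respectively $\mathrm{Surf}(X)$) be the collection of essential maps $Y\to X$ with $Y$ finite, of positive area, not necessarily connected, and irreducible (respectively a surface). Define $\rho_+(X)=\sup_{Y\in \mathrm{Irred}(X)}\kappa(Y)$, $\rho_-(X)=\inf_{Y\in \mathrm{Irred}(X)}\kappa(Y)$, $\sigma_+(X)=\sup_{Y\in \mathrm{Surf}(X)}\kappa(Y)$ and $\sigma_-(X)=\inf_{Y\in \mathrm{Surf}(X)}\kappa(Y)$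 in $[-\infty,\infty]$, with $\sup\varnothing=-\infty$ and $\inf\varnothing=+\infty$. Let $X$ be finite and connected, with faces $f_1,\dots,f_n$. Its *branched group pair* is $(F_X,\mathcal A_X)$, where $F_X=\pi_1(X_{(1)})$ and $\mathcal A_X=\bigsqcup_i F_X/\langle w_i\rangle$ with the left multiplication action of $F_X$; here $w_i\in F_X$, defined up to conjugacy, is represented by the boundary of $f_i$, and every element of $F_X/\langle w_i\rangle$ is given the area of $f_i$. Finite connected branched 2-complexes $X,X'$ are *Nielsen equivalent* if there are a group isomorphism $\varphi:F_X\to F_{X'}$ and a $\varphi$-equivariant, area-preserving bijection $\mathcal A_X\to\mathcal A_{X'}$. (For standard complexes, area is automatically preserved.) **Theorem.** Let $X$ and $X'$ be finite connected branched 2-complexes that are Nielsen equivalent. Then $$\rho_+(X)=\rho_+(X')\quad\text{and}\quad\rho_-(X)=\rho_-(X').$$ If moreover $X$ and $X'$ are irreducible, then $$\sigma_+(X)=\sigma_+(X')\quad\text{and}\quad\sigma_-(X)=\sigma_-(X').$$ -/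

import Mathlib

/-! ## Graphs, edge paths and fundamental groups -/

/-- A graph, in the topological sense: an edge set glued to a vertex set along its end points
(loops and multiple edges are allowed). Each edge comes with a reference orientation. -/
structure CombGraph where
  V : Type
  E : Type
  src : E → V
  tgt : E → V

namespace CombGraph

/-- Oriented edges: `(e, true)` is `e` with its reference orientation, `(e, false)` is the same edge
traversed backwards. -/
abbrev Dart (G : CombGraph) : Type := G.E × Bool

variable (G : CombGraph)

/-- The same edge, traversed in the opposite direction. -/
def flip (d : G.Dart) : G.Dart := (d.1, !d.2)

/-- Initial vertex of an oriented edge. -/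
def init (d : G.Dart) : G.V := if d.2 then G.src d.1 else G.tgt d.1

/-- Terminal vertex of an oriented edge. -/
def term (d : G.Dart) : G.V := G.init (G.flip d)

/-- `G.IsWalk u l v`: the list `l` of oriented edges is an edge path from `u` to `v`. -/
def IsWalk : G.V → List G.Dart → G.V → Prop
  | u, [], v => u = v
  | u, d :: l, v => G.init d = u ∧ IsWalk (G.term d) l v

@[simp] theorem flip_flip (d : G.Dart) : G.flip (G.flip d) = d := by
  simp [flip]

@[simp] theorem term_flip (d : G.Dart) : G.term (G.flip d) = G.init d := by
  simp [term]

theorem IsWalk.append {G : CombGraph} {u v w : G.V} {l m : List G.Dart}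
    (h : G.IsWalk u l v) (h' : G.IsWalk v m w) : G.IsWalk u (l ++ m) w := by
  induction l generalizing u with
  | nil => simp only [IsWalk] at h; subst h; simpa using h'
  | cons d l ih => exact ⟨h.1, ih h.2⟩

theorem IsWalk.invRev {G : CombGraph} {u v : G.V} {l : List G.Dart}
    (h : G.IsWalk u l v) : G.IsWalk v (FreeGroup.invRev l) u := by
  induction l generalizing u with
  | nil => simp only [IsWalk] at h; subst h; simp [IsWalk]
  | cons d l ih =>
    have h1 := ih h.2
    have h2 : FreeGroup.invRev (d :: l) = FreeGroup.invRev l ++ [G.flip d] := by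
      simp [FreeGroup.invRev, flip]
    rw [h2]
    refine h1.append ⟨rfl, ?_⟩
    rw [term_flip]
    exact h.1

/-- Cancelling a backtrack in an edge path leaves an edge path with the same end points. Hence two
edge paths with the same end points are homotopic (through edge paths) exactly when they represent
the same element of the free group on the edges. -/
theorem IsWalk.of_step {G : CombGraph} {u v : G.V} {l m : List G.Dart}
    (h : G.IsWalk u l v) (hs : FreeGroup.Red.Step l m) : G.IsWalk u m v := by
  cases hs with
  | @not L₁ L₂ x b =>
    induction L₁ generalizing u with
    | nil =>
      obtain ⟨h1, -, h3⟩ := h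
      have h4 : G.term (x, !b) = u := by rw [← h1]; exact G.term_flip (x, b)
      rw [h4] at h3
      exact h3
    | cons d L ih => exact ⟨h.1, ih h.2⟩

/-- The fundamental group of the graph at `v`: homotopy classes of closed edge paths at `v`, where
homotopy means insertion and deletion of backtracks `d, flip d`. It is realised inside the free
group on the edges, whose elements are the words in oriented edges modulo exactly these moves. -/
def pi1 (v : G.V) : Subgroup (FreeGroup G.E) where
  carrier := {g | ∃ l : List G.Dart, G.IsWalk v l v ∧ FreeGroup.mk l = g}
  mul_mem' := by
    rintro _ _ ⟨l, hl, rfl⟩ ⟨m, hm, rfl⟩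
    exact ⟨l ++ m, hl.append hm, FreeGroup.mul_mk.symm⟩
  one_mem' := ⟨[], rfl, rfl⟩
  inv_mem' := by
    rintro _ ⟨l, hl, rfl⟩
    exact ⟨FreeGroup.invRev l, hl.invRev, FreeGroup.inv_mk.symm⟩

/-- Two vertices lie in the same connected component. -/
def Joined (u v : G.V) : Prop := ∃ l : List G.Dart, G.IsWalk u l v

end CombGraph

/-! ## Branched 2-complexes and branched morphisms -/

/-- A branched 2-complex: a graph (the 1-skeleton) with faces, each of which is a circle subdivided
into `len f > 0` edges and immersed in the 1-skeleton, and which carries a positive integral area.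
The attaching map of `f` is recorded as the bi-infinite `len f`-periodic edge path `bd f`. A standard
2-complex is one where all areas are `1`. -/
structure BranchedComplex extends CombGraph where
  F : Type
  len : F → ℕ
  len_pos : ∀ f, 0 < len f
  bd : F → ℤ → toCombGraph.Dart
  bd_periodic : ∀ f i, bd f (i + len f) = bd f i
  bd_path : ∀ f i, toCombGraph.term (bd f i) = toCombGraph.init (bd f (i + 1))
  bd_immersed : ∀ f i, bd f (i + 1) ≠ toCombGraph.flip (bd f i)
  area : F → ℕ
  area_pos : ∀ f, 0 < area f

namespace BranchedComplex

/-- The complex has finitely many cells. -/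
def IsFinite (X : BranchedComplex) : Prop := Finite X.V ∧ Finite X.E ∧ Finite X.F

/-- The complex is non-empty and connected. -/
def IsConnected (X : BranchedComplex) : Prop := Nonempty X.V ∧ ∀ u v, X.Joined u v

/-- A branched morphism. It maps vertices to vertices and oriented edges to oriented edges, and
maps the face `f` onto the face `face f` by a map modelled on `z ↦ z ^ m`, with `m = mult f`, up to
the rotation `shift f` and, if `rev f` holds, a reflection. Areas satisfy
`Area f = m * Area (face f)`. -/
structure Hom (Y X : BranchedComplex) where
  vert : Y.V → X.V
  dart : Y.Dart → X.Dart
  init_dart : ∀ d, X.init (dart d) = vert (Y.init d)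
  dart_flip : ∀ d, dart (Y.flip d) = X.flip (dart d)
  face : Y.F → X.F
  mult : Y.F → ℕ
  mult_pos : ∀ f, 0 < mult f
  rev : Y.F → Bool
  shift : Y.F → ℤ
  len_eq : ∀ f, Y.len f = mult f * X.len (face f)
  area_eq : ∀ f, Y.area f = mult f * X.area (face f)
  dart_bd : ∀ f i, dart (Y.bd f i) =
    if rev f then X.flip (X.bd (face f) (shift f - i - 1)) else X.bd (face f) (shift f + i)

namespace Hom

variable {X Y Z : BranchedComplex}

/-- The corner number `i` of a face `f` (an edge of the link of a vertex) lies at the vertex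
`init (bd f i)`, between the edges `bd f (i - 1)` and `bd f i`; it only depends on `i` modulo
`len f`. This is the number of the corner of `face f` to which the corner `i` of `f` is mapped. -/
def corner (φ : Hom Y X) (f : Y.F) (i : ℤ) : ℤ :=
  if φ.rev f then φ.shift f - i else φ.shift f + i

/-- The morphism `φ` is the composition of `φ₀` followed by `ψ`. -/
def IsComp (φ : Hom Y X) (φ₀ : Hom Y Z) (ψ : Hom Z X) : Prop :=
  (∀ v, φ.vert v = ψ.vert (φ₀.vert v)) ∧
  (∀ d, φ.dart d = ψ.dart (φ₀.dart d)) ∧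
  (∀ f, φ.face f = ψ.face (φ₀.face f)) ∧
  (∀ f i, φ.corner f i ≡ ψ.corner (φ₀.face f) (φ₀.corner f i) [ZMOD X.len (φ.face f)])

/-- A branched immersion: the induced map on the link of every vertex is injective, both on the
vertices of the link (oriented edges issuing from the vertex) and on its edges (corners of faces at
the vertex). -/
def IsBranchedImmersion (φ : Hom Y X) : Prop :=
  (∀ d d', Y.init d = Y.init d' → φ.dart d = φ.dart d' → d = d') ∧
  (∀ f i f' i', Y.init (Y.bd f i) = Y.init (Y.bd f' i') → φ.face f = φ.face f' →
    φ.corner f i ≡ φ.corner f' i' [ZMOD X.len (φ.face f)] →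
    f = f' ∧ i ≡ i' [ZMOD Y.len f])

/-- An isomorphism of branched complexes. -/
def IsIso (φ : Hom Y X) : Prop :=
  Function.Bijective φ.vert ∧ Function.Bijective φ.dart ∧ Function.Bijective φ.face ∧
    ∀ f, φ.mult f = 1

/-- The homomorphism between free groups on edges which sends the class of an edge path to the class
of its image under `φ`; it restricts to the maps induced on fundamental groups of 1-skeleta. -/
def edgeMap (φ : Hom Y X) : FreeGroup Y.E →* FreeGroup X.E :=
  FreeGroup.lift fun e => FreeGroup.mk [φ.dart (e, true)]

/-- The induced map on 1-skeleta is a homotopy equivalence: it is bijective on connected components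
and on the fundamental groups at all vertices. -/
def IsGraphEquiv (φ : Hom Y X) : Prop :=
  (∀ u v, X.Joined (φ.vert u) (φ.vert v) → Y.Joined u v) ∧
  (∀ w, ∃ v, X.Joined (φ.vert v) w) ∧
  (∀ v, Set.BijOn φ.edgeMap (Y.pi1 v) (X.pi1 (φ.vert v)))

/-- `φ : Y → X` folds to `ψ : Z → X` by means of the fold map `φ₀ : Y → Z`: the composition of `φ₀`
and `ψ` is `φ`, the map `φ₀` is onto, does not identify points of different components and is
surjective on fundamental groups of 1-skeleta, and `ψ` is a branched immersion. -/
def IsFolding (φ : Hom Y X) (φ₀ : Hom Y Z) (ψ : Hom Z X) : Prop :=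
  φ.IsComp φ₀ ψ ∧
  (Function.Surjective φ₀.vert ∧ Function.Surjective φ₀.dart ∧ Function.Surjective φ₀.face) ∧
  (∀ u v, Z.Joined (φ₀.vert u) (φ₀.vert v) → Y.Joined u v) ∧
  (∀ v, Set.SurjOn φ₀.edgeMap (Y.pi1 v) (Z.pi1 (φ₀.vert v))) ∧
  ψ.IsBranchedImmersion

/-- The morphism is a homeomorphism from the union of the open faces to the union of the open
faces. -/
def IsFaceHomeo (φ : Hom Y X) : Prop :=
  Function.Bijective φ.face ∧ ∀ f, φ.mult f = 1

/-- An essential map: after folding, the fold map is a homotopy equivalence on 1-skeleta and a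
homeomorphism on the interiors of faces. -/
def IsEssential (φ : Hom Y X) : Prop :=
  ∃ (Z : BranchedComplex) (φ₀ : Hom Y Z) (ψ : Hom Z X),
    φ.IsFolding φ₀ ψ ∧ φ₀.IsGraphEquiv ∧ φ₀.IsFaceHomeo

/-- An essential equivalence: an essential map whose folded representative is an isomorphism. -/
def IsEssentialEquiv (φ : Hom Y X) : Prop :=
  ∃ (Z : BranchedComplex) (φ₀ : Hom Y Z) (ψ : Hom Z X),
    φ.IsFolding φ₀ ψ ∧ φ₀.IsGraphEquiv ∧ φ₀.IsFaceHomeo ∧ ψ.IsIso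

end Hom

/-! ## Links, irreducible complexes and surfaces -/

/-- The valence of a vertex; a loop counts twice. -/
noncomputable def valence (X : BranchedComplex) (v : X.V) : ℕ∞ := {d : X.Dart | X.init d = v}.encard

/-- The set of all traversals of the edge underlying `d` by boundaries of faces. Its cardinality is
also the valence of `d` as a vertex of the link of `init d`. -/
def hits (X : BranchedComplex) (d : X.Dart) : Set (Σ f : X.F, Fin (X.len f)) :=
  {p | X.bd p.1 (p.2 : ℕ) = d ∨ X.bd p.1 (p.2 : ℕ) = X.flip d}

/-- Some face has a corner between the oriented edges `d` and `d'`, which issue from the same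
vertex: this is an edge of the link of that vertex. -/
def LinkAdj (X : BranchedComplex) (d d' : X.Dart) : Prop :=
  ∃ f i, d = X.flip (X.bd f (i - 1)) ∧ d' = X.bd f i

/-- Any two vertices of the link of `v` are joined in the link of `v`. -/
def LinkConnected (X : BranchedComplex) (v : X.V) : Prop :=
  ∀ d d', X.init d = v → X.init d' = v → Relation.EqvGen X.LinkAdj d d'

/-- One of: (i) some vertex has valence `0` or `1`; (ii) some vertex is locally separating, i.e. has
disconnected link; (iii) there is a free face, i.e. an edge that is traversed exactly once. -/
def IsVisiblyReducible (X : BranchedComplex) : Prop :=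
  (∃ v, X.valence v ≤ 1) ∨ (∃ v, ¬ X.LinkConnected v) ∨ (∃ d, (X.hits d).encard = 1)

/-- (iv) There is an essential equivalence `X' → X`, from a finite complex, that is not an
isomorphism. Every vertex of `X'` is required to have valence at least `2`: otherwise one could
always take for `X'` the complex `X` with an additional edge hanging off a vertex, folded onto some
edge of `X`. -/
def HasUnfolding (X : BranchedComplex) : Prop :=
  ∃ X' : BranchedComplex, X'.IsFinite ∧ (∀ v, 2 ≤ X'.valence v) ∧
    ∃ φ : Hom X' X, φ.IsEssentialEquiv ∧ ¬ φ.IsIso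

/-- None of the conditions (i) - (iv) holds. -/
def IsVisiblyIrreducible (X : BranchedComplex) : Prop :=
  ¬ X.IsVisiblyReducible ∧ ¬ X.HasUnfolding

/-- Irreducibility of a finite complex. -/
def IsIrreducible (X : BranchedComplex) : Prop :=
  ∃ X' : BranchedComplex, X'.IsFinite ∧ X'.IsVisiblyIrreducible ∧
    ∃ φ : Hom X' X, φ.IsEssentialEquiv

/-- A (finite) complex is a closed surface: the link of every vertex is a circle, i.e. it is
non-empty, connected and all of its vertices have valence `2`. -/
def IsSurface (X : BranchedComplex) : Prop :=
  ∀ v, (∃ d, X.init d = v) ∧ X.LinkConnected v ∧ ∀ d, X.init d = v → (X.hits d).encard = 2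

/-! ## Curvature -/

/-- The sum of the areas of the faces. -/
noncomputable def totalArea (X : BranchedComplex) : ℕ := ∑ᶠ f, X.area f

/-- The Euler characteristic of the 1-skeleton. -/
noncomputable def eulerChar (X : BranchedComplex) : ℤ := Nat.card X.V - Nat.card X.E

/-- Total curvature. -/
noncomputable def totalCurvature (X : BranchedComplex) : ℤ := X.totalArea + X.eulerChar

/-- Average curvature. -/
noncomputable def avgCurvature (X : BranchedComplex) : ℝ := X.totalCurvature / X.totalArea

/-- The finite irreducible complexes `Y` of positive area that admit an essential map to `X`. -/
def Irred (X : BranchedComplex) : Set BranchedComplex :=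
  {Y | Y.IsFinite ∧ Nonempty Y.F ∧ Y.IsIrreducible ∧ ∃ φ : Hom Y X, φ.IsEssential}

/-- The closed surfaces `Y` of positive area that admit an essential map to `X`. -/
def Surf (X : BranchedComplex) : Set BranchedComplex :=
  {Y | Y.IsFinite ∧ Nonempty Y.F ∧ Y.IsSurface ∧ ∃ φ : Hom Y X, φ.IsEssential}

/-- Maximal irreducible curvature (`-∞` if `X.Irred` is empty). -/
noncomputable def rhoPlus (X : BranchedComplex) : EReal :=
  ⨆ Y ∈ X.Irred, (Y.avgCurvature : EReal)

/-- Minimal irreducible curvature (`+∞` if `X.Irred` is empty). -/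
noncomputable def rhoMinus (X : BranchedComplex) : EReal :=
  ⨅ Y ∈ X.Irred, (Y.avgCurvature : EReal)

/-- Maximal surface curvature (`-∞` if `X.Surf` is empty). -/
noncomputable def sigmaPlus (X : BranchedComplex) : EReal :=
  ⨆ Y ∈ X.Surf, (Y.avgCurvature : EReal)

/-- Minimal surface curvature (`+∞` if `X.Surf` is empty). -/
noncomputable def sigmaMinus (X : BranchedComplex) : EReal :=
  ⨅ Y ∈ X.Surf, (Y.avgCurvature : EReal)

/-! ## Group pairs and Nielsen equivalence -/

/-- The boundary of `f` as a closed edge path based at `init (bd f 0)`. -/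
def bdWord (X : BranchedComplex) (f : X.F) : List X.Dart :=
  (List.range (X.len f)).map fun i => X.bd f (i : ℕ)

theorem isWalk_bd (X : BranchedComplex) (f : X.F) (n : ℕ) :
    X.IsWalk (X.init (X.bd f 0)) ((List.range n).map fun i => X.bd f (i : ℕ))
      (X.init (X.bd f n)) := by
  induction n with
  | zero => simp [CombGraph.IsWalk]
  | succ n ih =>
    rw [List.range_succ, List.map_append]
    refine ih.append ⟨rfl, ?_⟩
    simpa [CombGraph.IsWalk] using X.bd_path f n

theorem isWalk_bdWord (X : BranchedComplex) (f : X.F) :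
    X.IsWalk (X.init (X.bd f 0)) (X.bdWord f) (X.init (X.bd f 0)) := by
  have h := X.isWalk_bd f (X.len f)
  have h2 := X.bd_periodic f 0
  rw [zero_add] at h2
  rw [h2] at h
  exact h

/-- The choices needed to write down the group pair of a connected complex: a base vertex, and for
each face a path from it to the boundary of the face. Other choices conjugate the boundary words
and give an isomorphic pair. -/
structure Marking (X : BranchedComplex) where
  base : X.V
  path : X.F → List X.Dart
  isWalk_path : ∀ f, X.IsWalk base (path f) (X.init (X.bd f 0))

namespace Marking

variable {X : BranchedComplex} (M : X.Marking)

/-- The fundamental group of the 1-skeleton. -/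
abbrev Grp : Type := X.pi1 M.base

/-- The element of the fundamental group of the 1-skeleton represented by the boundary of `f`. -/
def word (f : X.F) : M.Grp :=
  ⟨FreeGroup.mk (M.path f ++ X.bdWord f ++ FreeGroup.invRev (M.path f)),
    _, ((M.isWalk_path f).append (X.isWalk_bdWord f)).append (M.isWalk_path f).invRev, rfl⟩

/-- The set of the associated group pair: the disjoint union, over the faces, of the sets of left
cosets of the cyclic subgroups generated by the boundary words. The fundamental group acts on it by
left multiplication. -/
abbrev Cosets : Type := Σ f : X.F, M.Grp ⧸ Subgroup.zpowers (M.word f)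

/-- The invariant area function of the associated branched group pair. -/
def cosetArea (a : M.Cosets) : ℕ := X.area a.1

end Marking

/-- Isomorphism of branched group pairs `(G, A)` and `(H, B)`: a group isomorphism together with an
equivariant bijection that preserves area. -/
def PairIso (G A H B : Type) [Group G] [Group H] [MulAction G A] [MulAction H B]
    (areaA : A → ℕ) (areaB : B → ℕ) : Prop :=
  ∃ (φ : G ≃* H) (β : A ≃ B), (∀ g a, β (g • a) = φ g • β a) ∧ ∀ a, areaB (β a) = areaA a

/-- Nielsen equivalence of finite connected complexes: the associated branched group pairs are
isomorphic. For standard complexes the condition on areas holds automatically. -/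
def NielsenEquiv (X X' : BranchedComplex) : Prop :=
  ∃ (M : X.Marking) (M' : X'.Marking),
    PairIso M.Grp M.Cosets M'.Grp M'.Cosets M.cosetArea M'.cosetArea

end BranchedComplex

/-!
For every complex `Y` in `Irred X` there is a complex `W` in `Irred X'` with the same average
curvature, and likewise for surfaces (`NielsenEquiv.exists_irred`, `NielsenEquiv.exists_surf`). As
Nielsen equivalence is symmetric, the suprema and infima agree.

The complexes `Y` and `W` are compared through their group pairs. For a vertex `y` these consist of
the fundamental group of the 1-skeleton at `y`, acting on the *lines*: the lifts of the face
boundaries to the universal cover of the 1-skeleton, which is a tree. The relation `PairEquiv` says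
that the components of two complexes have isomorphic group pairs and that the areas of the faces
agree. It is implied by a fold that is a homotopy equivalence of 1-skeleta
(`Hom.IsFoldEquiv.pairEquiv`), and it preserves the average curvature
(`PairEquiv.avgCurvature_eq`), because the Euler characteristic of a finite graph is determined by
the fundamental groups of its components.

Two properties of the group pair detect the shape of a complex. They are expressed by almost
invariant sets of the fundamental group, which up to finite sets are the sets of vertices of the
universal cover with finitely many boundary edges in each orbit; such a set splits a line if it
separates the two ends of this line.

* A finite complex without vertices of valence at most `1` that has a disconnected link, or an edge
  that is traversed exactly once, has a non-trivial almost invariant set that splits at most one line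
  (`IsVisiblyReducible.hasWeakSplitting`): take the half-trees on one side of a vertex or an edge.
  A *tight* complex has no such set (`IsTight.not_hasWeakSplitting`), because connectedness of
  the links, also after the removal of a corner, propagates the values of the set at the ends of the
  tree from line to line. Visibly irreducible complexes and surfaces are tight; for the
  former, a cut vertex of a link would allow an unfolding (`IsSide.hasUnfolding`).
* If an edge of a tight complex is traversed more than twice, then the half-tree beyond it is an
  indecomposable set that splits three lines (`IsTight.hasTripodAt`). In the universal cover of a
  surface an indecomposable set splits at most two lines (`IsSurface.not_hasTripodAt`), since its
  half-trees are cyclically arranged by the lines.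

The complex `W` is constructed as follows. Folding `Y` gives an immersion `Z → X`, which corresponds
to an action of the fundamental group of `X` on the fibre of a covering, with a point of
the fibre for each face of `Z`. The isomorphism of the fundamental groups of `X` and `X'` turns these
data into a covering of the 1-skeleton of `X'` with lifted faces (`GroupPairIso.coverData`), which
has the same group pairs as `Z`. It may be infinite, but its group pairs are carried by a finite core
`K` without vertices of valence at most `1` (`PathEquiv.exists_core`). Among the complexes that fold
to `K` without changing the group pairs there is one, `W`, that cannot be unfolded further: none of
them is visibly reducible, by the first property, so every edge is traversed and the
number of edges is bounded by the total length of the faces (`exists_isVisiblyIrreducible`). Hence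
`W` is visibly irreducible. If `Y` is a surface, then every edge of `W` is traversed exactly
twice by the second property, and so `W` is a surface.
-/

namespace CombGraph

variable {G : CombGraph}

/-! ### Homotopy classes of edge paths -/

/-- The homotopy classes of edge paths from `u` to `v`. -/
def pathClass (G : CombGraph) (u v : G.V) : Set (FreeGroup G.E) :=
  {g | ∃ l : List G.Dart, G.IsWalk u l v ∧ FreeGroup.mk l = g}

theorem flip_ne (d : G.Dart) : G.flip d ≠ d := by
  obtain ⟨e, b⟩ := d
  simp [flip]

theorem flip_injective : Function.Injective G.flip := fun a b h => by
  rw [← G.flip_flip a, h, G.flip_flip]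

theorem init_flip (d : G.Dart) : G.init (G.flip d) = G.term d := rfl

theorem flip_eq_iff {d d' : G.Dart} : G.flip d = d' ↔ d = G.flip d' :=
  ⟨fun h => by rw [← h, flip_flip], fun h => by rw [h, flip_flip]⟩

theorem mk_flip (d : G.Dart) :
    (FreeGroup.mk [G.flip d] : FreeGroup G.E) = (FreeGroup.mk [d])⁻¹ := by
  rw [FreeGroup.inv_mk]; rfl

theorem reducedStep_iff {a b : G.Dart} : (a.1 = b.1 → a.2 = b.2) ↔ b ≠ G.flip a := by
  obtain ⟨e, s⟩ := a
  obtain ⟨e', s'⟩ := b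
  simp only [flip, ne_eq, Prod.mk.injEq, not_and]
  constructor
  · intro h h1; rw [← h h1.symm]; cases s <;> simp
  · intro h h1; have := h h1.symm; revert this; cases s <;> cases s' <;> simp

theorem eq_of_isReduced_of_mk_eq {α : Type} {l m : List (α × Bool)} (hl : FreeGroup.IsReduced l)
    (hm : FreeGroup.IsReduced m) (h : FreeGroup.mk l = FreeGroup.mk m) : l = m := by
  classical
  rw [← hl.reduce_eq, ← hm.reduce_eq]
  exact FreeGroup.reduce.sound h

theorem IsWalk.of_red {u v : G.V} {l m : List G.Dart} (h : G.IsWalk u l v)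
    (hr : FreeGroup.Red l m) : G.IsWalk u m v := by
  induction hr with
  | refl => exact h
  | tail _ hs ih => exact ih.of_step hs

theorem IsWalk.split {u v : G.V} {l m : List G.Dart} (h : G.IsWalk u (l ++ m) v) :
    ∃ w, G.IsWalk u l w ∧ G.IsWalk w m v := by
  induction l generalizing u with
  | nil => exact ⟨u, rfl, h⟩
  | cons d l ih =>
    obtain ⟨w, h1, h2⟩ := ih h.2
    exact ⟨w, ⟨h.1, h1⟩, h2⟩

theorem IsWalk.end_unique {u v w : G.V} {l : List G.Dart} (h : G.IsWalk u l v)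
    (h' : G.IsWalk u l w) : v = w := by
  induction l generalizing u with
  | nil => exact h.symm.trans h'
  | cons d l ih => exact ih h.2 h'.2

theorem IsWalk.concat_iff {u v : G.V} {l : List G.Dart} {d : G.Dart} :
    G.IsWalk u (l ++ [d]) v ↔ G.IsWalk u l (G.init d) ∧ G.term d = v := by
  constructor
  · intro h
    obtain ⟨w, h1, h2, h3⟩ := h.split
    subst h2
    exact ⟨h1, h3⟩
  · rintro ⟨h1, h2⟩
    exact h1.append ⟨rfl, h2⟩

theorem isWalk_singleton (d : G.Dart) : G.IsWalk (G.init d) [d] (G.term d) := ⟨rfl, rfl⟩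

theorem exists_reduced {u v : G.V} {g : FreeGroup G.E} (h : g ∈ G.pathClass u v) :
    ∃ l, G.IsWalk u l v ∧ FreeGroup.IsReduced l ∧ FreeGroup.mk l = g := by
  classical
  obtain ⟨l, h1, rfl⟩ := h
  exact ⟨FreeGroup.reduce l, h1.of_red FreeGroup.reduce.red,
    FreeGroup.IsReduced.of_reduce_eq FreeGroup.reduce.idem, FreeGroup.reduce.self⟩

theorem IsWalk.of_mk_eq {u v : G.V} {l m : List G.Dart} (h : G.IsWalk u l v)
    (hm : FreeGroup.IsReduced m) (he : FreeGroup.mk m = FreeGroup.mk l) : G.IsWalk u m v := by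
  obtain ⟨k, h1, h2, h3⟩ := exists_reduced (g := FreeGroup.mk l) ⟨l, h, rfl⟩
  rwa [eq_of_isReduced_of_mk_eq hm h2 (he.trans h3.symm)]

theorem IsWalk.mem {u v : G.V} {l : List G.Dart} (h : G.IsWalk u l v) :
    FreeGroup.mk l ∈ G.pathClass u v := ⟨l, h, rfl⟩

theorem one_mem_pathClass (u : G.V) : (1 : FreeGroup G.E) ∈ G.pathClass u u := ⟨[], rfl, rfl⟩

theorem dart_mem_pathClass (d : G.Dart) :
    (FreeGroup.mk [d] : FreeGroup G.E) ∈ G.pathClass (G.init d) (G.term d) :=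
  (isWalk_singleton d).mem

theorem mul_mem_pathClass {u v w : G.V} {g h : FreeGroup G.E} (hg : g ∈ G.pathClass u v)
    (hh : h ∈ G.pathClass v w) : g * h ∈ G.pathClass u w := by
  obtain ⟨l, h1, rfl⟩ := hg
  obtain ⟨m, h2, rfl⟩ := hh
  exact ⟨l ++ m, h1.append h2, FreeGroup.mul_mk.symm⟩

theorem inv_mem_pathClass {u v : G.V} {g : FreeGroup G.E} (hg : g ∈ G.pathClass u v) :
    g⁻¹ ∈ G.pathClass v u := by
  obtain ⟨l, h1, rfl⟩ := hg
  exact ⟨_, h1.invRev, FreeGroup.inv_mk.symm⟩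

theorem mem_pi1 {u : G.V} {g : FreeGroup G.E} : g ∈ G.pi1 u ↔ g ∈ G.pathClass u u := Iff.rfl

theorem pathClass_end_unique {u v w : G.V} {g : FreeGroup G.E} (h : g ∈ G.pathClass u v)
    (h' : g ∈ G.pathClass u w) : v = w := by
  obtain ⟨_, h1, h2, rfl⟩ := exists_reduced h
  obtain ⟨m, h3, rfl'⟩ := h'
  exact h1.end_unique (h3.of_mk_eq h2 rfl'.symm)

theorem joined_iff {u v : G.V} : G.Joined u v ↔ ∃ g, g ∈ G.pathClass u v :=
  ⟨fun ⟨_, h⟩ => ⟨_, h.mem⟩, fun ⟨_, l, h, _⟩ => ⟨l, h⟩⟩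

theorem Joined.refl (u : G.V) : G.Joined u u := ⟨[], rfl⟩

theorem Joined.symm {u v : G.V} (h : G.Joined u v) : G.Joined v u := by
  obtain ⟨l, h⟩ := h
  exact ⟨_, h.invRev⟩

theorem Joined.trans {u v w : G.V} (h : G.Joined u v) (h' : G.Joined v w) : G.Joined u w := by
  obtain ⟨l, h⟩ := h
  obtain ⟨l', h'⟩ := h'
  exact ⟨_, h.append h'⟩

theorem joined_dart (d : G.Dart) : G.Joined (G.init d) (G.term d) := ⟨_, isWalk_singleton d⟩

theorem joined_of_mem {u v : G.V} {g : FreeGroup G.E} (h : g ∈ G.pathClass u v) : G.Joined u v :=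
  joined_iff.2 ⟨g, h⟩

theorem mk_cons {α : Type} (d : α × Bool) (l : List (α × Bool)) :
    FreeGroup.mk (d :: l) = FreeGroup.mk [d] * FreeGroup.mk l := by
  rw [FreeGroup.mul_mk]; rfl

theorem mk_concat {α : Type} (d : α × Bool) (l : List (α × Bool)) :
    FreeGroup.mk (l ++ [d]) = FreeGroup.mk l * FreeGroup.mk [d] := by
  rw [FreeGroup.mul_mk]

/-- Path classes are generated by the classes of single oriented edges. -/
theorem pathClass_induction {P : G.V → G.V → FreeGroup G.E → Prop} (one : ∀ u, P u u 1)
    (cons : ∀ d v g, g ∈ G.pathClass (G.term d) v → P (G.term d) v g →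
      P (G.init d) v (FreeGroup.mk [d] * g))
    {u v : G.V} {g : FreeGroup G.E} (h : g ∈ G.pathClass u v) : P u v g := by
  obtain ⟨l, h1, rfl⟩ := h
  induction l generalizing u with
  | nil => cases h1; exact one _
  | cons d l ih =>
    obtain ⟨rfl, h2⟩ := h1
    rw [mk_cons]
    exact cons d v _ h2.mem (ih h2)

theorem isReduced_concat {l : List G.Dart} {d : G.Dart} :
    FreeGroup.IsReduced (l ++ [d]) ↔
      FreeGroup.IsReduced l ∧ ∀ a, l.getLast? = some a → d ≠ G.flip a := by
  unfold FreeGroup.IsReduced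
  rw [List.isChain_append]
  simp only [List.isChain_singleton, true_and, List.head?_cons, Option.mem_def,
    Option.some.injEq, forall_eq', reducedStep_iff]

end CombGraph

namespace BranchedComplex

open CombGraph

variable {X Y Z : BranchedComplex}

/-- The oriented edges `bd f i, …, bd f (i + n - 1)` of the boundary of a face. -/
def bdList (X : BranchedComplex) (f : X.F) (i : ℤ) (n : ℕ) : List X.Dart :=
  (List.range n).map fun k => X.bd f (i + (k : ℕ))

theorem bdList_zero (f : X.F) (i : ℤ) : X.bdList f i 0 = [] := rfl

theorem length_bdList (f : X.F) (i : ℤ) (n : ℕ) : (X.bdList f i n).length = n := by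
  simp [bdList]

theorem bdList_succ (f : X.F) (i : ℤ) (n : ℕ) :
    X.bdList f i (n + 1) = X.bdList f i n ++ [X.bd f (i + n)] := by
  simp [bdList, List.range_succ]

theorem bdList_succ' (f : X.F) (i : ℤ) (n : ℕ) :
    X.bdList f i (n + 1) = X.bd f i :: X.bdList f (i + 1) n := by
  simp only [bdList, List.range_succ_eq_map, List.map_cons, List.map_map]
  congr 1
  · simp
  · refine List.map_congr_left fun k _ => ?_
    simp only [Function.comp]
    congr 1
    push_cast
    ring

theorem bdList_add (f : X.F) (i : ℤ) (m n : ℕ) :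
    X.bdList f i (m + n) = X.bdList f i m ++ X.bdList f (i + m) n := by
  induction n with
  | zero => simp [bdList_zero]
  | succ n ih =>
    rw [← add_assoc, bdList_succ, ih, bdList_succ, List.append_assoc]
    congr 4
    push_cast
    ring

theorem bdWord_eq (f : X.F) : X.bdWord f = X.bdList f 0 (X.len f) := by
  simp [bdWord, bdList]

theorem isWalk_bdList (f : X.F) (i : ℤ) (n : ℕ) :
    X.IsWalk (X.init (X.bd f i)) (X.bdList f i n) (X.init (X.bd f (i + n))) := by
  induction n with
  | zero => simp [bdList_zero, IsWalk]
  | succ n ih =>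
    rw [bdList_succ, IsWalk.concat_iff]
    refine ⟨ih, ?_⟩
    rw [X.bd_path]
    push_cast
    rw [add_assoc]

theorem isReduced_bdList (f : X.F) (i : ℤ) (n : ℕ) : FreeGroup.IsReduced (X.bdList f i n) := by
  induction n with
  | zero => exact FreeGroup.IsReduced.nil
  | succ n ih =>
    rw [bdList_succ, isReduced_concat]
    refine ⟨ih, fun a ha => ?_⟩
    cases n with
    | zero => simp [bdList_zero] at ha
    | succ n =>
      rw [bdList_succ, List.getLast?_concat, Option.some.injEq] at ha
      subst ha
      have := X.bd_immersed f (i + n)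
      rwa [add_assoc] at this

/-- The class of the path that runs along the boundary of `f` from its corner `0` to its
corner `n`. -/
def bdPath (X : BranchedComplex) (f : X.F) (n : ℤ) : FreeGroup X.E :=
  if 0 ≤ n then FreeGroup.mk (X.bdList f 0 n.toNat)
  else (FreeGroup.mk (X.bdList f n (-n).toNat))⁻¹

@[simp] theorem bdPath_zero (f : X.F) : X.bdPath f 0 = 1 := rfl

theorem bdPath_natCast (f : X.F) (n : ℕ) : X.bdPath f n = FreeGroup.mk (X.bdList f 0 n) := by
  simp [bdPath]

theorem bdPath_neg_natCast (f : X.F) (n : ℕ) :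
    X.bdPath f (-n) = (FreeGroup.mk (X.bdList f (-n) n))⁻¹ := by
  rcases n with _ | n
  · simp [bdList_zero, ← FreeGroup.one_eq_mk]
  · rw [bdPath, if_neg (by omega)]
    congr 3

theorem bdPath_succ (f : X.F) (n : ℤ) :
    X.bdPath f (n + 1) = X.bdPath f n * FreeGroup.mk [X.bd f n] := by
  obtain ⟨n, rfl | rfl⟩ := n.eq_nat_or_neg
  · rw [bdPath_natCast, ← Nat.cast_succ, bdPath_natCast, bdList_succ, FreeGroup.mul_mk, zero_add]
  · rcases n with _ | n
    · have := bdPath_natCast f 1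
      simp only [Nat.cast_one] at this
      simp [this, bdList]
    · have h : (-((n + 1 : ℕ) : ℤ) + 1) = -(n : ℤ) := by push_cast; ring
      rw [h, bdPath_neg_natCast, bdPath_neg_natCast, bdList_succ', h,
        mk_cons, mul_inv_rev, inv_mul_cancel_right]

theorem bdPath_add (f : X.F) (m : ℤ) (n : ℕ) :
    X.bdPath f (m + n) = X.bdPath f m * FreeGroup.mk (X.bdList f m n) := by
  induction n with
  | zero => simp [bdList_zero, ← FreeGroup.one_eq_mk]
  | succ n ih =>
    rw [bdList_succ, mk_concat, ← mul_assoc, ← ih, ← bdPath_succ]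
    push_cast
    ring_nf

theorem bdPath_mem' (f : X.F) (m : ℤ) (n : ℕ) :
    (X.bdPath f m)⁻¹ * X.bdPath f (m + n) ∈
      X.pathClass (X.init (X.bd f m)) (X.init (X.bd f (m + n))) := by
  rw [bdPath_add, inv_mul_cancel_left]
  exact (isWalk_bdList f m n).mem

theorem bdPath_sub_mem (f : X.F) (m n : ℤ) :
    (X.bdPath f m)⁻¹ * X.bdPath f n ∈
      X.pathClass (X.init (X.bd f m)) (X.init (X.bd f n)) := by
  rcases le_total m n with h | h
  · obtain ⟨k, rfl⟩ := Int.le.dest h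
    exact bdPath_mem' f m k
  · obtain ⟨k, rfl⟩ := Int.le.dest h
    have := inv_mem_pathClass (bdPath_mem' f n k)
    rwa [mul_inv_rev, inv_inv] at this

theorem bdPath_mem (f : X.F) (n : ℤ) :
    X.bdPath f n ∈ X.pathClass (X.init (X.bd f 0)) (X.init (X.bd f n)) := by
  simpa using bdPath_sub_mem f 0 n

/-- The class of the boundary of `f`, based at its corner `0`. -/
def bdLoop (X : BranchedComplex) (f : X.F) : FreeGroup X.E := X.bdPath f (X.len f)

theorem bdLoop_eq (f : X.F) : X.bdLoop f = FreeGroup.mk (X.bdWord f) := by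
  rw [bdLoop, bdPath_natCast, bdWord_eq]

theorem bd_add_mul (f : X.F) (i k : ℤ) : X.bd f (i + k * X.len f) = X.bd f i := by
  induction k with
  | zero => simp
  | succ k ih => rw [add_mul, one_mul, ← add_assoc, X.bd_periodic, ih]
  | pred k ih =>
    rw [← ih, sub_mul, one_mul, ← X.bd_periodic f (i + (-(k : ℤ) * X.len f - X.len f))]
    congr 1
    ring

theorem bd_congr (f : X.F) {i j : ℤ} (h : i ≡ j [ZMOD X.len f]) : X.bd f i = X.bd f j := by
  obtain ⟨k, hk⟩ := h.dvd
  have : j = i + k * X.len f := by rw [mul_comm]; omega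
  rw [this, bd_add_mul]

theorem bdPath_len_add (f : X.F) (n : ℤ) :
    X.bdPath f (X.len f + n) = X.bdLoop f * X.bdPath f n := by
  induction n with
  | zero => simp [bdLoop]
  | succ n ih =>
    rw [← add_assoc, bdPath_succ, ih, bdPath_succ, mul_assoc]
    congr 3
    rw [add_comm, X.bd_periodic]
  | pred n ih =>
    have h1 := bdPath_succ f (X.len f + (-(n : ℤ) - 1))
    have h2 := bdPath_succ f (-(n : ℤ) - 1)
    rw [show (X.len f : ℤ) + (-(n : ℤ) - 1) + 1 = X.len f + -(n : ℤ) by ring, ih,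
      show -(n : ℤ) = -(n : ℤ) - 1 + 1 by ring, h2, ← mul_assoc] at h1
    rw [show X.len f + (-(n : ℤ) - 1 + 1 - 1) = -(n : ℤ) - 1 + X.len f by ring,
      X.bd_periodic, add_comm _ (X.len f : ℤ)] at h1
    simpa using (mul_right_cancel h1).symm

theorem bdPath_mul_len_add (f : X.F) (k n : ℤ) :
    X.bdPath f (k * X.len f + n) = X.bdLoop f ^ k * X.bdPath f n := by
  induction k with
  | zero => simp
  | succ k ih =>
    rw [show ((k : ℤ) + 1) * X.len f + n = X.len f + (k * X.len f + n) by ring, bdPath_len_add, ih,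
      ← mul_assoc, ← zpow_one_add, add_comm]
  | pred k ih =>
    have h := bdPath_len_add f ((-(k : ℤ) - 1) * X.len f + n)
    rw [show (X.len f : ℤ) + ((-(k : ℤ) - 1) * X.len f + n) = -(k : ℤ) * X.len f + n by ring,
      ih] at h
    rw [eq_inv_mul_of_mul_eq h.symm, ← mul_assoc, ← zpow_neg_one, ← zpow_add]
    congr 2
    ring

theorem bdPath_mul_len (f : X.F) (k : ℤ) : X.bdPath f (k * X.len f) = X.bdLoop f ^ k := by
  simpa using bdPath_mul_len_add f k 0

theorem bdLoop_mem (f : X.F) :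
    X.bdLoop f ∈ X.pathClass (X.init (X.bd f 0)) (X.init (X.bd f 0)) := by
  have := bdPath_mem f (X.len f)
  rwa [show X.bd f (X.len f) = X.bd f 0 by simpa using X.bd_periodic f 0] at this

theorem bdLoop_zpow_mem (f : X.F) (k : ℤ) :
    X.bdLoop f ^ k ∈ X.pathClass (X.init (X.bd f 0)) (X.init (X.bd f 0)) :=
  (X.pi1 _).zpow_mem (bdLoop_mem f) k

theorem bdPath_injective (f : X.F) : Function.Injective (X.bdPath f) := by
  intro m n h
  wlog hmn : m ≤ n generalizing m n
  · exact (this h.symm (by omega)).symm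
  obtain ⟨k, rfl⟩ := Int.le.dest hmn
  rw [bdPath_add, left_eq_mul] at h
  have := eq_of_isReduced_of_mk_eq (isReduced_bdList f m k) FreeGroup.IsReduced.nil h
  have h2 := length_bdList f m k
  rw [this] at h2
  simp at h2
  omega

theorem bdLoop_zpow_injective (f : X.F) : Function.Injective fun k : ℤ => X.bdLoop f ^ k := by
  intro m n h
  simp only [← bdPath_mul_len] at h
  have := bdPath_injective f h
  have hl := X.len_pos f
  exact Int.eq_of_mul_eq_mul_right (by omega) this

end BranchedComplex

namespace BranchedComplex

open CombGraph

variable {X Y Z : BranchedComplex}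

/-! ### Morphisms, folds and immersions -/

namespace Hom

theorem term_dart (φ : Hom Y X) (d : Y.Dart) : X.term (φ.dart d) = φ.vert (Y.term d) := by
  rw [term, ← φ.dart_flip, φ.init_dart]; rfl

theorem isWalk_map (φ : Hom Y X) {u v : Y.V} {l : List Y.Dart} (h : Y.IsWalk u l v) :
    X.IsWalk (φ.vert u) (l.map φ.dart) (φ.vert v) := by
  induction l generalizing u with
  | nil => exact congrArg φ.vert h
  | cons d l ih =>
    obtain ⟨rfl, h⟩ := h
    refine ⟨φ.init_dart d, ?_⟩
    rw [term_dart]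
    exact ih h

theorem edgeMap_dart (φ : Hom Y X) (d : Y.Dart) :
    φ.edgeMap (FreeGroup.mk [d]) = FreeGroup.mk [φ.dart d] := by
  have key : ∀ e, φ.edgeMap (FreeGroup.mk [(e, true)]) = FreeGroup.mk [φ.dart (e, true)] :=
    fun e => by simp [edgeMap, FreeGroup.lift_mk]
  obtain ⟨e, b⟩ := d
  cases b
  · have h : ((e, false) : Y.Dart) = Y.flip (e, true) := rfl
    rw [h, mk_flip, _root_.map_inv, key, φ.dart_flip, mk_flip]
  · exact key e

theorem edgeMap_mk (φ : Hom Y X) (l : List Y.Dart) :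
    φ.edgeMap (FreeGroup.mk l) = FreeGroup.mk (l.map φ.dart) := by
  induction l with
  | nil => exact _root_.map_one _
  | cons d l ih => rw [mk_cons, _root_.map_mul, ih, edgeMap_dart, List.map_cons, ← mk_cons]

theorem edgeMap_mem (φ : Hom Y X) {u v : Y.V} {g : FreeGroup Y.E} (h : g ∈ Y.pathClass u v) :
    φ.edgeMap g ∈ X.pathClass (φ.vert u) (φ.vert v) := by
  obtain ⟨l, h, rfl⟩ := h
  rw [edgeMap_mk]
  exact (φ.isWalk_map h).mem

theorem joined_map (φ : Hom Y X) {u v : Y.V} (h : Y.Joined u v) :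
    X.Joined (φ.vert u) (φ.vert v) := by
  obtain ⟨l, h⟩ := h
  exact ⟨_, φ.isWalk_map h⟩

/-- `φ` is an immersion of 1-skeleta: it is injective on the oriented edges issuing from any given
vertex. -/
def IsGraphImmersion (φ : Hom Y X) : Prop :=
  ∀ d d', Y.init d = Y.init d' → φ.dart d = φ.dart d' → d = d'

theorem IsGraphImmersion.isReduced_map {φ : Hom Y X} (hφ : φ.IsGraphImmersion) {u v : Y.V}
    {l : List Y.Dart} (h : Y.IsWalk u l v) (hl : FreeGroup.IsReduced l) :
    FreeGroup.IsReduced (l.map φ.dart) := by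
  induction l using List.reverseRecOn generalizing v with
  | nil => exact FreeGroup.IsReduced.nil
  | append_singleton l d ih =>
    rw [IsWalk.concat_iff] at h
    rw [isReduced_concat] at hl
    rw [List.map_append, List.map_singleton, isReduced_concat]
    refine ⟨ih h.1 hl.1, fun a ha hda => ?_⟩
    rw [List.getLast?_map, Option.map_eq_some_iff] at ha
    obtain ⟨b, hb, rfl⟩ := ha
    refine hl.2 b hb (hφ _ _ ?_ (hda.trans (φ.dart_flip b).symm))
    obtain ⟨m, rfl⟩ := List.getLast?_eq_some_iff.1 hb
    rw [init_flip, ← (IsWalk.concat_iff.1 h.1).2]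

theorem IsGraphImmersion.eq_of_map_eq {φ : Hom Y X} (hφ : φ.IsGraphImmersion) {u v w : Y.V}
    {l m : List Y.Dart} (h : Y.IsWalk u l v) (h' : Y.IsWalk u m w)
    (he : l.map φ.dart = m.map φ.dart) : l = m := by
  induction l generalizing u m with
  | nil =>
    rw [List.map_nil, eq_comm, List.map_eq_nil_iff] at he
    exact he.symm
  | cons d l ih =>
    cases m with
    | nil => simp at he
    | cons d' m =>
      rw [List.map_cons, List.map_cons, List.cons.injEq] at he
      obtain rfl := hφ d d' (h.1.trans h'.1.symm) he.1
      rw [ih h.2 h'.2 he.2]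

/-- Path classes with the same origin lift uniquely through an immersion of graphs. -/
theorem IsGraphImmersion.edgeMap_inj {φ : Hom Y X} (hφ : φ.IsGraphImmersion) {u v w : Y.V}
    {g h : FreeGroup Y.E} (hg : g ∈ Y.pathClass u v) (hh : h ∈ Y.pathClass u w)
    (he : φ.edgeMap g = φ.edgeMap h) : g = h := by
  obtain ⟨l, h1, h2, rfl⟩ := exists_reduced hg
  obtain ⟨m, h3, h4, rfl⟩ := exists_reduced hh
  rw [edgeMap_mk, edgeMap_mk] at he
  rw [hφ.eq_of_map_eq h1 h3
    (eq_of_isReduced_of_mk_eq (hφ.isReduced_map h1 h2) (hφ.isReduced_map h3 h4) he)]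

theorem IsBranchedImmersion.isGraphImmersion {φ : Hom Y X} (h : φ.IsBranchedImmersion) :
    φ.IsGraphImmersion := h.1

/-- The image of a corner lies at the image of the vertex. -/
theorem init_bd_corner (φ : Hom Y X) (f : Y.F) (i : ℤ) :
    X.init (X.bd (φ.face f) (φ.corner f i)) = φ.vert (Y.init (Y.bd f i)) := by
  rw [← φ.init_dart, φ.dart_bd, corner]
  split_ifs with h
  · rw [init_flip, X.bd_path, sub_add_cancel]
  · rfl

theorem edgeMap_bdPath (φ : Hom Y X) (f : Y.F) (n : ℤ) :
    φ.edgeMap (Y.bdPath f n) =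
      (X.bdPath (φ.face f) (φ.corner f 0))⁻¹ * X.bdPath (φ.face f) (φ.corner f n) := by
  have key : ∀ n, φ.edgeMap (FreeGroup.mk [Y.bd f n]) =
      (X.bdPath (φ.face f) (φ.corner f n))⁻¹ * X.bdPath (φ.face f) (φ.corner f (n + 1)) := by
    intro n
    rw [edgeMap_dart, φ.dart_bd]
    unfold corner
    split_ifs with h
    · have := bdPath_succ (φ.face f) (φ.shift f - n - 1)
      rw [sub_add_cancel] at this
      rw [this, mk_flip, show φ.shift f - (n + 1) = φ.shift f - n - 1 by ring]
      group
    · rw [← add_assoc, bdPath_succ, inv_mul_cancel_left]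
  induction n with
  | zero => simp
  | succ n ih => rw [bdPath_succ, _root_.map_mul, ih, key]; group
  | pred n ih =>
    have h1 := bdPath_succ f (-(n : ℤ) - 1)
    rw [sub_add_cancel] at h1
    have h2 := key (-(n : ℤ) - 1)
    rw [sub_add_cancel] at h2
    rw [h1, _root_.map_mul, h2, ← eq_mul_inv_iff_mul_eq] at ih
    rw [ih]
    group

/-- The sign with which `φ` runs along the boundaries of faces. -/
def sgn (φ : Hom Y X) (f : Y.F) : ℤ := if φ.rev f then -1 else 1

theorem corner_eq (φ : Hom Y X) (f : Y.F) (i : ℤ) :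
    φ.corner f i = φ.shift f + φ.sgn f * i := by
  unfold corner sgn
  split_ifs <;> ring

theorem sgn_mul_self (φ : Hom Y X) (f : Y.F) : φ.sgn f * φ.sgn f = 1 := by
  unfold sgn
  split_ifs <;> rfl

theorem edgeMap_bdLoop (φ : Hom Y X) (f : Y.F) :
    φ.edgeMap (Y.bdLoop f) = (X.bdPath (φ.face f) (φ.shift f))⁻¹ *
      X.bdLoop (φ.face f) ^ (φ.sgn f * φ.mult f) * X.bdPath (φ.face f) (φ.shift f) := by
  rw [bdLoop, edgeMap_bdPath, corner_eq, corner_eq, mul_zero, add_zero, φ.len_eq, mul_assoc,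
    ← bdPath_mul_len_add]
  congr 2
  push_cast
  ring

/-- The identity morphism. -/
def id (X : BranchedComplex) : Hom X X where
  vert v := v
  dart d := d
  init_dart _ := rfl
  dart_flip _ := rfl
  face f := f
  mult _ := 1
  mult_pos _ := one_pos
  rev _ := false
  shift _ := 0
  len_eq _ := (one_mul _).symm
  area_eq _ := (one_mul _).symm
  dart_bd f i := by simp

/-- Composition of morphisms: first `φ`, then `ψ`. -/
def comp (φ : Hom Y Z) (ψ : Hom Z X) : Hom Y X where
  vert v := ψ.vert (φ.vert v)
  dart d := ψ.dart (φ.dart d)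
  init_dart d := by rw [ψ.init_dart, φ.init_dart]
  dart_flip d := by rw [φ.dart_flip, ψ.dart_flip]
  face f := ψ.face (φ.face f)
  mult f := φ.mult f * ψ.mult (φ.face f)
  mult_pos f := Nat.mul_pos (φ.mult_pos f) (ψ.mult_pos _)
  rev f := xor (φ.rev f) (ψ.rev (φ.face f))
  shift f := ψ.corner (φ.face f) (φ.shift f)
  len_eq f := by rw [φ.len_eq, ψ.len_eq, mul_assoc]
  area_eq f := by rw [φ.area_eq, ψ.area_eq, mul_assoc]
  dart_bd f i := by
    rw [φ.dart_bd]
    unfold corner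
    cases h1 : φ.rev f <;> cases h2 : ψ.rev (φ.face f) <;>
      simp only [Bool.false_eq_true, if_true, if_false, ψ.dart_flip, ψ.dart_bd, h2, CombGraph.flip_flip,
        Bool.xor_false, Bool.xor_true, Bool.not_false, Bool.not_true] <;> ring_nf

theorem comp_corner (φ : Hom Y Z) (ψ : Hom Z X) (f : Y.F) (i : ℤ) :
    (φ.comp ψ).corner f i = ψ.corner (φ.face f) (φ.corner f i) := by
  unfold comp corner
  cases h1 : φ.rev f <;> cases h2 : ψ.rev (φ.face f) <;> simp [h1, h2] <;> ring

theorem isComp_comp (φ : Hom Y Z) (ψ : Hom Z X) : (φ.comp ψ).IsComp φ ψ :=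
  ⟨fun _ => rfl, fun _ => rfl, fun _ => rfl, fun f i => by rw [comp_corner]⟩

theorem isComp_id (φ : Hom Y X) : φ.IsComp φ (id X) :=
  ⟨fun _ => rfl, fun _ => rfl, fun _ => rfl, fun f i => by simp [id, corner]⟩

theorem comp_edgeMap (φ : Hom Y Z) (ψ : Hom Z X) (g : FreeGroup Y.E) :
    (φ.comp ψ).edgeMap g = ψ.edgeMap (φ.edgeMap g) := by
  induction g using Quot.induction_on with
  | _ l =>
    rw [FreeGroup.quot_mk_eq_mk, edgeMap_mk, edgeMap_mk, edgeMap_mk, List.map_map]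
    rfl

theorem id_isIso (X : BranchedComplex) : (id X).IsIso :=
  ⟨Function.bijective_id, Function.bijective_id, Function.bijective_id, fun _ => rfl⟩

theorem id_isBranchedImmersion (X : BranchedComplex) : (id X).IsBranchedImmersion := by
  refine ⟨fun d d' _ h => h, ?_⟩
  intro f i f' i' _ h1 h2
  obtain rfl : f = f' := h1
  refine ⟨rfl, ?_⟩
  simpa [corner, id] using h2

theorem IsBranchedImmersion.comp {φ : Hom Y Z} {ψ : Hom Z X} (hφ : φ.IsBranchedImmersion)
    (hψ : ψ.IsBranchedImmersion) : (φ.comp ψ).IsBranchedImmersion := by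
  constructor
  · intro d d' h h'
    exact hφ.1 d d' h (hψ.1 _ _ (by rw [φ.init_dart, φ.init_dart, h]) h')
  · intro f i f' i' h1 h2 h3
    rw [comp_corner, comp_corner] at h3
    obtain ⟨h4, h5⟩ := hψ.2 (φ.face f) (φ.corner f i) (φ.face f') (φ.corner f' i')
      (by rw [init_bd_corner, init_bd_corner, h1]) h2 h3
    exact hφ.2 f i f' i' h1 h4 h5

/-- A morphism that is onto and induces a homotopy equivalence of 1-skeleta and a homeomorphism on
open faces: the fold maps that occur in essential maps. -/
structure IsFoldEquiv (φ : Hom Y X) : Prop where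
  vert : Function.Surjective φ.vert
  dart : Function.Surjective φ.dart
  graph : φ.IsGraphEquiv
  faces : φ.IsFaceHomeo

theorem IsGraphEquiv.comp {φ : Hom Y Z} {ψ : Hom Z X} (hφ : φ.IsGraphEquiv)
    (hψ : ψ.IsGraphEquiv) : (φ.comp ψ).IsGraphEquiv := by
  refine ⟨fun u v h => hφ.1 u v (hψ.1 _ _ h), fun w => ?_, fun v => ?_⟩
  · obtain ⟨z, hz⟩ := hψ.2.1 w
    obtain ⟨v, hv⟩ := hφ.2.1 z
    exact ⟨v, (ψ.joined_map hv).trans hz⟩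
  · have h := (hψ.2.2 (φ.vert v)).comp (hφ.2.2 v)
    have he : ((φ.comp ψ).edgeMap : FreeGroup Y.E → FreeGroup X.E) = ψ.edgeMap ∘ φ.edgeMap :=
      funext fun g => comp_edgeMap φ ψ g
    rw [he]
    exact h

theorem IsFoldEquiv.comp {φ : Hom Y Z} {ψ : Hom Z X} (hφ : φ.IsFoldEquiv)
    (hψ : ψ.IsFoldEquiv) : (φ.comp ψ).IsFoldEquiv where
  vert := hψ.vert.comp hφ.vert
  dart := hψ.dart.comp hφ.dart
  graph := hφ.graph.comp hψ.graph
  faces := ⟨hψ.faces.1.comp hφ.faces.1, fun f => by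
    change φ.mult f * ψ.mult (φ.face f) = 1
    rw [hφ.faces.2, hψ.faces.2]⟩

theorem IsIso.isFoldEquiv {φ : Hom Y X} (h : φ.IsIso) : φ.IsFoldEquiv := by
  obtain ⟨h1, h2, h3, h4⟩ := h
  have lift : ∀ {l : List X.Dart} {u v : Y.V}, X.IsWalk (φ.vert u) l (φ.vert v) →
      ∃ m, Y.IsWalk u m v ∧ m.map φ.dart = l := by
    intro l
    induction l with
    | nil => exact fun h => ⟨[], h1.1 h, rfl⟩
    | cons d l ih =>
      intro u v h
      obtain ⟨d, rfl⟩ := h2.2 d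
      obtain ⟨h5, h6⟩ := h
      rw [φ.init_dart] at h5
      rw [term_dart] at h6
      obtain ⟨m, h7, rfl⟩ := ih h6
      exact ⟨d :: m, ⟨h1.1 h5, h7⟩, rfl⟩
  refine ⟨h1.2, h2.2, ⟨fun u v h => ?_, fun w => ?_, fun v => ⟨?_, ?_, ?_⟩⟩, h3, h4⟩
  · obtain ⟨l, h⟩ := h
    obtain ⟨m, h5, -⟩ := lift h
    exact ⟨m, h5⟩
  · obtain ⟨v, rfl⟩ := h1.2 w
    exact ⟨v, CombGraph.Joined.refl _⟩
  · exact fun g hg => φ.edgeMap_mem hg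
  · exact fun g hg h hh he =>
      IsGraphImmersion.edgeMap_inj (fun d d' _ h => h2.1 h) hg hh he
  · rintro g ⟨l, h, rfl⟩
    obtain ⟨m, h5, rfl⟩ := lift h
    exact ⟨_, h5.mem, φ.edgeMap_mk m⟩

theorem IsComp.edgeMap {φ : Hom Y X} {φ₀ : Hom Y Z} {ψ : Hom Z X} (h : φ.IsComp φ₀ ψ) :
    φ.edgeMap = (φ₀.comp ψ).edgeMap := by
  unfold Hom.edgeMap
  congr 1
  funext e
  rw [h.2.1]
  rfl

theorem IsFoldEquiv.of_isComp {φ : Hom Y X} {φ₀ : Hom Y Z} {ψ : Hom Z X} (h : φ.IsComp φ₀ ψ)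
    (hc : (φ₀.comp ψ).IsFoldEquiv) : φ.IsFoldEquiv := by
  have hv : φ.vert = (φ₀.comp ψ).vert := funext h.1
  have hd : φ.dart = (φ₀.comp ψ).dart := funext h.2.1
  have hf : φ.face = (φ₀.comp ψ).face := funext h.2.2.1
  obtain ⟨h1, h2, h3, h4, h5⟩ := hc
  refine ⟨hv ▸ h1, hd ▸ h2, ?_, hf ▸ h4, fun f => ?_⟩
  · unfold IsGraphEquiv at h3 ⊢
    rw [hv, h.edgeMap]
    exact h3
  · have e1 := φ.len_eq f
    have e2 := (φ₀.comp ψ).len_eq f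
    rw [hf, e2, h5] at e1
    exact (Nat.eq_of_mul_eq_mul_right (X.len_pos _) e1).symm

/-- Essential equivalences are the onto homotopy equivalences of 1-skeleta that are homeomorphic on
open faces. -/
theorem isEssentialEquiv_iff {φ : Hom Y X} : φ.IsEssentialEquiv ↔ φ.IsFoldEquiv := by
  constructor
  · rintro ⟨Z, φ₀, ψ, ⟨hc, ⟨h1, h2, h3⟩, -⟩, hg, hf, hi⟩
    exact IsFoldEquiv.of_isComp hc (IsFoldEquiv.comp ⟨h1, h2, hg, hf⟩ hi.isFoldEquiv)
  · intro h
    exact ⟨X, φ, id X, ⟨isComp_id φ, ⟨h.vert, h.dart, h.faces.1.2⟩, h.graph.1,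
      fun v => (h.graph.2.2 v).surjOn, id_isBranchedImmersion X⟩, h.graph, h.faces, id_isIso X⟩

theorem isEssential_comp {φ : Hom Y Z} {ψ : Hom Z X} (h : φ.IsFoldEquiv)
    (hψ : ψ.IsBranchedImmersion) : (φ.comp ψ).IsEssential :=
  ⟨Z, φ, ψ, ⟨isComp_comp φ ψ, ⟨h.vert, h.dart, h.faces.1.2⟩, h.graph.1,
    fun v => (h.graph.2.2 v).surjOn, hψ⟩, h.graph, h.faces⟩

end Hom

end BranchedComplex

/-! ### Groups with a family of subgroups -/

section GroupSystem

variable {G H A B : Type} [Group G] [Group H]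

/-- `S` is almost invariant under right multiplication. -/
def AlmostInv (S : Set G) : Prop := ∀ g, {x | ¬ (x ∈ S ↔ x * g ∈ S)}.Finite

/-- Infinitely many elements of the subgroup `K` lie in `S`, and infinitely many do not. -/
def IsSplitBy (K : Subgroup G) (S : Set G) : Prop :=
  ((K : Set G) ∩ S).Infinite ∧ ((K : Set G) \ S).Infinite

/-- There is a non-trivial almost invariant set that splits at most one member of the family. -/
def WeaklySplits (st : A → Subgroup G) : Prop :=
  ∃ S : Set G, AlmostInv S ∧ S.Infinite ∧ Sᶜ.Infinite ∧
    ∀ a b, IsSplitBy (st a) S → IsSplitBy (st b) S → a = b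

/-- There is an almost invariant set `S` that splits at least three members of the family, and that
has no non-trivial decomposition which splits no member contained in `S` up to finite sets. -/
def HasTripod (st : A → Subgroup G) : Prop :=
  ∃ S : Set G, AlmostInv S ∧
    (∃ a b c, a ≠ b ∧ a ≠ c ∧ b ≠ c ∧
      IsSplitBy (st a) S ∧ IsSplitBy (st b) S ∧ IsSplitBy (st c) S) ∧
    ∀ S₁ : Set G, AlmostInv S₁ →
      (∀ a, ((st a : Set G) \ S).Finite → ¬ IsSplitBy (st a) S₁) →
      (S₁ ∩ S).Finite ∨ (S \ S₁).Finite

/-- Isomorphism of groups with families of subgroups. -/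
def SystemIso (st : A → Subgroup G) (st' : B → Subgroup H) : Prop :=
  ∃ (θ : G ≃* H) (β : A ≃ B), ∀ a, (st a).map θ.toMonoidHom = st' (β a)

theorem SystemIso.symm {st : A → Subgroup G} {st' : B → Subgroup H} (h : SystemIso st st') :
    SystemIso st' st := by
  obtain ⟨θ, β, h⟩ := h
  refine ⟨θ.symm, β.symm, fun b => ?_⟩
  have := h (β.symm b)
  rw [β.apply_symm_apply] at this
  rw [← this]
  ext x
  simp

theorem SystemIso.trans {C K : Type} [Group K] {st : A → Subgroup G} {st' : B → Subgroup H}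
    {st'' : C → Subgroup K} (h : SystemIso st st') (h' : SystemIso st' st'') :
    SystemIso st st'' := by
  obtain ⟨θ, β, h⟩ := h
  obtain ⟨θ', β', h'⟩ := h'
  refine ⟨θ.trans θ', β.trans β', fun a => ?_⟩
  rw [Equiv.trans_apply, ← h', ← h, Subgroup.map_map]
  rfl

theorem AlmostInv.preimage (θ : G ≃* H) {S : Set H} (h : AlmostInv S) :
    AlmostInv (θ ⁻¹' S) := by
  intro g
  refine ((h (θ g)).preimage θ.injective.injOn).subset fun x hx => ?_
  simpa using hx

theorem isSplitBy_preimage (θ : G ≃* H) (K : Subgroup G) (S : Set H) :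
    IsSplitBy K (θ ⁻¹' S) ↔ IsSplitBy (K.map θ.toMonoidHom) S := by
  have h1 : ((K.map θ.toMonoidHom : Subgroup H) : Set H) ∩ S = θ '' ((K : Set G) ∩ θ ⁻¹' S) := by
    rw [Set.image_inter_preimage]; rfl
  have h2 : ((K.map θ.toMonoidHom : Subgroup H) : Set H) \ S = θ '' ((K : Set G) \ θ ⁻¹' S) := by
    rw [Set.image_sdiff_preimage]; rfl
  unfold IsSplitBy
  rw [h1, h2, Set.infinite_image_iff θ.injective.injOn, Set.infinite_image_iff θ.injective.injOn]

theorem WeaklySplits.of_iso {st : A → Subgroup G} {st' : B → Subgroup H} (h : SystemIso st st')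
    (h' : WeaklySplits st') : WeaklySplits st := by
  obtain ⟨θ, β, h⟩ := h
  obtain ⟨S, h1, h2, h3, h4⟩ := h'
  refine ⟨θ ⁻¹' S, h1.preimage θ, h2.preimage (by simp [θ.surjective.range_eq]),
    h3.preimage (by simp [θ.surjective.range_eq]), fun a b ha hb => ?_⟩
  rw [isSplitBy_preimage, h] at ha hb
  exact β.injective (h4 _ _ ha hb)

theorem HasTripod.of_iso {st : A → Subgroup G} {st' : B → Subgroup H} (h : SystemIso st st')
    (h' : HasTripod st') : HasTripod st := by
  obtain ⟨θ, β, h⟩ := h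
  obtain ⟨S, h1, ⟨a, b, c, hab, hac, hbc, ha, hb, hc⟩, h2⟩ := h'
  refine ⟨θ ⁻¹' S, h1.preimage θ, ⟨β.symm a, β.symm b, β.symm c, by simpa, by simpa, by simpa,
    ?_, ?_, ?_⟩, fun S₁ hS₁ hs => ?_⟩
  · rw [isSplitBy_preimage, h]; simpa
  · rw [isSplitBy_preimage, h]; simpa
  · rw [isSplitBy_preimage, h]; simpa
  · have hS : S₁ = θ ⁻¹' (θ.symm ⁻¹' S₁) := by ext; simp
    rw [hS] at hs ⊢
    have := h2 (θ.symm ⁻¹' S₁) (hS₁.preimage θ.symm) (fun b hb => ?_)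
    · rw [← Set.preimage_inter, ← Set.preimage_sdiff]
      exact this.imp (fun h => h.preimage θ.injective.injOn)
        (fun h => h.preimage θ.injective.injOn)
    · have h5 := h (β.symm b)
      rw [β.apply_symm_apply] at h5
      rw [← h5, ← isSplitBy_preimage]
      refine hs _ ?_
      have h6 : ((st (β.symm b) : Set G) \ θ ⁻¹' S) = θ ⁻¹' ((st' b : Set H) \ S) := by
        rw [← h5, Set.preimage_sdiff]
        congr 1
        ext; simp
      rw [h6]
      exact hb.preimage θ.injective.injOn

end GroupSystem

namespace BranchedComplex

open CombGraph

variable {X Y Z : BranchedComplex}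

/-! ### The lifts of face boundaries to the universal cover of the 1-skeleton -/

/-- A lift of the boundary of a face to the universal cover of the 1-skeleton at `y`, together with
a lift of the corner `0`: the latter is a path class from `y` to that corner. -/
abbrev MarkedLine (Y : BranchedComplex) (y : Y.V) : Type :=
  Σ f : Y.F, {p : FreeGroup Y.E // p ∈ Y.pathClass y (Y.init (Y.bd f 0))}

/-- Two marked lines agree up to the choice of the lift of the corner `0`. -/
def lineSetoid (Y : BranchedComplex) (y : Y.V) : Setoid (Y.MarkedLine y) where
  r a b := a.1 = b.1 ∧ ∃ n : ℤ, b.2.1 = a.2.1 * Y.bdLoop a.1 ^ n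
  iseqv :=
    { refl := fun a => ⟨rfl, 0, by simp⟩
      symm := by
        rintro ⟨f, p, hp⟩ ⟨f', p', hp'⟩ ⟨h, n, h'⟩
        obtain rfl : f = f' := h
        exact ⟨rfl, -n, by simp [show p' = _ from h']⟩
      trans := by
        rintro ⟨f, p, hp⟩ ⟨f', p', hp'⟩ ⟨f'', p'', hp''⟩ ⟨h, n, h'⟩ ⟨h1, m, h1'⟩
        obtain rfl : f = f' := h
        obtain rfl : f = f'' := h1
        have h' : p' = p * Y.bdLoop f ^ n := h'
        subst h'
        exact ⟨rfl, n + m, by rw [zpow_add, ← mul_assoc]; exact h1'⟩ }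

/-- The lifts of the face boundaries to the universal cover of the 1-skeleton at `y`. -/
def Line (Y : BranchedComplex) (y : Y.V) : Type := Quotient (Y.lineSetoid y)

/-- The element of the fundamental group that translates a marked line by one period. -/
def MarkedLine.word {y : Y.V} (a : Y.MarkedLine y) : Y.pi1 y :=
  ⟨a.2.1 * Y.bdLoop a.1 * a.2.1⁻¹,
    mul_mem_pathClass (mul_mem_pathClass a.2.2 (bdLoop_mem a.1)) (inv_mem_pathClass a.2.2)⟩

/-- The stabiliser of a line in the fundamental group. -/
def lineStab (Y : BranchedComplex) (y : Y.V) : Y.Line y → Subgroup (Y.pi1 y) :=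
  Quotient.lift (fun a : Y.MarkedLine y => Subgroup.zpowers a.word) (by
    rintro ⟨f, p, hp⟩ ⟨f', p', hp'⟩ ⟨h, n, h'⟩
    obtain rfl : f = f' := h
    have h' : p' = p * Y.bdLoop f ^ n := h'
    subst h'
    change Subgroup.zpowers _ = Subgroup.zpowers _
    congr 1
    apply Subtype.ext
    change p * _ * p⁻¹ = p * _ * _ * (p * _)⁻¹
    group)

theorem MarkedLine.word_zpow {y : Y.V} (a : Y.MarkedLine y) (n : ℤ) :
    ((a.word ^ n : Y.pi1 y) : FreeGroup Y.E) = a.2.1 * Y.bdLoop a.1 ^ n * a.2.1⁻¹ := by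
  rw [SubgroupClass.coe_zpow]
  exact conj_zpow

theorem MarkedLine.word_zpow_injective {y : Y.V} (a : Y.MarkedLine y) :
    Function.Injective fun n : ℤ => a.word ^ n := by
  intro m n h
  have := congrArg Subtype.val h
  simp only [a.word_zpow] at this
  exact bdLoop_zpow_injective a.1 (mul_left_cancel (mul_right_cancel this))

theorem line_eq_iff {y : Y.V} {a b : Y.MarkedLine y} :
    (Quotient.mk (Y.lineSetoid y) a : Y.Line y) = Quotient.mk (Y.lineSetoid y) b ↔
      a.1 = b.1 ∧ ∃ n : ℤ, b.2.1 = a.2.1 * Y.bdLoop a.1 ^ n := Quotient.eq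

/-- The group pairs of the components of `Y` at `y` and of `Z` at `z` are isomorphic. -/
def PairIsoAt (Y : BranchedComplex) (y : Y.V) (Z : BranchedComplex) (z : Z.V) : Prop :=
  SystemIso (Y.lineStab y) (Z.lineStab z)

/-- An isomorphism of group pairs can be defined on marked lines. -/
theorem PairIsoAt.of_marked {y : Y.V} {z : Z.V} (θ : Y.pi1 y ≃* Z.pi1 z)
    (F : Y.MarkedLine y → Z.MarkedLine z)
    (h1 : ∀ a b, (Y.lineSetoid y).r a b ↔ (Z.lineSetoid z).r (F a) (F b))
    (h2 : ∀ b, ∃ a, (Z.lineSetoid z).r (F a) b)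
    (h3 : ∀ a, (Subgroup.zpowers a.word).map θ.toMonoidHom = Subgroup.zpowers (F a).word) :
    PairIsoAt Y y Z z := by
  let β₀ : Y.Line y → Z.Line z := Quotient.map F fun a b h => (h1 a b).1 h
  have hβ : Function.Bijective β₀ := by
    constructor
    · intro a b
      induction a using Quotient.inductionOn
      induction b using Quotient.inductionOn
      intro h
      exact Quotient.sound ((h1 _ _).2 (Quotient.exact h))
    · intro b
      induction b using Quotient.inductionOn with
      | _ b =>
        obtain ⟨a, ha⟩ := h2 b
        exact ⟨Quotient.mk _ a, Quotient.sound ha⟩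
  refine ⟨θ, Equiv.ofBijective β₀ hβ, fun a => ?_⟩
  induction a using Quotient.inductionOn
  exact h3 _

/-- A change of base point. -/
theorem PairIsoAt.of_joined {y z : Y.V} (h : Y.Joined y z) : PairIsoAt Y y Y z := by
  obtain ⟨q, hq⟩ := joined_iff.1 h
  have hq' := inv_mem_pathClass hq
  let θ : Y.pi1 y ≃* Y.pi1 z :=
    { toFun := fun g => ⟨q⁻¹ * g.1 * q, mul_mem_pathClass (mul_mem_pathClass hq' g.2) hq⟩
      invFun := fun g => ⟨q * g.1 * q⁻¹, mul_mem_pathClass (mul_mem_pathClass hq g.2) hq'⟩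
      left_inv := fun g => Subtype.ext (by simp [mul_assoc])
      right_inv := fun g => Subtype.ext (by simp [mul_assoc])
      map_mul' := fun g h => Subtype.ext (by simp [mul_assoc]) }
  refine PairIsoAt.of_marked θ (fun a => ⟨a.1, q⁻¹ * a.2.1, mul_mem_pathClass hq' a.2.2⟩)
    (fun a b => ?_) (fun b => ?_) (fun a => ?_)
  · change (_ ∧ ∃ n : ℤ, _) ↔ (_ ∧ ∃ n : ℤ, _)
    simp only [mul_assoc, mul_right_inj]
  · refine ⟨⟨b.1, q * b.2.1, mul_mem_pathClass hq b.2.2⟩, rfl, 0, ?_⟩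
    simp
  · rw [MonoidHom.map_zpowers]
    congr 1
    apply Subtype.ext
    change q⁻¹ * (a.2.1 * _ * a.2.1⁻¹) * q = q⁻¹ * a.2.1 * _ * (q⁻¹ * a.2.1)⁻¹
    group

/-! ### Equivalences of path groupoids -/

/-- An equivalence of the path groupoids of the 1-skeleta of `Y` and `Z` that matches the
boundaries of the faces, up to orientation. -/
structure PathEquiv (Y Z : BranchedComplex) where
  vert : Y.V → Z.V
  map : Y.V → Y.V → FreeGroup Y.E → FreeGroup Z.E
  bijOn : ∀ u v, Set.BijOn (map u v) (Y.pathClass u v) (Z.pathClass (vert u) (vert v))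
  map_mul : ∀ {u v w g h}, g ∈ Y.pathClass u v → h ∈ Y.pathClass v w →
    map u w (g * h) = map u v g * map v w h
  essSurj : ∀ z, ∃ u, Z.Joined (vert u) z
  face : Y.F ≃ Z.F
  area : ∀ f, Z.area (face f) = Y.area f
  bdMap : ∀ f, ∃ q ∈ Z.pathClass (vert (Y.init (Y.bd f 0))) (Z.init (Z.bd (face f) 0)),
    ∃ ε : ℤ, ε * ε = 1 ∧
      map (Y.init (Y.bd f 0)) (Y.init (Y.bd f 0)) (Y.bdLoop f) = q * Z.bdLoop (face f) ^ ε * q⁻¹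

namespace PathEquiv

variable (Φ : PathEquiv Y Z)

theorem map_one (u : Y.V) : Φ.map u u 1 = 1 := by
  have := Φ.map_mul (one_mem_pathClass u) (one_mem_pathClass u)
  rwa [mul_one, left_eq_mul] at this

theorem map_inv {u v : Y.V} {g : FreeGroup Y.E} (h : g ∈ Y.pathClass u v) :
    Φ.map v u g⁻¹ = (Φ.map u v g)⁻¹ := by
  have := Φ.map_mul h (inv_mem_pathClass h)
  rw [mul_inv_cancel, map_one] at this
  exact eq_inv_of_mul_eq_one_right this.symm

/-- The isomorphism of fundamental groups at `u`. -/
noncomputable def pi1Equiv (u : Y.V) : Y.pi1 u ≃* Z.pi1 (Φ.vert u) :=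
  MulEquiv.ofBijective
    ({ toFun := fun g => ⟨Φ.map u u g.1, (Φ.bijOn u u).mapsTo g.2⟩
       map_one' := Subtype.ext (Φ.map_one u)
       map_mul' := fun g h => Subtype.ext (Φ.map_mul g.2 h.2) } : Y.pi1 u →* Z.pi1 (Φ.vert u))
    ⟨fun g h he => Subtype.ext ((Φ.bijOn u u).injOn g.2 h.2 (congrArg Subtype.val he)),
      fun g => by
        obtain ⟨h, h1, h2⟩ := (Φ.bijOn u u).surjOn g.2
        exact ⟨⟨h, h1⟩, Subtype.ext h2⟩⟩

theorem pi1Equiv_coe (u : Y.V) (g : Y.pi1 u) : (Φ.pi1Equiv u g : FreeGroup Z.E) = Φ.map u u g :=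
  rfl

theorem zpowers_zpow_of_sq {G : Type} [Group G] (g : G) {ε : ℤ} (h : ε * ε = 1) :
    Subgroup.zpowers (g ^ ε) = Subgroup.zpowers g := by
  apply le_antisymm
  · rw [Subgroup.zpowers_le]
    exact ⟨ε, rfl⟩
  · rw [Subgroup.zpowers_le]
    exact ⟨ε, by simp [← zpow_mul, h]⟩

/-- A path equivalence identifies the group pairs: if `q f` and `ε f` are as in `bdMap`, then the line
given by the face `f` and the path `p` corresponds to the one given by the face `Φ.face f` and the
path `Φ.map p * q f`. -/
theorem pairIsoAt (u : Y.V) : PairIsoAt Y u Z (Φ.vert u) := by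
  choose q hq ε hε hB using Φ.bdMap
  have hBn : ∀ f (n : ℤ), Φ.map (Y.init (Y.bd f 0)) (Y.init (Y.bd f 0)) (Y.bdLoop f ^ n) =
      q f * Z.bdLoop (Φ.face f) ^ (ε f * n) * (q f)⁻¹ := by
    intro f n
    have := congrArg Subtype.val
      (map_zpow (Φ.pi1Equiv (Y.init (Y.bd f 0))) ⟨Y.bdLoop f, bdLoop_mem f⟩ n)
    rw [pi1Equiv_coe, SubgroupClass.coe_zpow, SubgroupClass.coe_zpow, pi1Equiv_coe, hB,
      conj_zpow, ← zpow_mul] at this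
    exact this
  have hpB : ∀ f p, p ∈ Y.pathClass u (Y.init (Y.bd f 0)) → ∀ n : ℤ,
      Φ.map u (Y.init (Y.bd f 0)) (p * Y.bdLoop f ^ n) * q f =
        Φ.map u (Y.init (Y.bd f 0)) p * q f * Z.bdLoop (Φ.face f) ^ (ε f * n) := by
    intro f p hp n
    rw [Φ.map_mul hp (bdLoop_zpow_mem f n), hBn]
    group
  refine PairIsoAt.of_marked (Φ.pi1Equiv u)
    (fun a => ⟨Φ.face a.1, Φ.map u _ a.2.1 * q a.1,
      mul_mem_pathClass ((Φ.bijOn _ _).mapsTo a.2.2) (hq a.1)⟩) ?_ ?_ ?_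
  · rintro ⟨f, p, hp⟩ ⟨f', p', hp'⟩
    constructor
    · rintro ⟨h, n, h'⟩
      obtain rfl : f = f' := h
      have h' : p' = p * Y.bdLoop f ^ n := h'
      subst h'
      exact ⟨rfl, ε f * n, hpB f p hp n⟩
    · rintro ⟨h, n, h'⟩
      obtain rfl : f = f' := Φ.face.injective h
      refine ⟨rfl, ε f * n, (Φ.bijOn _ _).injOn hp'
        (mul_mem_pathClass hp (bdLoop_zpow_mem f _)) ?_⟩
      apply mul_right_cancel (b := q f)
      rw [hpB f p hp, ← mul_assoc, hε, one_mul]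
      exact h'
  · rintro ⟨f', p', hp'⟩
    obtain ⟨f, rfl⟩ := Φ.face.surjective f'
    obtain ⟨p, hp, h⟩ := (Φ.bijOn u (Y.init (Y.bd f 0))).surjOn
      (mul_mem_pathClass hp' (inv_mem_pathClass (hq f)))
    refine ⟨⟨f, p, hp⟩, rfl, 0, ?_⟩
    simp [h]
  · rintro ⟨f, p, hp⟩
    rw [MonoidHom.map_zpowers]
    conv_rhs => rw [← zpowers_zpow_of_sq _ (hε f)]
    congr 1
    apply Subtype.ext
    rw [MarkedLine.word_zpow]
    change Φ.map u u (p * Y.bdLoop f * p⁻¹) =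
      Φ.map u _ p * q f * Z.bdLoop (Φ.face f) ^ ε f * (Φ.map u _ p * q f)⁻¹
    rw [Φ.map_mul (mul_mem_pathClass hp (bdLoop_mem f)) (inv_mem_pathClass hp),
      Φ.map_mul hp (bdLoop_mem f), Φ.map_inv hp, hB]
    group

end PathEquiv

/-- The path equivalence defined by a morphism that is a homotopy equivalence on 1-skeleta and a
homeomorphism on open faces. -/
noncomputable def Hom.pathEquiv (φ : Hom Y Z) (h : φ.IsGraphEquiv) (hf : φ.IsFaceHomeo) :
    PathEquiv Y Z where
  vert := φ.vert
  map _ _ g := φ.edgeMap g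
  bijOn u v := by
    refine ⟨fun g hg => φ.edgeMap_mem hg, fun g hg g' hg' he => ?_, fun g hg => ?_⟩
    · have := (h.2.2 u).injOn (mul_mem_pathClass hg (inv_mem_pathClass hg'))
        (one_mem_pathClass u) (by simp [he])
      exact mul_inv_eq_one.1 this
    · obtain ⟨k, hk⟩ := joined_iff.1 (h.1 u v (joined_of_mem hg))
      obtain ⟨k', hk', he⟩ := (h.2.2 u).surjOn
        (mul_mem_pathClass hg (inv_mem_pathClass (φ.edgeMap_mem hk)))
      exact ⟨k' * k, mul_mem_pathClass hk' hk, by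
        change φ.edgeMap (k' * k) = g
        rw [_root_.map_mul, he, inv_mul_cancel_right]⟩
  map_mul _ _ := _root_.map_mul _ _ _
  essSurj := h.2.1
  face := Equiv.ofBijective φ.face hf.1
  area f := by
    rw [φ.area_eq, hf.2, one_mul]
    rfl
  bdMap f := by
    refine ⟨(Z.bdPath (φ.face f) (φ.shift f))⁻¹, ?_, φ.sgn f, φ.sgn_mul_self f, ?_⟩
    · have h1 := φ.init_bd_corner f 0
      rw [corner_eq, mul_zero, add_zero] at h1
      rw [← h1]
      exact inv_mem_pathClass (bdPath_mem _ _)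
    · rw [edgeMap_bdLoop, hf.2, Nat.cast_one, mul_one, inv_inv]
      rfl

/-- The equivalence relation of lying in the same component. -/
def joinedSetoid (Y : BranchedComplex) : Setoid Y.V where
  r := Y.Joined
  iseqv := ⟨CombGraph.Joined.refl, CombGraph.Joined.symm, CombGraph.Joined.trans⟩

/-- The set of connected components. -/
def Comp (Y : BranchedComplex) : Type := Quotient Y.joinedSetoid

/-- The component of a vertex. -/
def comp (Y : BranchedComplex) (y : Y.V) : Y.Comp := Quotient.mk Y.joinedSetoid y

theorem comp_eq_iff {y z : Y.V} : Y.comp y = Y.comp z ↔ Y.Joined y z := Quotient.eq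

theorem comp_surjective (Y : BranchedComplex) : Function.Surjective Y.comp := Quotient.mk_surjective

/-- `Y` and `Z` have the same collections of group pairs, and their faces have the same collections of
areas. This is a weak form of Nielsen equivalence for complexes that need not be connected: the two
bijections are not required to be compatible. -/
def PairEquiv (Y Z : BranchedComplex) : Prop :=
  (∃ σ : Y.Comp ≃ Z.Comp, ∀ y z, σ (Y.comp y) = Z.comp z → PairIsoAt Y y Z z) ∧
  ∃ β : Y.F ≃ Z.F, ∀ f, Z.area (β f) = Y.area f

theorem PairEquiv.symm (h : PairEquiv Y Z) : PairEquiv Z Y := by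
  obtain ⟨⟨σ, h⟩, β, h'⟩ := h
  refine ⟨⟨σ.symm, fun z y hzy => (h y z ?_).symm⟩, β.symm, fun f => ?_⟩
  · rw [← hzy, σ.apply_symm_apply]
  · rw [← h', β.apply_symm_apply]

theorem PairEquiv.trans (h : PairEquiv Y Z) (h' : PairEquiv Z X) : PairEquiv Y X := by
  obtain ⟨⟨σ, h1⟩, β, h2⟩ := h
  obtain ⟨⟨σ', h1'⟩, β', h2'⟩ := h'
  refine ⟨⟨σ.trans σ', fun y x hyx => ?_⟩, β.trans β', fun f => ?_⟩
  · obtain ⟨z, hz⟩ := comp_surjective Z (σ (Y.comp y))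
    exact (h1 y z hz.symm).trans (h1' z x (by rw [hz]; exact hyx))
  · rw [Equiv.trans_apply, h2', h2]

theorem PathEquiv.pairEquiv (Φ : PathEquiv Y Z) : PairEquiv Y Z := by
  have hj : ∀ u v, Y.Joined u v ↔ Z.Joined (Φ.vert u) (Φ.vert v) := by
    intro u v
    rw [joined_iff, joined_iff]
    constructor
    · rintro ⟨g, hg⟩
      exact ⟨_, (Φ.bijOn u v).mapsTo hg⟩
    · rintro ⟨g, hg⟩
      obtain ⟨g', hg', -⟩ := (Φ.bijOn u v).surjOn hg
      exact ⟨g', hg'⟩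
  let σ₀ : Y.Comp → Z.Comp := Quotient.map Φ.vert fun u v => (hj u v).1
  have hσ : Function.Bijective σ₀ := by
    constructor
    · intro a b
      induction a using Quotient.inductionOn
      induction b using Quotient.inductionOn
      intro h
      exact Quotient.sound ((hj _ _).2 (Quotient.exact h))
    · intro b
      obtain ⟨z, rfl⟩ := comp_surjective Z b
      obtain ⟨u, hu⟩ := Φ.essSurj z
      exact ⟨Y.comp u, Quotient.sound hu⟩
  refine ⟨⟨Equiv.ofBijective σ₀ hσ, fun y z h => ?_⟩, Φ.face, Φ.area⟩
  exact (Φ.pairIsoAt y).trans (PairIsoAt.of_joined (comp_eq_iff.1 h))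

theorem Hom.IsFoldEquiv.pairEquiv {φ : Hom Y Z} (h : φ.IsFoldEquiv) : PairEquiv Y Z :=
  (φ.pathEquiv h.graph h.faces).pairEquiv

theorem PairEquiv.exists_pairIsoAt (h : PairEquiv Y Z) (z : Z.V) : ∃ y, PairIsoAt Y y Z z := by
  obtain ⟨⟨σ, h⟩, -⟩ := h
  obtain ⟨y, hy⟩ := comp_surjective Y (σ.symm (Z.comp z))
  exact ⟨y, h y z (by rw [hy, σ.apply_symm_apply])⟩

/-- Some component of `Y` has a non-trivial almost invariant set that splits at most one line. -/
def HasWeakSplitting (Y : BranchedComplex) : Prop := ∃ y, WeaklySplits (Y.lineStab y)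

/-- Some component of `Y` has an indecomposable almost invariant set that splits three lines. -/
def HasTripodAt (Y : BranchedComplex) : Prop := ∃ y, HasTripod (Y.lineStab y)

theorem PairEquiv.hasWeakSplitting (h : PairEquiv Y Z) (h' : Z.HasWeakSplitting) :
    Y.HasWeakSplitting := by
  obtain ⟨z, hz⟩ := h'
  obtain ⟨y, hy⟩ := h.exists_pairIsoAt z
  exact ⟨y, hz.of_iso hy⟩

theorem PairEquiv.hasTripodAt (h : PairEquiv Y Z) (h' : Z.HasTripodAt) : Y.HasTripodAt := by
  obtain ⟨z, hz⟩ := h'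
  obtain ⟨y, hy⟩ := h.exists_pairIsoAt z
  exact ⟨y, hz.of_iso hy⟩

end BranchedComplex

/-! ### The Euler characteristic is determined by the fundamental groups -/

section ExtendOne

variable {G M : Type} [Group G] [CommGroup M] {H : Subgroup G}

open Classical in
/-- A homomorphism defined on a subgroup, extended by `1` to a function on the whole group. -/
noncomputable def extendOne (h : H →* M) (g : G) : M := if hg : g ∈ H then h ⟨g, hg⟩ else 1

theorem extendOne_of_mem (h : H →* M) {g : G} (hg : g ∈ H) : extendOne h g = h ⟨g, hg⟩ :=
  dif_pos hg

theorem extendOne_one (h : H →* M) : extendOne h 1 = 1 := by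
  rw [extendOne_of_mem h H.one_mem]
  exact map_one h

theorem extendOne_mul (h : H →* M) {g g' : G} (hg : g ∈ H) (hg' : g' ∈ H) :
    extendOne h (g * g') = extendOne h g * extendOne h g' := by
  rw [extendOne_of_mem h hg, extendOne_of_mem h hg', extendOne_of_mem h (H.mul_mem hg hg'),
    ← map_mul]
  rfl

theorem extendOne_inv (h : H →* M) {g : G} (hg : g ∈ H) :
    extendOne h g⁻¹ = (extendOne h g)⁻¹ := by
  rw [extendOne_of_mem h hg, extendOne_of_mem h (H.inv_mem hg), ← map_inv]
  rfl

end ExtendOne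

namespace BranchedComplex

open CombGraph

variable {X Y Z : BranchedComplex}

/-- Functions on edges with values in `M` (together with functions on components) correspond to
functions on vertices together with homomorphisms from the fundamental groups of the components:
the exact sequence computing the first cohomology of the 1-skeleton, split by a choice of paths. -/
noncomputable def cochainEquiv (M : Type) [CommGroup M] (Y : BranchedComplex) (r : Y.Comp → Y.V)
    (t : Y.V → FreeGroup Y.E) (hr : ∀ j, Y.comp (r j) = j)
    (ht : ∀ v, t v ∈ Y.pathClass (r (Y.comp v)) v) :
    (Y.E → M) × (Y.Comp → M) ≃ (Y.V → M) × (∀ j, Y.pi1 (r j) →* M) where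
  toFun c := ⟨fun v => FreeGroup.lift c.1 (t v) * c.2 (Y.comp v),
    fun j => (FreeGroup.lift c.1).comp (Y.pi1 (r j)).subtype⟩
  invFun w := ⟨fun e => (w.1 (Y.src e))⁻¹ * extendOne (w.2 (Y.comp (Y.src e)))
      (t (Y.src e) * FreeGroup.of e * (t (Y.tgt e))⁻¹) * w.1 (Y.tgt e),
    fun j => w.1 (r j) * (extendOne (w.2 j) (t (r j)))⁻¹⟩
  left_inv := by
    rintro ⟨c, k⟩
    refine Prod.ext (funext fun e => ?_) (funext fun j => ?_)
    · have hc : Y.comp (Y.src e) = Y.comp (Y.tgt e) :=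
        comp_eq_iff.2 (joined_dart (G := Y.toCombGraph) (e, true))
      dsimp only
      rw [extendOne_of_mem]
      · simp only [MonoidHom.comp_apply, Subgroup.subtype_apply, map_mul, map_inv,
          FreeGroup.lift_apply_of, hc]
        generalize FreeGroup.lift c (t (Y.src e)) = a
        generalize FreeGroup.lift c (t (Y.tgt e)) = b
        generalize k (Y.comp (Y.tgt e)) = d
        rw [mul_inv_rev, show d⁻¹ * a⁻¹ * (a * c e * b⁻¹) * (b * d) = d⁻¹ * c e * d by group,
          mul_comm, mul_inv_cancel_left]
      · refine mul_mem_pathClass (mul_mem_pathClass (ht _)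
          (dart_mem_pathClass (G := Y.toCombGraph) (e, true))) ?_
        rw [hc]
        exact inv_mem_pathClass (ht _)
    · dsimp only
      rw [extendOne_of_mem]
      · simp only [MonoidHom.comp_apply, Subgroup.subtype_apply, hr]
        rw [mul_comm, inv_mul_cancel_left]
      · have := ht (r j)
        rwa [hr] at this
  right_inv := by
    rintro ⟨u, h⟩
    set c : Y.E → M := fun e => (u (Y.src e))⁻¹ * extendOne (h (Y.comp (Y.src e)))
      (t (Y.src e) * FreeGroup.of e * (t (Y.tgt e))⁻¹) * u (Y.tgt e) with hc
    have mem : ∀ {v w p}, p ∈ Y.pathClass v w → t v * p * (t w)⁻¹ ∈ Y.pi1 (r (Y.comp v)) := by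
      intro v w p hp
      refine mul_mem_pathClass (mul_mem_pathClass (ht _) hp) ?_
      rw [comp_eq_iff.2 (joined_of_mem hp)]
      exact inv_mem_pathClass (ht _)
    -- the homomorphism attached to the cochain `c`, evaluated on an arbitrary path class
    have key : ∀ {v w p}, p ∈ Y.pathClass v w →
        FreeGroup.lift c p =
          (u v)⁻¹ * extendOne (h (Y.comp v)) (t v * p * (t w)⁻¹) * u w := by
      have pos : ∀ e, FreeGroup.lift c (FreeGroup.mk [(e, true)]) = c e := fun e => by
        simp [FreeGroup.lift_mk]
      have dart : ∀ d : Y.Dart, FreeGroup.lift c (FreeGroup.mk [d]) = (u (Y.init d))⁻¹ *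
          extendOne (h (Y.comp (Y.init d)))
            (t (Y.init d) * FreeGroup.mk [d] * (t (Y.term d))⁻¹) * u (Y.term d) := by
        rintro ⟨e, b⟩
        cases b
        · have hf : ((e, false) : Y.Dart) = Y.flip (e, true) := rfl
          have hm := mem (dart_mem_pathClass (G := Y.toCombGraph) (e, true))
          have hj : Y.comp (Y.term (e, true)) = Y.comp (Y.init (e, true)) :=
            (comp_eq_iff.2 (joined_dart (G := Y.toCombGraph) (e, true))).symm
          rw [hf, mk_flip, map_inv, pos, term_flip, init_flip, hj,
            show t (Y.term (e, true)) * (FreeGroup.mk [(e, true)])⁻¹ * (t (Y.init (e, true)))⁻¹ =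
              (t (Y.init (e, true)) * FreeGroup.mk [(e, true)] * (t (Y.term (e, true)))⁻¹)⁻¹ by
              group, extendOne_inv _ hm]
          rw [show c e = (u (Y.init (e, true)))⁻¹ * extendOne (h (Y.comp (Y.init (e, true))))
            (t (Y.init (e, true)) * FreeGroup.mk [(e, true)] * (t (Y.term (e, true)))⁻¹) *
              u (Y.term (e, true)) from rfl, mul_inv_rev, mul_inv_rev, inv_inv,
            ← mul_assoc]
        · exact pos e
      intro v w p hp
      refine pathClass_induction (P := fun v w p => FreeGroup.lift c p =
          (u v)⁻¹ * extendOne (h (Y.comp v)) (t v * p * (t w)⁻¹) * u w) ?_ ?_ hp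
      · intro v
        simp [extendOne_one]
      · intro d v g hg ih
        have hm := mem (dart_mem_pathClass d)
        have hm' := mem hg
        have hj : Y.comp (Y.term d) = Y.comp (Y.init d) := (comp_eq_iff.2 (joined_dart d)).symm
        rw [hj] at hm' ih
        rw [map_mul, ih, dart, show t (Y.init d) * (FreeGroup.mk [d] * g) * (t v)⁻¹ =
          t (Y.init d) * FreeGroup.mk [d] * (t (Y.term d))⁻¹ * (t (Y.term d) * g * (t v)⁻¹) by
          group, extendOne_mul _ hm hm']
        group
    have htr : ∀ j, t (r j) ∈ Y.pi1 (r j) := fun j => by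
      have := ht (r j)
      rwa [hr] at this
    refine Prod.ext (funext fun v => ?_) (funext fun j => MonoidHom.ext fun g => ?_)
    · dsimp only
      have h1 := key (ht v)
      have hjj : Y.comp (r (Y.comp v)) = Y.comp v := hr _
      rw [hjj] at h1
      rw [h1, mul_inv_cancel_right]
      generalize extendOne (h (Y.comp v)) (t (r (Y.comp v))) = a
      generalize u (r (Y.comp v)) = b
      rw [mul_comm (b⁻¹ * a), mul_assoc, mul_comm b, mul_assoc, mul_inv_cancel_left,
        inv_mul_cancel, mul_one]
    · dsimp only
      rw [MonoidHom.comp_apply, Subgroup.subtype_apply, key g.2, hr,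
        extendOne_mul _ ((Y.pi1 _).mul_mem (htr j) g.2) ((Y.pi1 _).inv_mem (htr j)),
        extendOne_mul _ (htr j) g.2, extendOne_inv _ (htr j), extendOne_of_mem _ g.2]
      rw [mul_comm (extendOne (h j) (t (r j))) (h j ⟨g.1, g.2⟩), mul_inv_cancel_right,
        mul_comm (u (r j))⁻¹, inv_mul_cancel_right]

theorem card_cochains (Y : BranchedComplex) (h : Y.IsFinite) (r : Y.Comp → Y.V)
    (hr : ∀ j, Y.comp (r j) = j) :
    2 ^ (Nat.card Y.E + Nat.card Y.Comp) =
      2 ^ Nat.card Y.V * Nat.card (∀ j, Y.pi1 (r j) →* Multiplicative (ZMod 2)) := by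
  obtain ⟨hV, hE, -⟩ := h
  have : Finite Y.Comp := Finite.of_surjective _ Y.comp_surjective
  have ht : ∀ v, ∃ g, g ∈ Y.pathClass (r (Y.comp v)) v := fun v =>
    joined_iff.1 (comp_eq_iff.1 (hr _))
  choose t ht using ht
  have := Nat.card_congr (cochainEquiv (Multiplicative (ZMod 2)) Y r t hr ht)
  rw [Nat.card_prod, Nat.card_prod, Nat.card_fun, Nat.card_fun, Nat.card_fun] at this
  have h2 : Nat.card (Multiplicative (ZMod 2)) = 2 := by simp
  rwa [h2, ← pow_add] at this

/-- Counting cochains with values in `ZMod 2` expresses the Euler characteristic in terms of the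
number of components and the numbers of homomorphisms from their fundamental groups to `ZMod 2`. -/
theorem PairEquiv.eulerChar_eq (h : PairEquiv Y Z) (hY : Y.IsFinite) (hZ : Z.IsFinite) :
    Y.eulerChar = Z.eulerChar := by
  obtain ⟨⟨σ, h⟩, -⟩ := h
  obtain ⟨r, hr⟩ := Y.comp_surjective.hasRightInverse
  obtain ⟨r', hr'⟩ := Z.comp_surjective.hasRightInverse
  have h1 := card_cochains Y hY r hr
  have h2 := card_cochains Z hZ r' hr'
  have h3 : ∀ j, Nonempty (Y.pi1 (r j) ≃* Z.pi1 (r' (σ j))) := fun j => by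
    obtain ⟨θ, -⟩ := h (r j) (r' (σ j)) (by rw [hr, hr'])
    exact ⟨θ⟩
  have h4 := Nat.card_congr (Equiv.piCongr (W := fun j => Y.pi1 (r j) →* Multiplicative (ZMod 2))
    (Z := fun j => Z.pi1 (r' j) →* Multiplicative (ZMod 2)) σ fun j =>
    ((h3 j).some.monoidHomCongrLeftEquiv (N := Multiplicative (ZMod 2))))
  have h5 := Nat.card_congr σ
  rw [h4] at h1
  rw [← h5] at h2
  have h6 : 2 ^ (Nat.card Y.E + Nat.card Y.Comp + Nat.card Z.V) =
      2 ^ (Nat.card Z.E + Nat.card Y.Comp + Nat.card Y.V) := by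
    rw [pow_add, h1, pow_add, h2]
    ring
  have h7 := Nat.pow_right_injective le_rfl h6
  unfold eulerChar
  omega

theorem PairEquiv.totalArea_eq (h : PairEquiv Y Z) : Y.totalArea = Z.totalArea := by
  obtain ⟨-, β, h⟩ := h
  unfold totalArea
  rw [← finsum_comp_equiv β]
  exact finsum_congr fun f => (h f).symm

theorem PairEquiv.avgCurvature_eq (h : PairEquiv Y Z) (hY : Y.IsFinite) (hZ : Z.IsFinite) :
    Y.avgCurvature = Z.avgCurvature := by
  unfold avgCurvature totalCurvature
  rw [h.totalArea_eq, h.eulerChar_eq hY hZ]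

end BranchedComplex

namespace BranchedComplex

open CombGraph Filter

variable {X Y Z : BranchedComplex}

/-! ### Almost invariant sets and sets of vertices of the universal cover -/

/-- A set of vertices of the universal cover of the 1-skeleton at `y`, that is, of path classes
starting at `y`, with finite coboundary above every edge. -/
def TreeInv (Y : BranchedComplex) (y : Y.V) (c : Set (FreeGroup Y.E)) : Prop :=
  ∀ d, {g | g ∈ Y.pathClass y (Y.init d) ∧ ¬ (g ∈ c ↔ g * FreeGroup.mk [d] ∈ c)}.Finite

theorem TreeInv.finite_path {y : Y.V} {c : Set (FreeGroup Y.E)} (hc : Y.TreeInv y c) {u v : Y.V}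
    {h : FreeGroup Y.E} (hh : h ∈ Y.pathClass u v) :
    {g | g ∈ Y.pathClass y u ∧ ¬ (g ∈ c ↔ g * h ∈ c)}.Finite := by
  refine pathClass_induction
    (P := fun u _ h => {g | g ∈ Y.pathClass y u ∧ ¬ (g ∈ c ↔ g * h ∈ c)}.Finite) ?_ ?_ hh
  · intro u
    simp
  · intro d v g _ ih
    refine ((hc d).union (ih.preimage (f := fun x => x * FreeGroup.mk [d])
      (mul_left_injective _).injOn)).subset ?_
    rintro x ⟨h1, h2⟩
    by_cases h3 : x ∈ c ↔ x * FreeGroup.mk [d] ∈ c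
    · refine Or.inr ⟨mul_mem_pathClass h1 (dart_mem_pathClass d), fun h4 => h2 ?_⟩
      rw [h3, h4, mul_assoc]
    · exact Or.inl ⟨h1, h3⟩

/-- A property of integers that changes only finitely often is eventually constant in both
directions. -/
theorem eventually_or_of_finite_changes {P : ℤ → Prop}
    (h : {n | ¬ (P n ↔ P (n + 1))}.Finite) :
    ((∀ᶠ n in atTop, P n) ∨ ∀ᶠ n in atTop, ¬ P n) ∧
      ((∀ᶠ n in atBot, P n) ∨ ∀ᶠ n in atBot, ¬ P n) := by
  obtain ⟨N, hN⟩ := h.bddAbove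
  obtain ⟨M, hM⟩ := h.bddBelow
  constructor
  · have key : ∀ n, N + 1 ≤ n → (P n ↔ P (N + 1)) := by
      intro n hn
      induction n, hn using Int.leInduction with
      | base => rfl
      | succ n hn ih =>
        rw [← ih]
        by_contra h1
        have := hN (show n ∈ {n | ¬ (P n ↔ P (n + 1))} from fun h2 => h1 h2.symm)
        omega
    by_cases h1 : P (N + 1)
    · exact Or.inl ((eventually_ge_atTop (N + 1)).mono fun n hn => (key n hn).2 h1)
    · exact Or.inr ((eventually_ge_atTop (N + 1)).mono fun n hn h2 => h1 ((key n hn).1 h2))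
  · have key : ∀ n, n ≤ M → (P n ↔ P M) := by
      intro n hn
      induction n, hn using Int.leInductionDown with
      | base => rfl
      | pred n hn ih =>
        rw [← ih]
        by_contra h1
        have := hM (show n - 1 ∈ {n | ¬ (P n ↔ P (n + 1))} from fun h2 => h1 (by simpa using h2))
        omega
    by_cases h1 : P M
    · exact Or.inl ((eventually_le_atBot M).mono fun n hn => (key n hn).2 h1)
    · exact Or.inr ((eventually_le_atBot M).mono fun n hn h2 => h1 ((key n hn).1 h2))

theorem finite_range_bd (f : Y.F) : (Set.range (Y.bd f)).Finite := by
  refine ((Set.finite_Ico (0 : ℤ) (Y.len f)).image (Y.bd f)).subset ?_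
  rintro _ ⟨n, rfl⟩
  have hl : (0 : ℤ) < Y.len f := by exact_mod_cast Y.len_pos f
  exact ⟨n % Y.len f, ⟨Int.emod_nonneg _ hl.ne', Int.emod_lt_of_pos _ hl⟩,
    bd_congr f (Int.mod_modEq n _)⟩

/-- Along a lift of the boundary of a face, a set with finite coboundary is eventually constant in
both directions. -/
theorem TreeInv.eventually_line {y : Y.V} {c : Set (FreeGroup Y.E)} (hc : Y.TreeInv y c) (f : Y.F)
    {p : FreeGroup Y.E} (hp : p ∈ Y.pathClass y (Y.init (Y.bd f 0))) :
    ((∀ᶠ n in atTop, p * Y.bdPath f n ∈ c) ∨ ∀ᶠ n in atTop, p * Y.bdPath f n ∉ c) ∧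
      ((∀ᶠ n in atBot, p * Y.bdPath f n ∈ c) ∨ ∀ᶠ n in atBot, p * Y.bdPath f n ∉ c) := by
  refine eventually_or_of_finite_changes ?_
  refine (((finite_range_bd f).biUnion fun d _ => hc d).preimage
    (f := fun n => p * Y.bdPath f n)
    ((mul_right_injective p).comp (bdPath_injective f)).injOn).subset ?_
  intro n hn
  simp only [Set.mem_preimage, Set.mem_iUnion]
  refine ⟨_, ⟨n, rfl⟩, mul_mem_pathClass hp (bdPath_mem f n), ?_⟩
  rw [mul_assoc, ← bdPath_succ]
  exact hn

/-- The two ends of the lift at `p` of the boundary of `f` lie on different sides of `c`. -/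
def LineSplit (c : Set (FreeGroup Y.E)) (f : Y.F) (p : FreeGroup Y.E) : Prop :=
  ¬ ((∀ᶠ n in atTop, p * Y.bdPath f n ∈ c) ↔ ∀ᶠ n in atBot, p * Y.bdPath f n ∈ c)

/-- The set `S` of elements of the fundamental group at `z` and the set `c` of vertices of the
universal cover at `y` agree up to finite sets, where `q` is the class of a path from `z` to `y`. -/
structure Assoc {z : Y.V} (S : Set (Y.pi1 z)) (y : Y.V) (q : FreeGroup Y.E)
    (c : Set (FreeGroup Y.E)) : Prop where
  base : q ∈ Y.pathClass z y
  treeInv : Y.TreeInv y c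
  finite : ∀ v h, h ∈ Y.pathClass v z →
    {g | g ∈ Y.pathClass y v ∧ ¬ (g ∈ c ↔ q * g * h ∈ Subtype.val '' S)}.Finite

namespace Assoc

variable {z y : Y.V} {S S' : Set (Y.pi1 z)} {q : FreeGroup Y.E} {c c' : Set (FreeGroup Y.E)}

theorem mem_image {x : FreeGroup Y.E} (hx : x ∈ Y.pathClass z z) :
    x ∈ Subtype.val '' S ↔ (⟨x, hx⟩ : Y.pi1 z) ∈ S := by
  constructor
  · rintro ⟨_, h, rfl⟩
    exact h
  · exact fun h => ⟨_, h, rfl⟩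

theorem inter (h : Assoc S y q c) (h' : Assoc S' y q c') : Assoc (S ∩ S') y q (c ∩ c') where
  base := h.base
  treeInv d := ((h.treeInv d).union (h'.treeInv d)).subset (by
    rintro g ⟨h1, h2⟩
    by_contra h3
    simp only [Set.mem_union, Set.mem_ofPred_eq, h1, true_and, not_or, not_not] at h3
    exact h2 (and_congr h3.1 h3.2))
  finite v x hx := ((h.finite v x hx).union (h'.finite v x hx)).subset (by
    rintro g ⟨h1, h2⟩
    by_contra h3
    simp only [Set.mem_union, Set.mem_ofPred_eq, h1, true_and, not_or, not_not] at h3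
    refine h2 ?_
    have hm : q * g * x ∈ Y.pathClass z z := mul_mem_pathClass (mul_mem_pathClass h.base h1) hx
    rw [mem_image hm] at h3 ⊢
    rw [mem_image hm] at h3
    exact and_congr h3.1 h3.2)

theorem compl (h : Assoc S y q c) : Assoc Sᶜ y q cᶜ where
  base := h.base
  treeInv d := (h.treeInv d).subset (by
    rintro g ⟨h1, h2⟩
    exact ⟨h1, fun h3 => h2 (not_congr h3)⟩)
  finite v x hx := (h.finite v x hx).subset (by
    rintro g ⟨h1, h2⟩
    refine ⟨h1, fun h3 => h2 ?_⟩
    have hm : q * g * x ∈ Y.pathClass z z := mul_mem_pathClass (mul_mem_pathClass h.base h1) hx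
    rw [mem_image hm] at h3 ⊢
    exact not_congr h3)

/-- A set of vertices of the universal cover restricts to a subset of the fundamental group. -/
theorem of_treeInv (hc : Y.TreeInv z c) : Assoc (Subtype.val ⁻¹' c : Set (Y.pi1 z)) z 1 c where
  base := one_mem_pathClass z
  treeInv := hc
  finite v h hh := (hc.finite_path hh).subset (by
    rintro g ⟨h1, h2⟩
    refine ⟨h1, fun h3 => h2 ?_⟩
    have hm : g * h ∈ Y.pathClass z z := mul_mem_pathClass h1 hh
    rw [one_mul, mem_image hm]
    exact h3)

theorem almostInv (h : Assoc S z 1 c) : AlmostInv S := by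
  intro g
  refine (((h.finite z 1 (one_mem_pathClass z)).union
    (h.finite z g.1 g.2)).preimage (f := Subtype.val)
    Subtype.val_injective.injOn).subset fun x hx => ?_
  by_contra h3
  simp only [Set.mem_preimage, Set.mem_union, Set.mem_ofPred_eq, not_or, not_and, not_not,
    one_mul, mul_one] at h3
  have h4 := h3.1 x.2
  have h5 := h3.2 x.2
  rw [mem_image x.2] at h4
  rw [mem_image (mul_mem_pathClass x.2 g.2)] at h5
  exact hx (h4.symm.trans h5)

/-- An almost invariant subset of the fundamental group extends to a set of vertices of the universal
cover with finite coboundary. -/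
theorem exists_of_almostInv (hS : AlmostInv S) (hq : q ∈ Y.pathClass z y) :
    ∃ c, Assoc S y q c := by
  classical
  have ht : ∀ v, ∃ t, Y.Joined z v → t ∈ Y.pathClass z v := by
    intro v
    by_cases h : Y.Joined z v
    · obtain ⟨t, ht⟩ := joined_iff.1 h
      exact ⟨t, fun _ => ht⟩
    · exact ⟨1, fun h' => absurd h' h⟩
  choose t ht using ht
  let c : Set (FreeGroup Y.E) :=
    {g | ∃ v, g ∈ Y.pathClass y v ∧ q * g * (t v)⁻¹ ∈ Subtype.val '' S}
  have htv : ∀ {v g}, g ∈ Y.pathClass y v → t v ∈ Y.pathClass z v := fun hg =>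
    ht _ (joined_of_mem (mul_mem_pathClass hq hg))
  have hc : ∀ {v g}, g ∈ Y.pathClass y v → (g ∈ c ↔ q * g * (t v)⁻¹ ∈ Subtype.val '' S) := by
    intro v g hg
    constructor
    · rintro ⟨w, hw, h⟩
      rwa [pathClass_end_unique hg hw]
    · exact fun h => ⟨v, hg, h⟩
  -- the set changes finitely often when path classes are extended by a fixed path class
  have key : ∀ v k, k ∈ Y.pathClass z z → {g | g ∈ Y.pathClass y v ∧
      ¬ (q * g * (t v)⁻¹ ∈ Subtype.val '' S ↔ q * g * (t v)⁻¹ * k ∈ Subtype.val '' S)}.Finite := by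
    intro v k hk
    refine (((hS ⟨k, hk⟩).image Subtype.val).preimage (f := fun g => q * g * (t v)⁻¹)
      (fun a _ b _ h => mul_left_cancel (mul_right_cancel h))).subset ?_
    rintro g ⟨h1, h2⟩
    have hm : q * g * (t v)⁻¹ ∈ Y.pathClass z z :=
      mul_mem_pathClass (mul_mem_pathClass hq h1) (inv_mem_pathClass (htv h1))
    rw [mem_image hm, mem_image (mul_mem_pathClass hm hk)] at h2
    exact ⟨⟨_, hm⟩, h2, rfl⟩
  have fin : ∀ v h, h ∈ Y.pathClass v z →
      {g | g ∈ Y.pathClass y v ∧ ¬ (g ∈ c ↔ q * g * h ∈ Subtype.val '' S)}.Finite := by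
    intro v h hh
    by_cases hv : Y.Joined z v
    · refine (key v (t v * h) (mul_mem_pathClass (ht v hv) hh)).subset ?_
      rintro g ⟨h1, h2⟩
      refine ⟨h1, fun h3 => h2 ?_⟩
      rw [hc h1, h3]
      group
    · refine Set.Finite.subset Set.finite_empty ?_
      rintro g ⟨h1, -⟩
      exact hv (joined_of_mem (mul_mem_pathClass hq h1))
  refine ⟨c, hq, fun d => ?_, fin⟩
  by_cases hd : Y.Joined z (Y.term d)
  · have h1 := inv_mem_pathClass (ht _ hd)
    have h2 := fin _ _ (mul_mem_pathClass (dart_mem_pathClass d) h1)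
    have h3 := (fin _ _ h1).preimage (f := fun g => g * FreeGroup.mk [d])
      (mul_left_injective _).injOn
    refine (h2.union h3).subset ?_
    rintro g ⟨h4, h5⟩
    by_contra h6
    have h7 : g * FreeGroup.mk [d] ∈ Y.pathClass y (Y.term d) :=
      mul_mem_pathClass h4 (dart_mem_pathClass d)
    simp only [Set.mem_union, Set.mem_preimage, Set.mem_ofPred_eq, h4, h7, true_and, not_or,
      not_not] at h6
    refine h5 (h6.1.trans (Iff.trans ?_ h6.2.symm))
    simp only [mul_assoc]
  · refine Set.Finite.subset Set.finite_empty ?_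
    rintro g ⟨h1, -⟩
    exact hd (joined_of_mem (mul_mem_pathClass (mul_mem_pathClass hq h1) (dart_mem_pathClass d)))

/-- Provided there are finitely many vertices, finiteness can be tested in the fundamental group or
in the universal cover. -/
theorem finite_iff [Finite Y.V] (h : Assoc S y q c) :
    S.Finite ↔ {g | (∃ v, g ∈ Y.pathClass y v) ∧ g ∈ c}.Finite := by
  constructor
  · intro hS
    have key : ∀ v, {g | g ∈ Y.pathClass y v ∧ g ∈ c}.Finite := by
      intro v
      by_cases hv : Y.Joined v z
      · obtain ⟨t, ht⟩ := joined_iff.1 hv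
        refine ((h.finite v t ht).union ((hS.image Subtype.val).preimage
          (f := fun g => q * g * t)
          (fun a _ b _ h => mul_left_cancel (mul_right_cancel h)))).subset ?_
        rintro g ⟨h1, h2⟩
        by_cases h3 : q * g * t ∈ Subtype.val '' S
        · exact Or.inr h3
        · exact Or.inl ⟨h1, fun h4 => h3 (h4.1 h2)⟩
      · refine Set.Finite.subset Set.finite_empty ?_
        rintro g ⟨h1, -⟩
        exact hv (joined_of_mem (mul_mem_pathClass h.base h1)).symm
    refine (Set.finite_iUnion key).subset ?_
    rintro g ⟨⟨v, h1⟩, h2⟩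
    exact Set.mem_iUnion.2 ⟨v, h1, h2⟩
  · intro hT
    have hq := inv_mem_pathClass h.base
    have h1 := (hT.union (h.finite z 1 (one_mem_pathClass z))).preimage
      (f := fun x : Y.pi1 z => q⁻¹ * x.1)
      (fun a _ b _ h => Subtype.ext (mul_left_cancel h))
    refine h1.subset fun x hx => ?_
    have hm : q⁻¹ * x.1 ∈ Y.pathClass y z := mul_mem_pathClass hq x.2
    by_cases h3 : q⁻¹ * x.1 ∈ c
    · exact Or.inl ⟨⟨z, hm⟩, h3⟩
    · refine Or.inr ⟨hm, fun h4 => h3 (h4.2 ?_)⟩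
      rw [mul_one, mul_inv_cancel_left]
      exact ⟨x, hx, rfl⟩

theorem finite_changes (h : Assoc S y q c) (a : Y.MarkedLine z) :
    {n : ℤ | ¬ (a.word ^ n ∈ S ↔ q⁻¹ * a.2.1 * Y.bdPath a.1 (n * Y.len a.1) ∈ c)}.Finite := by
  have hq := inv_mem_pathClass h.base
  refine ((h.finite _ _ (inv_mem_pathClass a.2.2)).preimage
    (f := fun n : ℤ => q⁻¹ * a.2.1 * Y.bdLoop a.1 ^ n)
    (fun m _ n _ h => bdLoop_zpow_injective a.1 (mul_left_cancel h))).subset ?_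
  intro n hn
  refine ⟨mul_mem_pathClass (mul_mem_pathClass hq a.2.2) (bdLoop_zpow_mem _ _), fun h1 => hn ?_⟩
  have e : q * (q⁻¹ * a.2.1 * Y.bdLoop a.1 ^ n) * a.2.1⁻¹ = ((a.word ^ n : Y.pi1 z) : FreeGroup Y.E) := by
    rw [a.word_zpow]; group
  rw [e, mem_image (a.word ^ n).2] at h1
  rw [bdPath_mul_len]
  exact h1.symm

theorem finite_zpowers_iff (a : Y.MarkedLine z) (S : Set (Y.pi1 z)) :
    (((Subgroup.zpowers a.word : Subgroup (Y.pi1 z)) : Set (Y.pi1 z)) ∩ S).Finite ↔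
      {n : ℤ | a.word ^ n ∈ S}.Finite := by
  have : ((Subgroup.zpowers a.word : Subgroup (Y.pi1 z)) : Set (Y.pi1 z)) ∩ S =
      (fun n : ℤ => a.word ^ n) '' {n : ℤ | a.word ^ n ∈ S} := by
    ext x
    constructor
    · rintro ⟨⟨n, rfl⟩, h⟩
      exact ⟨n, h, rfl⟩
    · rintro ⟨n, h, rfl⟩
      exact ⟨⟨n, rfl⟩, h⟩
  rw [this, Set.finite_image_iff a.word_zpow_injective.injOn]

theorem tendsto_mul_len (f : Y.F) : Tendsto (fun n : ℤ => n * (Y.len f : ℤ)) atTop atTop ∧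
    Tendsto (fun n : ℤ => n * (Y.len f : ℤ)) atBot atBot := by
  have hl : (0 : ℤ) < Y.len f := by exact_mod_cast Y.len_pos f
  exact ⟨tendsto_id.atTop_mul_const' hl, tendsto_id.atBot_mul_const' hl⟩

/-- A line meets `S` in a finite set if and only if both of its ends avoid `c`. -/
theorem finite_line_iff (h : Assoc S y q c) (a : Y.MarkedLine z) :
    ((Y.lineStab z (Quotient.mk _ a) : Set (Y.pi1 z)) ∩ S).Finite ↔
      (∀ᶠ n in atTop, q⁻¹ * a.2.1 * Y.bdPath a.1 n ∉ c) ∧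
        ∀ᶠ n in atBot, q⁻¹ * a.2.1 * Y.bdPath a.1 n ∉ c := by
  have hp : q⁻¹ * a.2.1 ∈ Y.pathClass y (Y.init (Y.bd a.1 0)) :=
    mul_mem_pathClass (inv_mem_pathClass h.base) a.2.2
  refine (finite_zpowers_iff a S).trans ?_
  have h1 := h.finite_changes a
  have h2 := h.treeInv.eventually_line a.1 hp
  obtain ⟨t1, t2⟩ := tendsto_mul_len (Y := Y) a.1
  have e : ∀ P : ℤ → Prop, {n | P n}.Finite ↔ (∀ᶠ n in atTop, ¬ P n) ∧ ∀ᶠ n in atBot, ¬ P n := by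
    intro P
    rw [← eventually_sup, sup_comm, ← Int.cofinite_eq, eventually_cofinite]
    simp
  have h3 : {n : ℤ | a.word ^ n ∈ S}.Finite ↔
      {n : ℤ | q⁻¹ * a.2.1 * Y.bdPath a.1 (n * Y.len a.1) ∈ c}.Finite := by
    constructor
    · intro h4
      refine (h4.union h1).subset fun n hn => ?_
      by_cases h5 : a.word ^ n ∈ S
      · exact Or.inl h5
      · exact Or.inr fun h6 => h5 (h6.2 hn)
    · intro h4
      refine (h4.union h1).subset fun n hn => ?_
      by_cases h5 : q⁻¹ * a.2.1 * Y.bdPath a.1 (n * Y.len a.1) ∈ c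
      · exact Or.inl h5
      · exact Or.inr fun h6 => h5 (h6.1 hn)
  rw [h3, e]
  refine and_congr ⟨fun h4 => ?_, fun h4 => t1.eventually h4⟩ ⟨fun h4 => ?_, fun h4 => t2.eventually h4⟩
  · refine h2.1.resolve_left fun h5 => ?_
    obtain ⟨n, h6, h7⟩ := (h4.and (t1.eventually h5)).exists
    exact h6 h7
  · refine h2.2.resolve_left fun h5 => ?_
    obtain ⟨n, h6, h7⟩ := (h4.and (t2.eventually h5)).exists
    exact h6 h7

/-- A line is split by `S` if and only if its two ends lie on different sides of `c`. -/
theorem isSplitBy_iff (h : Assoc S y q c) (a : Y.MarkedLine z) :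
    IsSplitBy (Y.lineStab z (Quotient.mk _ a)) S ↔ LineSplit c a.1 (q⁻¹ * a.2.1) := by
  have hp : q⁻¹ * a.2.1 ∈ Y.pathClass y (Y.init (Y.bd a.1 0)) :=
    mul_mem_pathClass (inv_mem_pathClass h.base) a.2.2
  unfold IsSplitBy LineSplit
  rw [Set.Infinite, Set.Infinite, Set.sdiff_eq, h.finite_line_iff a, h.compl.finite_line_iff a]
  simp only [Set.mem_compl_iff, not_not]
  have h2 := h.treeInv.eventually_line a.1 hp
  have n1 : ¬ ((∀ᶠ n in atTop, q⁻¹ * a.2.1 * Y.bdPath a.1 n ∈ c) ∧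
      ∀ᶠ n in atTop, q⁻¹ * a.2.1 * Y.bdPath a.1 n ∉ c) := fun ⟨h3, h4⟩ => by
    obtain ⟨n, h5, h6⟩ := (h3.and h4).exists
    exact h6 h5
  have n2 : ¬ ((∀ᶠ n in atBot, q⁻¹ * a.2.1 * Y.bdPath a.1 n ∈ c) ∧
      ∀ᶠ n in atBot, q⁻¹ * a.2.1 * Y.bdPath a.1 n ∉ c) := fun ⟨h3, h4⟩ => by
    obtain ⟨n, h5, h6⟩ := (h3.and h4).exists
    exact h6 h5
  tauto

end Assoc

end BranchedComplex

namespace BranchedComplex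

open CombGraph Filter

variable {X Y Z : BranchedComplex}

/-! ### Reduced walks: the universal cover of the 1-skeleton as a tree -/

/-- `l` is a reduced edge path starting at `y`: a vertex of the universal cover at `y`. -/
def RWalk (Y : BranchedComplex) (y : Y.V) (l : List Y.Dart) : Prop :=
  FreeGroup.IsReduced l ∧ ∃ v, Y.IsWalk y l v

theorem rwalk_nil (y : Y.V) : Y.RWalk y [] := ⟨FreeGroup.IsReduced.nil, y, rfl⟩

theorem rwalk_concat {y v : Y.V} {l : List Y.Dart} {d : Y.Dart} (h : Y.RWalk y l)
    (hv : Y.IsWalk y l v) : Y.RWalk y (l ++ [d]) ↔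
      Y.init d = v ∧ ∀ a, l.getLast? = some a → d ≠ Y.flip a := by
  unfold RWalk
  rw [isReduced_concat]
  constructor
  · rintro ⟨⟨-, h1⟩, w, h2⟩
    exact ⟨(IsWalk.concat_iff.1 h2).1.end_unique hv, h1⟩
  · rintro ⟨h1, h2⟩
    exact ⟨⟨h.1, h2⟩, _, IsWalk.concat_iff.2 ⟨h1 ▸ hv, rfl⟩⟩

theorem RWalk.of_prefix {y : Y.V} {l m : List Y.Dart} (h : Y.RWalk y (l ++ m)) : Y.RWalk y l := by
  obtain ⟨h1, v, h2⟩ := h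
  obtain ⟨w, h3, -⟩ := h2.split
  exact ⟨h1.infix (List.prefix_append l m).isInfix, w, h3⟩

theorem RWalk.mem {y : Y.V} {l : List Y.Dart} (h : Y.RWalk y l) :
    ∃ v, FreeGroup.mk l ∈ Y.pathClass y v := by
  obtain ⟨-, v, h⟩ := h
  exact ⟨v, h.mem⟩

theorem exists_rwalk {y v : Y.V} {g : FreeGroup Y.E} (h : g ∈ Y.pathClass y v) :
    ∃ l, Y.RWalk y l ∧ FreeGroup.mk l = g := by
  obtain ⟨l, h1, h2, h3⟩ := exists_reduced h
  exact ⟨l, ⟨h2, v, h1⟩, h3⟩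

theorem mk_injOn_rwalk (y : Y.V) :
    Set.InjOn (FreeGroup.mk : List Y.Dart → FreeGroup Y.E) {l | Y.RWalk y l} :=
  fun _ h _ h' he => eq_of_isReduced_of_mk_eq h.1 h'.1 he

theorem RWalk.append {y v w : Y.V} {l m : List Y.Dart} (h : Y.RWalk y l) (hv : Y.IsWalk y l v)
    (hm : FreeGroup.IsReduced m) (hw : Y.IsWalk v m w)
    (hlm : ∀ a, l.getLast? = some a → ∀ b, m.head? = some b → b ≠ Y.flip a) :
    Y.RWalk y (l ++ m) := by
  refine ⟨?_, w, hv.append hw⟩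
  have h1 := h.1
  unfold FreeGroup.IsReduced at h1 hm ⊢
  rw [List.isChain_append]
  exact ⟨h1, hm, fun a ha b hb => reducedStep_iff.2 (hlm a ha b hb)⟩

/-- The oriented edges that the boundary of `f` traverses backwards from its corner `i`. -/
def bdRev (Y : BranchedComplex) (f : Y.F) (i : ℤ) (n : ℕ) : List Y.Dart :=
  FreeGroup.invRev (Y.bdList f (i - n) n)

theorem bdRev_succ' (f : Y.F) (i : ℤ) (n : ℕ) :
    Y.bdRev f i (n + 1) = Y.flip (Y.bd f (i - 1)) :: Y.bdRev f (i - 1) n := by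
  unfold bdRev
  rw [bdList_succ, FreeGroup.invRev_append]
  have h1 : i - ((n + 1 : ℕ) : ℤ) = i - 1 - n := by push_cast; ring
  rw [h1, sub_add_cancel]
  rfl

theorem isReduced_invRev {α : Type} {l : List (α × Bool)} (h : FreeGroup.IsReduced l) :
    FreeGroup.IsReduced (FreeGroup.invRev l) := by
  classical
  apply FreeGroup.IsReduced.of_reduce_eq
  rw [FreeGroup.reduce_invRev, h.reduce_eq]

theorem isReduced_bdRev (f : Y.F) (i : ℤ) (n : ℕ) : FreeGroup.IsReduced (Y.bdRev f i n) :=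
  isReduced_invRev (isReduced_bdList _ _ _)

theorem isWalk_bdRev (f : Y.F) (i : ℤ) (n : ℕ) :
    Y.IsWalk (Y.init (Y.bd f i)) (Y.bdRev f i n) (Y.init (Y.bd f (i - n))) := by
  have := (isWalk_bdList f (i - n) n).invRev
  rwa [sub_add_cancel] at this

theorem length_bdRev (f : Y.F) (i : ℤ) (n : ℕ) : (Y.bdRev f i n).length = n := by
  rw [bdRev, FreeGroup.invRev_length, length_bdList]

theorem bdPath_forward (f : Y.F) (i : ℤ) (n : ℕ) (l : List Y.Dart) :
    FreeGroup.mk l * (Y.bdPath f i)⁻¹ * Y.bdPath f (i + n) =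
      FreeGroup.mk (l ++ Y.bdList f i n) := by
  rw [bdPath_add, mul_assoc, inv_mul_cancel_left, FreeGroup.mul_mk]

theorem bdPath_backward (f : Y.F) (i : ℤ) (n : ℕ) (l : List Y.Dart) :
    FreeGroup.mk l * (Y.bdPath f i)⁻¹ * Y.bdPath f (i - n) =
      FreeGroup.mk (l ++ Y.bdRev f i n) := by
  have := bdPath_add f (i - n) n
  rw [sub_add_cancel] at this
  rw [this, ← FreeGroup.mul_mk, bdRev, ← FreeGroup.inv_mk]
  group

/-- A line passes through the vertex `l` of the universal cover; its points in front of `l` are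
reduced walks that extend `l`, provided that it does not continue along the edge that leads from
`l` back to the root. -/
theorem RWalk.forward {y : Y.V} {l : List Y.Dart} {f : Y.F} {i : ℤ}
    (h : Y.RWalk y (l ++ [Y.bd f i])) (n : ℕ) : Y.RWalk y (l ++ Y.bdList f i n) := by
  have hl := h.of_prefix
  obtain ⟨-, v, hv⟩ := id hl
  obtain ⟨h1, h2⟩ := (rwalk_concat hl hv).1 h
  subst h1
  refine hl.append hv (isReduced_bdList f i n) (isWalk_bdList f i n) fun a ha b hb => ?_
  rcases n with _ | n
  · simp [bdList_zero] at hb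
  · rw [bdList_succ'] at hb
    simp only [List.head?_cons, Option.some.injEq] at hb
    subst hb
    exact h2 a ha

theorem RWalk.backward {y : Y.V} {l : List Y.Dart} {f : Y.F} {i : ℤ}
    (h : Y.RWalk y (l ++ [Y.flip (Y.bd f (i - 1))])) (n : ℕ) :
    Y.RWalk y (l ++ Y.bdRev f i n) := by
  have hl := h.of_prefix
  obtain ⟨-, v, hv⟩ := id hl
  obtain ⟨h1, h2⟩ := (rwalk_concat hl hv).1 h
  rw [init_flip, bd_path, sub_add_cancel] at h1
  subst h1
  refine hl.append hv (isReduced_bdRev f i n) (isWalk_bdRev f i n) fun a ha b hb => ?_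
  rcases n with _ | n
  · simp [bdRev, bdList_zero] at hb
  · rw [bdRev_succ'] at hb
    simp only [List.head?_cons, Option.some.injEq] at hb
    subst hb
    exact h2 a ha

/-- All but finitely many of the vertices of the universal cover beyond `l` lie in `c`. -/
def AllIn (Y : BranchedComplex) (y : Y.V) (c : Set (FreeGroup Y.E)) (l : List Y.Dart) : Prop :=
  {r | Y.RWalk y r ∧ l <+: r ∧ FreeGroup.mk r ∉ c}.Finite

/-- `c` is constant beyond `l`, up to finitely many vertices. -/
def EvConst (Y : BranchedComplex) (y : Y.V) (c : Set (FreeGroup Y.E)) (l : List Y.Dart) : Prop :=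
  Y.AllIn y c l ∨ Y.AllIn y cᶜ l

theorem AllIn.eventually {y : Y.V} {c : Set (FreeGroup Y.E)} {l : List Y.Dart}
    (h : Y.AllIn y c l) (r : ℕ → List Y.Dart) (h1 : ∀ n, Y.RWalk y (r n)) (h2 : ∀ n, l <+: r n)
    (h3 : Function.Injective r) : ∀ᶠ n in atTop, FreeGroup.mk (r n) ∈ c := by
  have : {n | FreeGroup.mk (r n) ∉ c}.Finite :=
    (Set.Finite.preimage (f := r) h3.injOn h).subset fun n hn => ⟨h1 n, h2 n, hn⟩
  rwa [← Nat.cofinite_eq_atTop, eventually_cofinite]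

theorem AllIn.forward {y : Y.V} {c : Set (FreeGroup Y.E)} {l : List Y.Dart} {f : Y.F} {i : ℤ}
    (h : Y.AllIn y c (l ++ [Y.bd f i])) (hl : Y.RWalk y (l ++ [Y.bd f i])) :
    ∀ᶠ n in atTop, FreeGroup.mk l * (Y.bdPath f i)⁻¹ * Y.bdPath f n ∈ c := by
  have h1 := h.eventually (fun n => l ++ Y.bdList f i (n + 1)) (fun n => hl.forward _)
    (fun n => by
      rw [bdList_succ']
      exact ⟨_, (List.append_cons _ _ _).symm⟩)
    (fun m n h => by
      have := congrArg List.length h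
      simp only [List.length_append, length_bdList] at this
      omega)
  obtain ⟨N, hN⟩ := eventually_atTop.1 h1
  refine eventually_atTop.2 ⟨i + (N + 1), fun n hn => ?_⟩
  obtain ⟨k, hk⟩ := Int.le.dest hn
  have h2 := hN (N + k) (by omega)
  rw [← bdPath_forward] at h2
  rw [show n = i + ((N + k + 1 : ℕ) : ℤ) by push_cast; omega]
  exact h2

theorem AllIn.backward {y : Y.V} {c : Set (FreeGroup Y.E)} {l : List Y.Dart} {f : Y.F} {i : ℤ}
    (h : Y.AllIn y c (l ++ [Y.flip (Y.bd f (i - 1))]))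
    (hl : Y.RWalk y (l ++ [Y.flip (Y.bd f (i - 1))])) :
    ∀ᶠ n in atBot, FreeGroup.mk l * (Y.bdPath f i)⁻¹ * Y.bdPath f n ∈ c := by
  have h1 := h.eventually (fun n => l ++ Y.bdRev f i (n + 1)) (fun n => hl.backward _)
    (fun n => by
      rw [bdRev_succ']
      exact ⟨_, (List.append_cons _ _ _).symm⟩)
    (fun m n h => by
      have := congrArg List.length h
      simp only [List.length_append, length_bdRev] at this
      omega)
  obtain ⟨N, hN⟩ := eventually_atTop.1 h1
  refine eventually_atBot.2 ⟨i - (N + 1), fun n hn => ?_⟩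
  obtain ⟨k, hk⟩ := Int.le.dest hn
  have h2 := hN (N + k) (by omega)
  rw [← bdPath_backward] at h2
  rw [show n = i - ((N + k + 1 : ℕ) : ℤ) by push_cast; omega]
  exact h2

/-- The line that turns the corner `i` of the face `f` at the vertex `l` of the universal cover has
both of its ends on the same side of `c`. -/
def Balanced (c : Set (FreeGroup Y.E)) (l : List Y.Dart) (f : Y.F) (i : ℤ) : Prop :=
  ¬ LineSplit c f (FreeGroup.mk l * (Y.bdPath f i)⁻¹)

/-- If the line through a corner at `l` is balanced, then the half-trees on the two sides of the
corner lie on the same side of `c`. -/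
theorem Balanced.allIn_iff {y : Y.V} {c : Set (FreeGroup Y.E)} {l : List Y.Dart} {f : Y.F} {i : ℤ}
    (hb : Balanced c l f i) (h1 : Y.RWalk y (l ++ [Y.flip (Y.bd f (i - 1))]))
    (h2 : Y.RWalk y (l ++ [Y.bd f i])) (h3 : Y.EvConst y c (l ++ [Y.flip (Y.bd f (i - 1))]))
    (h4 : Y.EvConst y c (l ++ [Y.bd f i])) :
    Y.AllIn y c (l ++ [Y.flip (Y.bd f (i - 1))]) ↔ Y.AllIn y c (l ++ [Y.bd f i]) := by
  unfold Balanced LineSplit at hb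
  rw [not_not] at hb
  constructor
  · intro h5
    refine h4.resolve_right fun h6 => ?_
    obtain ⟨n, h7, h8⟩ := ((hb.2 (h5.backward h1)).and (h6.forward h2)).exists
    exact h8 h7
  · intro h5
    refine h3.resolve_right fun h6 => ?_
    obtain ⟨n, h7, h8⟩ := ((hb.1 (h5.forward h2)).and (h6.backward h1)).exists
    exact h8 h7

theorem prefix_cases {α : Type} {l r : List α} (h : l <+: r) : r = l ∨ ∃ d, l ++ [d] <+: r := by
  obtain ⟨m, rfl⟩ := h
  rcases m with _ | ⟨d, m⟩
  · exact Or.inl (by simp)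
  · exact Or.inr ⟨d, m, by simp⟩

theorem AllIn.of_children [Finite Y.E] {y : Y.V} {c : Set (FreeGroup Y.E)} {l : List Y.Dart}
    (h : ∀ d, Y.RWalk y (l ++ [d]) → Y.AllIn y c (l ++ [d])) : Y.AllIn y c l := by
  have key : ∀ d, {r | Y.RWalk y r ∧ l ++ [d] <+: r ∧ FreeGroup.mk r ∉ c}.Finite := by
    intro d
    by_cases hd : Y.RWalk y (l ++ [d])
    · exact h d hd
    · refine Set.finite_empty.subset ?_
      rintro r ⟨h1, ⟨m, rfl⟩, -⟩
      exact hd h1.of_prefix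
  refine ((Set.finite_iUnion key).union (Set.finite_singleton l)).subset ?_
  rintro r ⟨h1, h2, h3⟩
  rcases prefix_cases h2 with rfl | ⟨d, hd⟩
  · exact Or.inr rfl
  · exact Or.inl (Set.mem_iUnion.2 ⟨d, h1, hd, h3⟩)

theorem EvConst.of_children [Finite Y.E] {y : Y.V} {c : Set (FreeGroup Y.E)} {l : List Y.Dart}
    (h : ∀ d, Y.RWalk y (l ++ [d]) → Y.EvConst y c (l ++ [d]))
    (h' : ∀ d d', Y.RWalk y (l ++ [d]) → Y.RWalk y (l ++ [d']) →
      (Y.AllIn y c (l ++ [d]) ↔ Y.AllIn y c (l ++ [d']))) : Y.EvConst y c l := by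
  by_cases hc : ∀ d, Y.RWalk y (l ++ [d]) → Y.AllIn y c (l ++ [d])
  · exact Or.inl (AllIn.of_children hc)
  · push Not at hc
    obtain ⟨d, h1, h2⟩ := hc
    exact Or.inr (AllIn.of_children fun d' h3 => (h d' h3).resolve_left fun h4 =>
      h2 ((h' d d' h1 h3).2 h4))

/-- Beyond a certain depth, a set with finite coboundary is constant. -/
theorem TreeInv.exists_depth [Finite Y.E] {y : Y.V} {c : Set (FreeGroup Y.E)}
    (hc : Y.TreeInv y c) : ∃ N, ∀ l m, Y.RWalk y (l ++ m) → N ≤ l.length →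
      (FreeGroup.mk l ∈ c ↔ FreeGroup.mk (l ++ m) ∈ c) := by
  have h1 : {l | Y.RWalk y l ∧ FreeGroup.mk l ∈ ⋃ d, {g | g ∈ Y.pathClass y (Y.init d) ∧
      ¬ (g ∈ c ↔ g * FreeGroup.mk [d] ∈ c)}}.Finite :=
    Set.Finite.of_injOn (f := FreeGroup.mk) (fun l hl => hl.2)
      ((mk_injOn_rwalk y).mono fun l hl => hl.1) (Set.finite_iUnion hc)
  obtain ⟨N, hN⟩ := (h1.image List.length).bddAbove
  refine ⟨N + 1, fun l m h hl => ?_⟩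
  induction m using List.reverseRecOn with
  | nil => simp
  | append_singleton m d ih =>
    rw [← List.append_assoc] at h ⊢
    have h2 := h.of_prefix
    rw [ih h2]
    by_contra h3
    obtain ⟨-, v, hv⟩ := id h2
    obtain ⟨h4, -⟩ := (rwalk_concat h2 hv).1 h
    have h5 := hN ⟨l ++ m, ⟨h2, Set.mem_iUnion.2 ⟨d, h4 ▸ hv.mem, by rwa [← mk_concat]⟩⟩, rfl⟩
    rw [List.length_append] at h5
    omega

/-- Removing an edge from the link of a vertex of the 1-skeleton (a vertex of the link) leaves the
link connected. -/
def NoCutVertex (Y : BranchedComplex) : Prop :=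
  ∀ d₀ d d' : Y.Dart, Y.init d = Y.init d₀ → Y.init d' = Y.init d₀ → d ≠ d₀ → d' ≠ d₀ →
    Relation.EqvGen (fun a b => Y.LinkAdj a b ∧ a ≠ d₀ ∧ b ≠ d₀) d d'

theorem LinkAdj.init_eq {d d' : Y.Dart} (h : Y.LinkAdj d d') : Y.init d = Y.init d' := by
  obtain ⟨f, i, rfl, rfl⟩ := h
  rw [init_flip, bd_path, sub_add_cancel]

theorem iff_of_eqvGen {α : Type} {r : α → α → Prop} {P : α → Prop} (h : ∀ a b, r a b → (P a ↔ P b))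
    {a b : α} (hab : Relation.EqvGen r a b) : P a ↔ P b := by
  induction hab with
  | rel a b hab => exact h a b hab
  | refl a => rfl
  | symm a b _ ih => exact ih.symm
  | trans a b c _ _ ih ih' => exact ih.trans ih'

theorem eqvGen_bind {α : Type} {r s : α → α → Prop} (h : ∀ a b, s a b → Relation.EqvGen r a b)
    {a b : α} (hab : Relation.EqvGen s a b) : Relation.EqvGen r a b := by
  induction hab with
  | rel a b hab => exact h a b hab
  | refl a => exact .refl a
  | symm a b _ ih => exact .symm _ _ ih
  | trans a b c _ _ ih ih' => exact .trans _ _ _ ih ih'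

theorem eqvGen_mono {α : Type} {r s : α → α → Prop} (h : ∀ a b, s a b → r a b) {a b : α}
    (hab : Relation.EqvGen s a b) : Relation.EqvGen r a b :=
  eqvGen_bind (fun a b hab => .rel _ _ (h a b hab)) hab

/-- The basic propagation argument: if no link has a cut vertex and all lines that turn corners
at vertices in `Q`, away from the root, are balanced, then `c` is constant beyond every vertex
of `Q`. This follows by induction from far away towards the root. -/
theorem TreeInv.evConst [Finite Y.E] (hY : Y.NoCutVertex) {y : Y.V} {c : Set (FreeGroup Y.E)}
    (hc : Y.TreeInv y c) (Q : List Y.Dart → Prop) (hQ : ∀ l d, Q l → Q (l ++ [d]))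
    (hb : ∀ l, l ≠ [] → Q l → ∀ f i, Y.RWalk y (l ++ [Y.flip (Y.bd f (i - 1))]) →
      Y.RWalk y (l ++ [Y.bd f i]) → Balanced c l f i)
    (l : List Y.Dart) (hl : Y.RWalk y l) (h0 : l ≠ []) (hl' : Q l) : Y.EvConst y c l := by
  obtain ⟨N, hN⟩ := hc.exists_depth
  obtain ⟨k, hk⟩ : ∃ k, N ≤ l.length + k := ⟨N, by omega⟩
  induction k generalizing l with
  | zero =>
    by_cases h1 : FreeGroup.mk l ∈ c
    · refine Or.inl (Set.finite_empty.subset ?_)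
      rintro r ⟨h2, ⟨m, rfl⟩, h3⟩
      exact h3 ((hN l m h2 hk).1 h1)
    · refine Or.inr (Set.finite_empty.subset ?_)
      rintro r ⟨h2, ⟨m, rfl⟩, h3⟩
      exact h3 fun h4 => h1 ((hN l m h2 hk).2 h4)
  | succ k ih =>
    have h1 : ∀ d, Y.RWalk y (l ++ [d]) → Y.EvConst y c (l ++ [d]) := fun d hd =>
      ih _ hd (by simp) (hQ l d hl') (by rw [List.length_append, List.length_singleton]; omega)
    refine EvConst.of_children h1 fun d d' hd hd' => ?_
    obtain ⟨m, a, rfl⟩ : ∃ m a, l = m ++ [a] :=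
      ⟨_, _, (List.dropLast_append_getLast h0).symm⟩
    obtain ⟨-, v, hv⟩ := id hl
    have hva : Y.init (Y.flip a) = v := (IsWalk.concat_iff.1 hv).2
    have hch : ∀ d, Y.RWalk y (m ++ [a] ++ [d]) ↔ Y.init d = Y.init (Y.flip a) ∧ d ≠ Y.flip a := by
      intro d
      rw [rwalk_concat hl hv, hva]
      simp
    obtain ⟨h2, h3⟩ := (hch d).1 hd
    obtain ⟨h4, h5⟩ := (hch d').1 hd'
    -- membership is propagated along the link, away from the edge leading back to the root
    have key := iff_of_eqvGen (P := fun d => Y.init d = Y.init (Y.flip a) →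
      Y.AllIn y c (m ++ [a] ++ [d])) ?_ (hY (Y.flip a) d d' h2 h4 h3 h5)
    · simpa only [h2, h4, true_imp_iff] using key
    · rintro b b' ⟨h6, h7, h8⟩
      have h9 := h6.init_eq
      obtain ⟨f, i, rfl, rfl⟩ := h6
      rw [h9]
      refine imp_congr_right fun h10 => ?_
      have h11 := (hch _).2 ⟨h9.trans h10, h7⟩
      have h12 := (hch _).2 ⟨h10, h8⟩
      exact (hb _ h0 hl' f i h11 h12).allIn_iff h11 h12 (h1 _ h11) (h1 _ h12)

/-- The conditions on a finite complex that rule out visible reductions and elementary unfoldings: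
all valences are at least `2`, links are connected and have no cut vertices, and every edge is
traversed at least twice. -/
structure IsTight (Y : BranchedComplex) : Prop where
  valence : ∀ v, 2 ≤ Y.valence v
  conn : ∀ v, Y.LinkConnected v
  noCut : Y.NoCutVertex
  hits : ∀ d, 2 ≤ (Y.hits d).encard

theorem exists_ne_of_two_le_encard {α : Type} {s : Set α} (h : 2 ≤ s.encard) (a : α) :
    ∃ b ∈ s, b ≠ a := by
  obtain ⟨x, y, hx, hy, hxy⟩ := Set.one_lt_encard_iff.1 (lt_of_lt_of_le (by norm_num) h)
  by_cases hxa : x = a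
  · exact ⟨y, hy, fun h => hxy (hxa.trans h.symm)⟩
  · exact ⟨x, hx, hxa⟩

theorem bd_ne_flip (f : Y.F) (i : ℤ) : Y.bd f i ≠ Y.flip (Y.bd f (i - 1)) := by
  have := Y.bd_immersed f (i - 1)
  rwa [sub_add_cancel] at this

/-- In a tight complex, the link of a vertex stays connected when a corner is removed (an edge of
the link, say the corner `0` of the face `f₀`). -/
theorem IsTight.eqvGen_ne_corner (hY : Y.IsTight) (f₀ : Y.F) {d d' : Y.Dart}
    (hd : Y.init d = Y.init d') :
    Relation.EqvGen (fun a b => ∃ f i, a = Y.flip (Y.bd f (i - 1)) ∧ b = Y.bd f i ∧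
      ¬ (f = f₀ ∧ (Y.len f₀ : ℤ) ∣ i)) d d' := by
  set r : Y.Dart → Y.Dart → Prop := fun a b => ∃ f i, a = Y.flip (Y.bd f (i - 1)) ∧ b = Y.bd f i ∧
      ¬ (f = f₀ ∧ (Y.len f₀ : ℤ) ∣ i) with hr
  -- the end points of the removed corner
  set a := Y.flip (Y.bd f₀ (0 - 1)) with ha
  set b := Y.bd f₀ 0 with hb
  have hdvd : ∀ i : ℤ, (Y.len f₀ : ℤ) ∣ i → Y.bd f₀ i = b ∧ Y.flip (Y.bd f₀ (i - 1)) = a := by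
    rintro _ ⟨k, rfl⟩
    constructor
    · rw [mul_comm, hb, ← bd_add_mul f₀ 0 k, zero_add]
    · rw [mul_comm, ha, ← bd_add_mul f₀ (0 - 1) k]
      congr 2
      ring
  have hab : b ≠ a := bd_ne_flip f₀ 0
  have hinit : Y.init a = Y.init b := LinkAdj.init_eq ⟨f₀, 0, rfl, rfl⟩
  have main : Relation.EqvGen r a b := by
    -- a second neighbour `x` of `a`
    obtain ⟨x, hx, hxa, hxi⟩ : ∃ x, Relation.EqvGen r x a ∧ x ≠ a ∧ Y.init x = Y.init a := by
      have hlast : 0 < Y.len f₀ := Y.len_pos f₀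
      obtain ⟨⟨f, j⟩, h1, h2⟩ := exists_ne_of_two_le_encard (hY.hits a)
        ⟨f₀, ⟨Y.len f₀ - 1, by omega⟩⟩
      rcases h1 with h1 | h1
      · have h1 : Y.bd f (j : ℕ) = a := h1
        refine ⟨Y.flip (Y.bd f ((j : ℕ) - 1)), .rel _ _ ⟨f, (j : ℕ), rfl, h1.symm, ?_⟩, ?_, ?_⟩
        · rintro ⟨rfl, h3⟩
          exact hab ((hdvd _ h3).1.symm.trans h1)
        · rw [← h1]
          exact (bd_ne_flip f _).symm
        · rw [← h1]
          exact LinkAdj.init_eq ⟨f, (j : ℕ), rfl, rfl⟩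
      · have h1 : Y.bd f (j : ℕ) = Y.flip a := h1
        have h3 : Y.flip (Y.bd f ((j : ℕ) + 1 - 1)) = a := by
          rw [add_sub_cancel_right, h1, CombGraph.flip_flip]
        refine ⟨Y.bd f ((j : ℕ) + 1), .symm _ _ (.rel _ _ ⟨f, (j : ℕ) + 1, h3.symm, rfl, ?_⟩),
          ?_, ?_⟩
        · rintro ⟨rfl, h4⟩
          have h5 := j.2
          have h6 : (Y.len f : ℤ) ≤ (j : ℕ) + 1 := Int.le_of_dvd (by omega) h4
          refine h2 ?_
          congr 1
          apply Fin.ext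
          change (j : ℕ) = _ - 1
          omega
        · rw [← h3]
          exact bd_ne_flip f _
        · rw [← h3]
          exact (LinkAdj.init_eq ⟨f, (j : ℕ) + 1, rfl, rfl⟩).symm
    refine .trans _ _ _ (.symm _ _ hx) ?_
    refine eqvGen_bind ?_ (hY.noCut a x b hxi hinit.symm hxa hab)
    rintro u v ⟨⟨f, i, rfl, rfl⟩, h1, -⟩
    refine .rel _ _ ⟨f, i, rfl, rfl, ?_⟩
    rintro ⟨rfl, h2⟩
    exact h1 (hdvd i h2).2
  refine eqvGen_bind ?_ (hY.conn (Y.init d') d d' hd rfl)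
  rintro u v ⟨f, i, rfl, rfl⟩
  by_cases h : f = f₀ ∧ (Y.len f₀ : ℤ) ∣ i
  · obtain ⟨rfl, h⟩ := h
    rw [(hdvd i h).1, (hdvd i h).2]
    exact main
  · exact .rel _ _ ⟨f, i, rfl, rfl, h⟩

/-- If a line through the root is given by `1`, then a line that turns a corner at a vertex beyond
the root is a different line. -/
theorem not_through_root {y : Y.V} {l : List Y.Dart} (h0 : l ≠ []) {f : Y.F} {i n : ℤ}
    (h1 : Y.RWalk y (l ++ [Y.flip (Y.bd f (i - 1))])) (h2 : Y.RWalk y (l ++ [Y.bd f i])) :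
    FreeGroup.mk l * (Y.bdPath f i)⁻¹ * Y.bdPath f n ≠ 1 := by
  have key : ∀ {m : List Y.Dart}, Y.RWalk y (l ++ m) → FreeGroup.mk (l ++ m) ≠ 1 := by
    intro m hm h3
    have := mk_injOn_rwalk y hm (rwalk_nil y) h3
    simp [h0] at this
  rcases le_total i n with h | h
  · obtain ⟨k, rfl⟩ := Int.le.dest h
    rw [bdPath_forward]
    exact key (h2.forward k)
  · obtain ⟨k, hk⟩ := Int.le.dest h
    obtain rfl : n = i - k := by omega
    rw [bdPath_backward]
    exact key (h1.backward k)

/-- The universal cover of a tight finite complex has no non-trivial decomposition into two parts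
with finite coboundary that separates the ends of at most one line. -/
theorem IsTight.not_hasWeakSplitting [Finite Y.V] [Finite Y.E] (hY : Y.IsTight) :
    ¬ Y.HasWeakSplitting := by
  rintro ⟨z, S, hS, hinf, hinf', huniq⟩
  -- it suffices to find a root at which the propagation can be completed
  have finish : ∀ (y : Y.V) (q : FreeGroup Y.E) (c : Set (FreeGroup Y.E)), Assoc S y q c →
      (∀ l, l ≠ [] → ∀ f i, Y.RWalk y (l ++ [Y.flip (Y.bd f (i - 1))]) →
        Y.RWalk y (l ++ [Y.bd f i]) → Balanced c l f i) →
      (∀ d d', Y.init d = y → Y.init d' = y → Relation.EqvGen (fun a b => ∃ f i,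
        a = Y.flip (Y.bd f (i - 1)) ∧ b = Y.bd f i ∧
          (Y.init (Y.bd f i) = y → Balanced c [] f i)) d d') → False := by
    intro y q c ha hb hr
    have h1 : ∀ d, Y.RWalk y ([] ++ [d]) → Y.EvConst y c ([] ++ [d]) := fun d hd =>
      ha.treeInv.evConst hY.noCut (fun _ => True) (fun _ _ _ => trivial)
        (fun l h0 _ => hb l h0) _ hd (by simp) trivial
    have hch : ∀ d, Y.RWalk y ([] ++ [d]) ↔ Y.init d = y := by
      intro d
      rw [rwalk_concat (rwalk_nil y) rfl]
      simp
    have h2 : Y.EvConst y c [] := by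
      refine EvConst.of_children h1 fun d d' hd hd' => ?_
      rw [hch] at hd hd'
      have key := iff_of_eqvGen (P := fun d => Y.init d = y → Y.AllIn y c ([] ++ [d])) ?_
        (hr d d' hd hd')
      · simpa only [hd, hd', true_imp_iff] using key
      · rintro b b' ⟨f, i, rfl, rfl, h6⟩
        have h9 : Y.init (Y.flip (Y.bd f (i - 1))) = Y.init (Y.bd f i) :=
          LinkAdj.init_eq ⟨f, i, rfl, rfl⟩
        rw [h9]
        refine imp_congr_right fun h10 => ?_
        have h11 := (hch _).2 (h9.trans h10)
        have h12 := (hch _).2 h10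
        exact (h6 h10).allIn_iff h11 h12 (h1 _ h11) (h1 _ h12)
    have h3 : ∀ c', Y.AllIn y c' [] → {g | (∃ v, g ∈ Y.pathClass y v) ∧ g ∈ c'ᶜ}.Finite := by
      intro c' h
      refine (h.image FreeGroup.mk).subset ?_
      rintro g ⟨⟨v, h1⟩, h2⟩
      obtain ⟨l, h3, rfl⟩ := exists_rwalk h1
      exact ⟨l, ⟨h3, List.nil_prefix, h2⟩, rfl⟩
    rcases h2 with h2 | h2
    · exact hinf' (ha.compl.finite_iff.2 (h3 _ h2))
    · refine hinf (ha.finite_iff.2 ?_)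
      simpa using h3 _ h2
  have hline : ∀ (y : Y.V) (q : FreeGroup Y.E) (c : Set (FreeGroup Y.E)), Assoc S y q c →
      ∀ (f : Y.F) (p : FreeGroup Y.E) (hp : q * p ∈ Y.pathClass z (Y.init (Y.bd f 0))),
      LineSplit c f p → IsSplitBy (Y.lineStab z (Quotient.mk _ ⟨f, q * p, hp⟩)) S := by
    intro y q c ha f p hp h
    rw [ha.isSplitBy_iff]
    simpa using h
  have hwalk : ∀ {y : Y.V} {l : List Y.Dart} {f : Y.F} {i : ℤ}, Y.RWalk y (l ++ [Y.bd f i]) →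
      FreeGroup.mk l * (Y.bdPath f i)⁻¹ ∈ Y.pathClass y (Y.init (Y.bd f 0)) := by
    rintro y l f i ⟨-, v, h⟩
    exact mul_mem_pathClass (IsWalk.concat_iff.1 h).1.mem (inv_mem_pathClass (bdPath_mem f i))
  by_cases hex : ∃ a : Y.MarkedLine z, IsSplitBy (Y.lineStab z (Quotient.mk _ a)) S
  · -- one line is split: the root is placed on it
    obtain ⟨⟨f₀, p₀, hp₀⟩, h0⟩ := hex
    obtain ⟨c, ha⟩ := Assoc.exists_of_almostInv hS hp₀
    have hsame : ∀ (f : Y.F) (p : FreeGroup Y.E),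
        p ∈ Y.pathClass (Y.init (Y.bd f₀ 0)) (Y.init (Y.bd f 0)) → LineSplit c f p →
        f₀ = f ∧ ∃ n : ℤ, p = Y.bdLoop f₀ ^ n := by
      intro f p hp h
      have := huniq _ _ h0 (hline _ _ _ ha f p (mul_mem_pathClass hp₀ hp) h)
      obtain ⟨h1, n, h2⟩ := line_eq_iff.1 this
      exact ⟨h1, n, mul_left_cancel h2⟩
    refine finish _ _ _ ha (fun l h1 f i h2 h3 h4 => ?_) (fun d d' hd hd' => ?_)
    · obtain ⟨rfl, n, h5⟩ := hsame f _ (hwalk h3) h4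
      refine not_through_root h1 h2 h3 (n := -n * Y.len f₀) ?_
      rw [h5, bdPath_mul_len, ← zpow_add, add_neg_cancel, zpow_zero]
    · refine eqvGen_mono ?_ (hY.eqvGen_ne_corner f₀ (hd.trans hd'.symm))
      rintro a b ⟨f, i, rfl, rfl, h1⟩
      refine ⟨f, i, rfl, rfl, fun h2 h3 => h1 ?_⟩
      have h4 : Y.RWalk (Y.init (Y.bd f₀ 0)) ([] ++ [Y.bd f i]) := by
        rw [rwalk_concat (rwalk_nil _) rfl]
        simp [h2]
      obtain ⟨rfl, n, h5⟩ := hsame f _ (hwalk h4) h3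
      refine ⟨rfl, -n, ?_⟩
      rw [← FreeGroup.one_eq_mk, one_mul, inv_eq_iff_eq_inv, ← zpow_neg, ← bdPath_mul_len] at h5
      rw [bdPath_injective f₀ h5, mul_comm]
  · obtain ⟨c, ha⟩ := Assoc.exists_of_almostInv hS (one_mem_pathClass z)
    have hbal : ∀ l f i, Y.RWalk z (l ++ [Y.bd f i]) → Balanced c l f i := by
      intro l f i h1 h2
      exact hex ⟨_, hline _ _ _ ha f _ (by rw [one_mul]; exact hwalk h1) h2⟩
    refine finish _ _ _ ha (fun l _ f i _ h => hbal l f i h) (fun d d' hd hd' => ?_)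
    refine eqvGen_mono ?_ (hY.conn z d d' hd hd')
    rintro a b ⟨f, i, rfl, rfl⟩
    refine ⟨f, i, rfl, rfl, fun h2 => hbal [] f i ?_⟩
    rw [rwalk_concat (rwalk_nil _) rfl]
    simp [h2]

end BranchedComplex

namespace BranchedComplex

open CombGraph Filter

variable {X Y Z : BranchedComplex}

/-! ### Half-trees at the root -/

/-- The vertices of the universal cover at `y` which lie beyond the edges of a set `A` at the
root. -/
def startIn (Y : BranchedComplex) (y : Y.V) (A : Set Y.Dart) : Set (FreeGroup Y.E) :=
  {g | ∃ d ∈ A, ∃ l, Y.RWalk y (d :: l) ∧ FreeGroup.mk (d :: l) = g}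

theorem mem_startIn_cons {y : Y.V} {A : Set Y.Dart} {d : Y.Dart} {l : List Y.Dart}
    (h : Y.RWalk y (d :: l)) : FreeGroup.mk (d :: l) ∈ Y.startIn y A ↔ d ∈ A := by
  constructor
  · rintro ⟨d', h1, l', h2, h3⟩
    have := mk_injOn_rwalk y h2 h h3
    simp only [List.cons.injEq] at this
    exact this.1 ▸ h1
  · exact fun h1 => ⟨d, h1, l, h, rfl⟩

/-- Membership in `startIn y A` only changes along the edges that issue from the root. -/
theorem startIn_change {y : Y.V} {A : Set Y.Dart} {d : Y.Dart} {g : FreeGroup Y.E}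
    (hg : g ∈ Y.pathClass y (Y.init d))
    (h : ¬ (g ∈ Y.startIn y A ↔ g * FreeGroup.mk [d] ∈ Y.startIn y A)) :
    g = 1 ∨ g * FreeGroup.mk [d] = 1 := by
  obtain ⟨l, h1, h2, rfl⟩ := exists_reduced hg
  have hl : Y.RWalk y l := ⟨h2, _, h1⟩
  rcases l with _ | ⟨b, l⟩
  · exact Or.inl rfl
  refine Or.inr ?_
  by_contra h3
  apply h
  by_cases h4 : ∀ a, (b :: l).getLast? = some a → d ≠ Y.flip a
  · have h5 := (rwalk_concat hl h1).2 ⟨rfl, h4⟩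
    rw [← mk_concat, mem_startIn_cons hl]
    exact (mem_startIn_cons h5).symm
  · push Not at h4
    obtain ⟨a, h5, rfl⟩ := h4
    obtain ⟨m, h6⟩ := List.getLast?_eq_some_iff.1 h5
    rw [h6, mk_concat, mk_flip, mul_inv_cancel_right] at h3 ⊢
    rcases m with _ | ⟨b', m⟩
    · exact absurd rfl h3
    · rw [h6] at hl
      have h7 : Y.RWalk y (b' :: m) := hl.of_prefix
      rw [← mk_concat, mem_startIn_cons h7]
      exact mem_startIn_cons hl

theorem treeInv_startIn (y : Y.V) (A : Set Y.Dart) : Y.TreeInv y (Y.startIn y A) := by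
  intro d
  refine (Set.toFinite {1, (FreeGroup.mk [d])⁻¹}).subset ?_
  rintro g ⟨h1, h2⟩
  exact (startIn_change h1 h2).imp id eq_inv_of_mul_eq_one_left

theorem eventually_startIn_top {y : Y.V} (A : Set Y.Dart) {f : Y.F} {k : ℤ}
    (h : Y.init (Y.bd f k) = y) :
    ∀ᶠ n in atTop, ((Y.bdPath f k)⁻¹ * Y.bdPath f n ∈ Y.startIn y A ↔ Y.bd f k ∈ A) := by
  have h1 : Y.RWalk y ([] ++ [Y.bd f k]) := by
    rw [rwalk_concat (rwalk_nil y) rfl]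
    simp [h]
  refine (eventually_ge_atTop (k + 1)).mono fun n hn => ?_
  obtain ⟨m, hm⟩ := Int.le.dest hn
  have h2 := bdPath_forward f k (m + 1) []
  have h3 := h1.forward (m + 1)
  rw [← FreeGroup.one_eq_mk, one_mul] at h2
  rw [show n = k + ((m + 1 : ℕ) : ℤ) by push_cast; omega, h2]
  rw [bdList_succ'] at h3 ⊢
  exact mem_startIn_cons h3

theorem eventually_startIn_bot {y : Y.V} (A : Set Y.Dart) {f : Y.F} {k : ℤ}
    (h : Y.init (Y.bd f k) = y) :
    ∀ᶠ n in atBot, ((Y.bdPath f k)⁻¹ * Y.bdPath f n ∈ Y.startIn y A ↔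
      Y.flip (Y.bd f (k - 1)) ∈ A) := by
  have h0 : Y.init (Y.flip (Y.bd f (k - 1))) = Y.init (Y.bd f k) :=
    LinkAdj.init_eq ⟨f, k, rfl, rfl⟩
  have h1 : Y.RWalk y ([] ++ [Y.flip (Y.bd f (k - 1))]) := by
    rw [rwalk_concat (rwalk_nil y) rfl]
    simp [h0, h]
  refine (eventually_le_atBot (k - 1)).mono fun n hn => ?_
  obtain ⟨m, hm⟩ := Int.le.dest hn
  have h2 := bdPath_backward f k (m + 1) []
  have h3 := h1.backward (m + 1)
  rw [← FreeGroup.one_eq_mk, one_mul] at h2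
  rw [show n = k - ((m + 1 : ℕ) : ℤ) by push_cast; omega, h2]
  rw [bdRev_succ'] at h3 ⊢
  exact mem_startIn_cons h3

theorem eventually_iff_const {F : Filter ℤ} [F.NeBot] {P : ℤ → Prop} {b : Prop}
    (h : ∀ᶠ n in F, (P n ↔ b)) : (∀ᶠ n in F, P n) ↔ b :=
  (eventually_congr h).trans eventually_const

/-- A line through the root is split by a union of half-trees at the root if and only if exactly one
of its two directions at the root lies in the given set. -/
theorem lineSplit_startIn {y : Y.V} (A : Set Y.Dart) {f : Y.F} {k : ℤ}
    (h : Y.init (Y.bd f k) = y) : LineSplit (Y.startIn y A) f (Y.bdPath f k)⁻¹ ↔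
      ¬ (Y.bd f k ∈ A ↔ Y.flip (Y.bd f (k - 1)) ∈ A) := by
  unfold LineSplit
  rw [eventually_iff_const (eventually_startIn_top A h),
    eventually_iff_const (eventually_startIn_bot A h)]

/-- Only lines through the root are split. -/
theorem LineSplit.through_root {y : Y.V} {A : Set Y.Dart} {f : Y.F} {p : FreeGroup Y.E}
    (hp : p ∈ Y.pathClass y (Y.init (Y.bd f 0))) (h : LineSplit (Y.startIn y A) f p) :
    ∃ k, p = (Y.bdPath f k)⁻¹ ∧ Y.init (Y.bd f k) = y := by
  have h1 : ∃ k, p * Y.bdPath f k = 1 := by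
    by_contra h1
    push Not at h1
    have h2 : ∀ n, p * Y.bdPath f n ∈ Y.startIn y A ↔ p * Y.bdPath f (n + 1) ∈ Y.startIn y A := by
      intro n
      by_contra h3
      rw [bdPath_succ, ← mul_assoc] at h3
      rcases startIn_change (mul_mem_pathClass hp (bdPath_mem f n)) h3 with h4 | h4
      · exact h1 n h4
      · rw [mul_assoc, ← bdPath_succ] at h4
        exact h1 _ h4
    have h3 : ∀ n, p * Y.bdPath f n ∈ Y.startIn y A ↔ p ∈ Y.startIn y A := by
      intro n
      induction n with
      | zero => simp
      | succ n ih => rw [← h2, ih]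
      | pred n ih => rw [h2, sub_add_cancel, ih]
    apply h
    simp only [h3, eventually_const]
  obtain ⟨k, hk⟩ := h1
  refine ⟨k, eq_inv_of_mul_eq_one_left hk, ?_⟩
  have h2 := mul_mem_pathClass hp (bdPath_mem f k)
  rw [hk] at h2
  exact pathClass_end_unique h2 (one_mem_pathClass y)

theorem RWalk.exists_extension (hY : ∀ v, 2 ≤ Y.valence v) {y : Y.V} {l : List Y.Dart}
    (h : Y.RWalk y l) (h0 : l ≠ []) : ∃ d, Y.RWalk y (l ++ [d]) := by
  obtain ⟨-, v, hv⟩ := id h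
  obtain ⟨d, h1, h2⟩ := exists_ne_of_two_le_encard (hY v) (Y.flip (l.getLast h0))
  refine ⟨d, (rwalk_concat h hv).2 ⟨h1, fun a ha => ?_⟩⟩
  rw [List.getLast?_eq_getLast_of_ne_nil h0, Option.some.injEq] at ha
  rwa [← ha]

theorem RWalk.infinite_beyond (hY : ∀ v, 2 ≤ Y.valence v) {y : Y.V} {l : List Y.Dart}
    (h : Y.RWalk y l) (h0 : l ≠ []) : {r | Y.RWalk y r ∧ l <+: r}.Infinite := by
  intro hf
  obtain ⟨N, hN⟩ := (hf.image List.length).bddAbove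
  have : ∀ n, ∃ r, Y.RWalk y r ∧ l <+: r ∧ n ≤ r.length := by
    intro n
    induction n with
    | zero => exact ⟨l, h, List.prefix_rfl, Nat.zero_le _⟩
    | succ n ih =>
      obtain ⟨r, h1, h2, h3⟩ := ih
      have h4 : r ≠ [] := by
        rintro rfl
        exact h0 (List.prefix_nil.1 h2)
      obtain ⟨d, hd⟩ := h1.exists_extension hY h4
      exact ⟨_, hd, h2.trans (List.prefix_append _ _), by simpa using h3⟩
  obtain ⟨r, h1, h2, h3⟩ := this (N + 1)
  have := hN ⟨r, ⟨h1, h2⟩, rfl⟩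
  omega

theorem infinite_startIn (hY : ∀ v, 2 ≤ Y.valence v) {y : Y.V} {A : Set Y.Dart} {d : Y.Dart}
    (hd : Y.init d = y) (hA : d ∈ A) :
    {g | (∃ v, g ∈ Y.pathClass y v) ∧ g ∈ Y.startIn y A}.Infinite := by
  have h1 : Y.RWalk y ([] ++ [d]) := by
    rw [rwalk_concat (rwalk_nil y) rfl]
    simp [hd]
  refine ((h1.infinite_beyond hY (by simp)).image
    ((mk_injOn_rwalk y).mono fun r hr => hr.1)).mono ?_
  rintro _ ⟨_, ⟨h2, ⟨m, rfl⟩⟩, rfl⟩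
  exact ⟨h2.mem, (mem_startIn_cons h2).2 hA⟩

theorem infinite_compl_startIn (hY : ∀ v, 2 ≤ Y.valence v) {y : Y.V} {A : Set Y.Dart} {d : Y.Dart}
    (hd : Y.init d = y) (hA : d ∉ A) :
    {g | (∃ v, g ∈ Y.pathClass y v) ∧ g ∈ (Y.startIn y A)ᶜ}.Infinite := by
  refine (infinite_startIn hY hd (A := {d}) rfl).mono ?_
  rintro g ⟨h1, d', rfl, l, h3, rfl⟩
  exact ⟨h1, fun h4 => hA ((mem_startIn_cons h3).1 h4)⟩

/-- The set `startIn y A` is the union of the half-trees at the root beyond the edges in `A`. A line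
that misses the root is not split by it, and a line through the root is split if it passes from an
edge in `A` to an edge outside `A`; `h` says that there is at most one such line. -/
theorem hasWeakSplitting_of_startIn [Finite Y.V] (hY : ∀ v, 2 ≤ Y.valence v) (y : Y.V)
    (A : Set Y.Dart) {d d' : Y.Dart} (hd : Y.init d = y) (hA : d ∈ A) (hd' : Y.init d' = y)
    (hA' : d' ∉ A)
    (h : ∀ f k f' k', Y.init (Y.bd f k) = y → Y.init (Y.bd f' k') = y →
      ¬ (Y.bd f k ∈ A ↔ Y.flip (Y.bd f (k - 1)) ∈ A) →
      ¬ (Y.bd f' k' ∈ A ↔ Y.flip (Y.bd f' (k' - 1)) ∈ A) →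
      f = f' ∧ k ≡ k' [ZMOD Y.len f]) : Y.HasWeakSplitting := by
  have ha := Assoc.of_treeInv (treeInv_startIn y A)
  refine ⟨y, _, ha.almostInv, ?_, ?_, ?_⟩
  · rw [Set.Infinite, ha.finite_iff]
    exact infinite_startIn hY hd hA
  · rw [Set.Infinite, ha.compl.finite_iff]
    exact infinite_compl_startIn hY hd' hA'
  · intro a b
    induction a using Quotient.inductionOn with | _ a
    induction b using Quotient.inductionOn with | _ b
    intro h1 h2
    rw [ha.isSplitBy_iff, inv_one, one_mul] at h1 h2
    obtain ⟨f, p, hp⟩ := a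
    obtain ⟨f', p', hp'⟩ := b
    obtain ⟨k, h3, h4⟩ := h1.through_root hp
    obtain ⟨k', h5, h6⟩ := h2.through_root hp'
    dsimp only at h1 h2 h3 h5
    subst h3 h5
    rw [lineSplit_startIn A h4] at h1
    rw [lineSplit_startIn A h6] at h2
    obtain ⟨rfl, h7⟩ := h f k f' k' h4 h6 h1 h2
    obtain ⟨j, hj⟩ := h7.dvd
    refine line_eq_iff.2 ⟨rfl, -j, ?_⟩
    have : k' = j * Y.len f + k := by rw [mul_comm]; omega
    simp only [this, bdPath_mul_len_add]
    group

theorem zmod_eq_of_fin_eq {f : Y.F} {k k' : ℤ}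
    (h : (k % Y.len f).toNat = (k' % Y.len f).toNat) : k ≡ k' [ZMOD Y.len f] := by
  have hl : (0 : ℤ) < Y.len f := by exact_mod_cast Y.len_pos f
  have h1 := Int.emod_nonneg k hl.ne'
  have h2 := Int.emod_nonneg k' hl.ne'
  unfold Int.ModEq
  omega

/-- The position in the boundary of `f` given by an integer modulo the length. -/
def bdPos (f : Y.F) (k : ℤ) : Fin (Y.len f) :=
  ⟨(k % Y.len f).toNat, by
    have hl : (0 : ℤ) < Y.len f := by exact_mod_cast Y.len_pos f
    have h1 := Int.emod_nonneg k hl.ne'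
    have h2 := Int.emod_lt_of_pos k hl
    omega⟩

theorem bdPos_cast (f : Y.F) (k : ℤ) : ((bdPos f k : ℕ) : ℤ) ≡ k [ZMOD Y.len f] := by
  have hl : (0 : ℤ) < Y.len f := by exact_mod_cast Y.len_pos f
  have h1 := Int.emod_nonneg k hl.ne'
  change (((k % Y.len f).toNat : ℕ) : ℤ) ≡ k [ZMOD Y.len f]
  rw [Int.toNat_of_nonneg h1]
  exact Int.mod_modEq _ _

theorem bd_bdPos (f : Y.F) (k : ℤ) : Y.bd f (bdPos f k : ℕ) = Y.bd f k :=
  bd_congr f (bdPos_cast f k)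

/-- A finite complex with valences at least `2` that has a disconnected link or an edge that is
traversed exactly once has a non-trivial almost invariant set that splits at most one line. -/
theorem IsVisiblyReducible.hasWeakSplitting [Finite Y.V] (hY : ∀ v, 2 ≤ Y.valence v)
    (h : Y.IsVisiblyReducible) : Y.HasWeakSplitting := by
  rcases h with ⟨v, hv⟩ | ⟨v, hv⟩ | ⟨d, hd⟩
  · exact absurd ((hY v).trans hv) (by norm_num)
  · unfold LinkConnected at hv
    push Not at hv
    obtain ⟨d, d', h1, h2, h3⟩ := hv
    refine hasWeakSplitting_of_startIn hY v {x | Relation.EqvGen Y.LinkAdj d x} h1 (.refl d) h2 h3 ?_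
    intro f k _ _ _ _ h4 _
    have h5 : Y.LinkAdj (Y.flip (Y.bd f (k - 1))) (Y.bd f k) := ⟨f, k, rfl, rfl⟩
    exact absurd ⟨fun h => .trans _ _ _ h (.symm _ _ (.rel _ _ h5)),
      fun h => .trans _ _ _ h (.rel _ _ h5)⟩ h4
  · obtain ⟨d', h1, h2⟩ := exists_ne_of_two_le_encard (hY (Y.init d)) d
    refine hasWeakSplitting_of_startIn hY (Y.init d) {d} rfl rfl h1 h2 ?_
    -- a line that is split traverses the edge, either forwards or backwards
    have key : ∀ f k, ¬ (Y.bd f k ∈ ({d} : Set Y.Dart) ↔ Y.flip (Y.bd f (k - 1)) ∈ ({d} : Set Y.Dart)) →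
        Y.bd f k = d ∨ Y.bd f (k - 1) = Y.flip d := by
      intro f k h
      by_contra h3
      push Not at h3
      refine h (iff_of_false h3.1 fun h4 => h3.2 ?_)
      rw [← CombGraph.flip_eq_iff]
      exact h4
    intro f k f' k' _ _ h3 h4
    obtain ⟨⟨f₀, j₀⟩, h5⟩ := Set.encard_eq_one.1 hd
    have h6 : ∀ f k, (Y.bd f k = d ∨ Y.bd f k = Y.flip d) → (⟨f, bdPos f k⟩ : Σ f : Y.F, Fin (Y.len f)) =
        ⟨f₀, j₀⟩ := by
      intro f k h
      have : (⟨f, bdPos f k⟩ : Σ f : Y.F, Fin (Y.len f)) ∈ Y.hits d := by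
        change Y.bd f (bdPos f k : ℕ) = d ∨ Y.bd f (bdPos f k : ℕ) = Y.flip d
        rwa [bd_bdPos]
      rw [h5] at this
      exact this
    have h7 : ∀ f k f' k', (Y.bd f k = d ∨ Y.bd f k = Y.flip d) →
        (Y.bd f' k' = d ∨ Y.bd f' k' = Y.flip d) → f = f' ∧ k ≡ k' [ZMOD Y.len f] := by
      intro f k f' k' h h'
      have h8 := (h6 f k h).trans (h6 f' k' h').symm
      obtain rfl : f = f' := congrArg Sigma.fst h8
      have h9 := eq_of_heq (Sigma.mk.inj h8).2
      exact ⟨rfl, zmod_eq_of_fin_eq (congrArg Fin.val h9)⟩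
    have hd : d ≠ Y.flip d := (CombGraph.flip_ne d).symm
    rcases key f k h3 with h8 | h8 <;> rcases key f' k' h4 with h9 | h9
    · exact h7 _ _ _ _ (Or.inl h8) (Or.inl h9)
    · obtain ⟨rfl, h10⟩ := h7 f k f' (k' - 1) (Or.inl h8) (Or.inr h9)
      exact absurd (h8.symm.trans ((bd_congr f h10).trans h9)) hd
    · obtain ⟨rfl, h10⟩ := h7 f (k - 1) f' k' (Or.inr h8) (Or.inl h9)
      exact absurd (h9.symm.trans ((bd_congr f h10).symm.trans h8)) hd
    · obtain ⟨rfl, h10⟩ := h7 _ _ _ _ (Or.inr h8) (Or.inr h9)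
      refine ⟨rfl, ?_⟩
      have := h10.add_right 1
      rwa [sub_add_cancel, sub_add_cancel] at this

/-- If an edge of a tight finite complex is traversed at least three times, then a half-tree bounded
by a lift of this edge is an indecomposable almost invariant set that splits three lines. -/
theorem IsTight.hasTripodAt [Finite Y.V] [Finite Y.E] (hY : Y.IsTight) {d : Y.Dart}
    (hd : 2 < (Y.hits d).encard) : Y.HasTripodAt := by
  have ha := Assoc.of_treeInv (treeInv_startIn (Y.init d) {d})
  refine ⟨Y.init d, _, ha.almostInv, ?_, ?_⟩
  · -- each traversal of the edge defines a line through the root that is split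
    have key : ∀ x ∈ Y.hits d, ∃ k : ℤ, Y.init (Y.bd x.1 k) = Y.init d ∧
        ((k = (x.2 : ℕ) ∧ Y.bd x.1 k = d ∧ Y.flip (Y.bd x.1 (k - 1)) ≠ d) ∨
          (k = (x.2 : ℕ) + 1 ∧ Y.bd x.1 k ≠ d ∧ Y.flip (Y.bd x.1 (k - 1)) = d)) := by
      rintro ⟨f, j⟩ h
      rcases h with h | h
      · have h : Y.bd f (j : ℕ) = d := h
        refine ⟨(j : ℕ), by rw [h], Or.inl ⟨rfl, h, ?_⟩⟩
        change Y.flip (Y.bd f _) ≠ d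
        rw [← h]
        exact (bd_ne_flip f _).symm
      · have h : Y.bd f (j : ℕ) = Y.flip d := h
        have h1 : Y.flip (Y.bd f ((j : ℕ) + 1 - 1)) = d := by
          rw [add_sub_cancel_right, h, CombGraph.flip_flip]
        refine ⟨(j : ℕ) + 1, ?_, Or.inr ⟨rfl, ?_, h1⟩⟩
        · change Y.init (Y.bd f _) = _
          rw [← bd_path, h, term_flip]
        · change Y.bd f _ ≠ d
          rw [← h1]
          exact bd_ne_flip f _
    choose! k hk1 hk2 using key
    have hmem : ∀ x ∈ Y.hits d, (Y.bdPath x.1 (k x))⁻¹ ∈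
        Y.pathClass (Y.init d) (Y.init (Y.bd x.1 0)) := by
      intro x hx
      rw [← hk1 x hx]
      exact inv_mem_pathClass (bdPath_mem _ _)
    have hsplit : ∀ x (hx : x ∈ Y.hits d), IsSplitBy (Y.lineStab (Y.init d)
        (Quotient.mk _ ⟨x.1, _, hmem x hx⟩)) (Subtype.val ⁻¹' Y.startIn (Y.init d) {d}) := by
      intro x hx
      rw [ha.isSplitBy_iff, inv_one, one_mul, lineSplit_startIn _ (hk1 x hx)]
      simp only [Set.mem_singleton_iff]
      rcases hk2 x hx with ⟨-, h1, h2⟩ | ⟨-, h1, h2⟩ <;> simp [h1, h2]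
    have hinj : ∀ x (hx : x ∈ Y.hits d) y (hy : y ∈ Y.hits d), x ≠ y →
        (Quotient.mk _ ⟨x.1, _, hmem x hx⟩ : Y.Line (Y.init d)) ≠
          Quotient.mk _ ⟨y.1, _, hmem y hy⟩ := by
      intro x hx y hy hne h
      apply hne
      obtain ⟨h1, n, h2⟩ := line_eq_iff.1 h
      obtain ⟨f, j⟩ := x
      obtain ⟨f', j'⟩ := y
      obtain rfl : f = f' := h1
      have h2 : (Y.bdPath f (k ⟨f, j'⟩))⁻¹ = (Y.bdPath f (k ⟨f, j⟩))⁻¹ * Y.bdLoop f ^ n := h2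
      have h3 : Y.bdPath f (k ⟨f, j'⟩) = Y.bdPath f (-n * Y.len f + k ⟨f, j⟩) := by
        rw [bdPath_mul_len_add, ← inv_inj, h2]
        group
      have h4 := bdPath_injective f h3
      have h5 : k ⟨f, j'⟩ ≡ k ⟨f, j⟩ [ZMOD Y.len f] := by
        rw [h4]
        exact (Int.modEq_iff_dvd).2 ⟨n, by ring⟩
      have fin : ∀ j j' : Fin (Y.len f), ((j : ℕ) : ℤ) ≡ (j' : ℕ) [ZMOD Y.len f] → j = j' := by
        intro j j' h
        have := Int.natCast_modEq_iff.1 h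
        exact Fin.ext (Nat.ModEq.eq_of_lt_of_lt this j.2 j'.2)
      congr 1
      rcases hk2 _ hx with ⟨h6, h7, h8⟩ | ⟨h6, h7, h8⟩ <;>
        rcases hk2 _ hy with ⟨h9, h10, h11⟩ | ⟨h9, h10, h11⟩
      · rw [h6, h9] at h5
        exact (fin _ _ h5).symm
      · exact absurd ((bd_congr f h5).trans h7) h10
      · exact absurd ((bd_congr f h5).symm.trans h10) h7
      · rw [h6, h9] at h5
        exact (fin _ _ (Int.ModEq.add_right_cancel' 1 h5)).symm
    obtain ⟨t, ht, ht3⟩ := Set.exists_subset_encard_eq (show (3 : ℕ∞) ≤ (Y.hits d).encard from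
      Order.add_one_le_of_lt hd)
    obtain ⟨x, y, z, hxy, hxz, hyz, rfl⟩ := Set.encard_eq_three.1 ht3
    have hx : x ∈ Y.hits d := ht (by simp)
    have hy : y ∈ Y.hits d := ht (by simp)
    have hz : z ∈ Y.hits d := ht (by simp)
    exact ⟨_, _, _, hinj x hx y hy hxy, hinj x hx z hz hxz, hinj y hy z hz hyz,
      hsplit x hx, hsplit y hy, hsplit z hz⟩
  · -- the half-tree is indecomposable: no link has a cut vertex, so a set that splits no line inside
    -- the half-tree is constant on it up to a finite set
    intro S₁ hS₁ hs
    obtain ⟨c, hc⟩ := Assoc.exists_of_almostInv hS₁ (one_mem_pathClass (Y.init d))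
    have h1 : Y.RWalk (Y.init d) ([] ++ [d]) := by
      rw [rwalk_concat (rwalk_nil _) rfl]
      simp
    have h2 := hc.treeInv.evConst hY.noCut (fun l => [d] <+: l)
      (fun l _ h => h.trans (List.prefix_append _ _)) ?_ [d] h1 (by simp) List.prefix_rfl
    · rcases h2 with h2 | h2
      · right
        refine (ha.inter hc.compl).finite_iff.2 ((h2.image FreeGroup.mk).subset ?_)
        rintro g ⟨-, ⟨b, hb, l, h3, rfl⟩, h4⟩
        obtain rfl : b = d := hb
        exact ⟨_, ⟨h3, ⟨l, rfl⟩, h4⟩, rfl⟩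
      · left
        refine (hc.inter ha).finite_iff.2 ((h2.image FreeGroup.mk).subset ?_)
        rintro g ⟨-, h4, ⟨b, hb, l, h3, rfl⟩⟩
        obtain rfl : b = d := hb
        exact ⟨_, ⟨h3, ⟨l, rfl⟩, fun h5 => h5 h4⟩, rfl⟩
    · -- a line that turns a corner inside the half-tree has both of its ends in the half-tree
      intro l h0 hl f i h3 h4 h5
      have hp : FreeGroup.mk l * (Y.bdPath f i)⁻¹ ∈
          Y.pathClass (Y.init d) (Y.init (Y.bd f 0)) := by
        obtain ⟨-, v, h⟩ := h4
        exact mul_mem_pathClass (IsWalk.concat_iff.1 h).1.mem (inv_mem_pathClass (bdPath_mem f i))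
      have hin : ∀ b, Y.RWalk (Y.init d) (l ++ [b]) →
          Y.AllIn (Y.init d) (Y.startIn (Y.init d) {d}) (l ++ [b]) := by
        intro b hb
        refine Set.finite_empty.subset ?_
        rintro r ⟨h6, h7, h8⟩
        obtain ⟨m, rfl⟩ := hl.trans ((List.prefix_append l [b]).trans h7)
        exact h8 ((mem_startIn_cons h6).2 rfl)
      refine hs (Quotient.mk _ ⟨f, _, hp⟩) ?_ ?_
      · rw [Set.sdiff_eq]
        refine (ha.compl.finite_line_iff _).2 ?_
        simp only [inv_one, one_mul, Set.mem_compl_iff, not_not]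
        exact ⟨(hin _ h4).forward h4, (hin _ h3).backward h3⟩
      · rw [hc.isSplitBy_iff]
        simpa using h5

end BranchedComplex

namespace BranchedComplex

open CombGraph Filter

variable {X Y Z : BranchedComplex}

/-! ### Surfaces are tight -/

/-- The ends of the corners of faces, that is, the half-edges of the links of all vertices: the
element `(⟨f, j⟩, true)` is the end of the corner `j` of `f` at the oriented edge `bd f j`, and
`(⟨f, j⟩, false)` is the end of the corner `j + 1` at the reverse of this edge. -/
abbrev CornerEnd (Y : BranchedComplex) : Type := (Σ f : Y.F, Fin (Y.len f)) × Bool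

/-- The oriented edge at which a corner ends. -/
def CornerEnd.dart (h : Y.CornerEnd) : Y.Dart :=
  if h.2 then Y.bd h.1.1 (h.1.2 : ℕ) else Y.flip (Y.bd h.1.1 (h.1.2 : ℕ))

/-- The other end of the same corner. -/
def CornerEnd.swap (h : Y.CornerEnd) : Y.CornerEnd :=
  if h.2 then (⟨h.1.1, bdPos h.1.1 ((h.1.2 : ℕ) - 1)⟩, false)
  else (⟨h.1.1, bdPos h.1.1 ((h.1.2 : ℕ) + 1)⟩, true)

theorem fin_eq_of_modEq {n : ℕ} {j j' : Fin n} (h : ((j : ℕ) : ℤ) ≡ (j' : ℕ) [ZMOD n]) :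
    j = j' :=
  Fin.ext (Nat.ModEq.eq_of_lt_of_lt (Int.natCast_modEq_iff.1 h) j.2 j'.2)

theorem CornerEnd.swap_swap (h : Y.CornerEnd) : h.swap.swap = h := by
  obtain ⟨⟨f, j⟩, s⟩ := h
  cases s
  · simp only [swap, Bool.false_eq_true, if_false, if_true, Prod.mk.injEq, and_true]
    congr 1
    refine fin_eq_of_modEq ((bdPos_cast f _).trans ?_)
    simpa using (bdPos_cast f ((j : ℕ) + 1)).sub_right 1
  · simp only [swap, Bool.false_eq_true, if_false, if_true, Prod.mk.injEq, and_true]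
    congr 1
    refine fin_eq_of_modEq ((bdPos_cast f _).trans ?_)
    simpa using (bdPos_cast f ((j : ℕ) - 1)).add_right 1

theorem CornerEnd.swap_ne (h : Y.CornerEnd) : h.swap ≠ h := by
  obtain ⟨x, s⟩ := h
  intro h1
  have := congrArg Prod.snd h1
  cases s <;> simp [swap] at this

theorem CornerEnd.linkAdj_swap (h : Y.CornerEnd) :
    Y.LinkAdj h.swap.dart h.dart ∨ Y.LinkAdj h.dart h.swap.dart := by
  obtain ⟨⟨f, j⟩, s⟩ := h
  cases s
  · refine Or.inr ⟨f, (j : ℕ) + 1, ?_, ?_⟩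
    · rw [add_sub_cancel_right]
      rfl
    · exact bd_bdPos f _
  · exact Or.inl ⟨f, (j : ℕ), congrArg Y.flip (bd_bdPos f _), rfl⟩

theorem LinkAdj.exists_cornerEnd {d d' : Y.Dart} (h : Y.LinkAdj d d') :
    ∃ h : Y.CornerEnd, h.dart = d' ∧ h.swap.dart = d := by
  obtain ⟨f, i, rfl, rfl⟩ := h
  refine ⟨(⟨f, bdPos f i⟩, true), bd_bdPos f i, ?_⟩
  change Y.flip (Y.bd f (bdPos f ((bdPos f i : ℕ) - 1) : ℕ)) = _
  rw [bd_bdPos]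
  exact congrArg _ (bd_congr f ((bdPos_cast f i).sub_right 1))

theorem encard_cornerEnd (d : Y.Dart) : {h : Y.CornerEnd | h.dart = d}.encard = (Y.hits d).encard := by
  have h1 : Prod.fst '' {h : Y.CornerEnd | h.dart = d} = Y.hits d := by
    ext x
    constructor
    · rintro ⟨⟨x, s⟩, h, rfl⟩
      cases s
      · exact Or.inr (CombGraph.flip_eq_iff.1 h)
      · exact Or.inl h
    · rintro (h | h)
      · exact ⟨(x, true), h, rfl⟩
      · exact ⟨(x, false), CombGraph.flip_eq_iff.2 h, rfl⟩
  rw [← h1, Set.InjOn.encard_image]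
  rintro ⟨x, s⟩ h ⟨x', s'⟩ h' rfl
  have h : CornerEnd.dart (x, s) = d := h
  have h' : CornerEnd.dart (x, s') = d := h'
  cases s <;> cases s'
  · rfl
  · exact absurd (h.trans h'.symm) (CombGraph.flip_ne _)
  · exact absurd (h'.trans h.symm) (CombGraph.flip_ne _)
  · rfl

theorem CornerEnd.dart_swap_ne (h : Y.CornerEnd) : h.swap.dart ≠ h.dart := by
  have key : ∀ d d' : Y.Dart, Y.LinkAdj d d' → d' ≠ d := by
    rintro _ _ ⟨f, i, rfl, rfl⟩
    exact bd_ne_flip f i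
  rcases h.linkAdj_swap with h1 | h1
  · exact (key _ _ h1).symm
  · exact key _ _ h1

theorem CornerEnd.init_swap (h : Y.CornerEnd) : Y.init h.swap.dart = Y.init h.dart := by
  rcases h.linkAdj_swap with h1 | h1
  · exact h1.init_eq
  · exact h1.init_eq.symm

theorem even_card_of_involution {α : Type} (s : Finset α) (τ : α → α) (h1 : ∀ a ∈ s, τ a ∈ s)
    (h2 : ∀ a ∈ s, τ (τ a) = a) (h3 : ∀ a ∈ s, τ a ≠ a) : Even s.card := by
  have : ∑ _ ∈ s, (1 : ZMod 2) = 0 := Finset.sum_involution (fun a _ => τ a)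
    (fun _ _ => by decide) (fun a ha _ => h3 a ha) h1 h2
  rw [Finset.sum_const, nsmul_one] at this
  exact (ZMod.natCast_eq_zero_iff_even).1 this

/-- In a finite surface, no link has a cut vertex: a circle minus a vertex is connected. A component
of the rest would contain exactly one of the two neighbouring corner ends, but it contains an
even number of corner ends in total. -/
theorem IsSurface.noCutVertex [Finite Y.E] [Finite Y.F] (hY : Y.IsSurface) : Y.NoCutVertex := by
  classical
  have hits2 : ∀ d, (Y.hits d).encard = 2 := fun d => (hY (Y.init d)).2.2 d rfl
  intro d₀ d d' hd hd' hne hne'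
  by_contra hcon
  set r : Y.Dart → Y.Dart → Prop := fun a b => Y.LinkAdj a b ∧ a ≠ d₀ ∧ b ≠ d₀ with hr
  -- `d₀` has a neighbour in every set that is closed under adjacency away from `d₀`
  have nbr : ∀ P : Y.Dart → Prop, (∀ a b, r a b → (P a ↔ P b)) →
      ∀ x x', Y.init x = Y.init d₀ → Y.init x' = Y.init d₀ → x ≠ d₀ → x' ≠ d₀ → P x → ¬ P x' →
      ∃ h : Y.CornerEnd, h.dart = d₀ ∧ P h.swap.dart := by
    intro P hP x x' hx hx' hxne hxne' hPx hPx'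
    by_contra hno
    push Not at hno
    have hL := iff_of_eqvGen (P := fun a => P a ∧ a ≠ d₀) ?_ ((hY (Y.init d₀)).2.1 x x' hx hx')
    · exact hPx' (hL.1 ⟨hPx, hxne⟩).1
    · intro a b hab
      by_cases ha : a = d₀
      · obtain ⟨h, h1, h2⟩ := hab.exists_cornerEnd
        refine iff_of_false (fun h3 => h3.2 ha) fun h3 => ?_
        refine hno h.swap (h2.trans ha) ?_
        rw [CornerEnd.swap_swap, h1]
        exact h3.1
      · by_cases hb : b = d₀
        · obtain ⟨h, h1, h2⟩ := hab.exists_cornerEnd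
          refine iff_of_false (fun h3 => hno h (h1.trans hb) ?_) fun h3 => h3.2 hb
          rw [h2]
          exact h3.1
        · rw [hP a b ⟨hab, ha, hb⟩]
          simp [ha, hb]
  have hclosed : ∀ a b, r a b → (Relation.EqvGen r d a ↔ Relation.EqvGen r d b) := fun a b hab =>
    ⟨fun h => .trans _ _ _ h (.rel _ _ hab), fun h => .trans _ _ _ h (.symm _ _ (.rel _ _ hab))⟩
  obtain ⟨h₁, h₁d, h₁L⟩ := nbr (fun a => Relation.EqvGen r d a) hclosed d d' hd hd' hne hne'
    (.refl d) hcon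
  obtain ⟨h₂, h₂d, h₂L⟩ := nbr (fun a => ¬ Relation.EqvGen r d a)
    (fun a b hab => not_congr (hclosed a b hab)) d' d hd' hd hne' hne hcon (not_not.2 (.refl d))
  have h12 : h₁ ≠ h₂ := by
    rintro rfl
    exact h₂L h₁L
  have hfin : Finite Y.CornerEnd := inferInstance
  have := Fintype.ofFinite Y.CornerEnd
  have := Fintype.ofFinite Y.Dart
  have hD₀ : ∀ h : Y.CornerEnd, h.dart = d₀ → h = h₁ ∨ h = h₂ := by
    intro h hh
    have h2 : {h : Y.CornerEnd | h.dart = d₀}.encard = 2 := (encard_cornerEnd d₀).trans (hits2 d₀)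
    obtain ⟨a, b, hab, hset⟩ := Set.encard_eq_two.1 h2
    have ha : h₁ ∈ ({a, b} : Set Y.CornerEnd) := hset ▸ h₁d
    have hb : h₂ ∈ ({a, b} : Set Y.CornerEnd) := hset ▸ h₂d
    have hc : h ∈ ({a, b} : Set Y.CornerEnd) := hset ▸ hh
    simp only [Set.mem_insert_iff, Set.mem_singleton_iff] at ha hb hc
    rcases ha with rfl | rfl <;> rcases hb with rfl | rfl <;> tauto
  -- the corner ends in the component of `d`, and those among them that do not lead to `d₀`
  set L : Finset Y.Dart := Finset.univ.filter fun a => a ≠ d₀ ∧ Relation.EqvGen r d a with hL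
  set H : Finset Y.CornerEnd := Finset.univ.filter fun h => h.dart ∈ L with hH
  have hHcard : Even H.card := by
    have : H.card = ∑ a ∈ L, 2 := by
      have h0 := Finset.card_eq_sum_card_fiberwise (s := H) (f := CornerEnd.dart) (t := L)
        (fun h hh => (Finset.mem_filter.1 hh).2)
      rw [h0]
      refine Finset.sum_congr rfl fun a ha => ?_
      have h1 := (encard_cornerEnd a).trans (hits2 a)
      have h2 : {h : Y.CornerEnd | h.dart = a} = ((H.filter fun h => h.dart = a : Finset _) : Set _) := by
        ext h
        simp only [Set.mem_ofPred_eq, Finset.coe_filter, hH, Finset.mem_filter, Finset.mem_univ,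
          true_and]
        exact ⟨fun h => ⟨h ▸ ha, h⟩, fun h => h.2⟩
      rw [h2, Set.encard_coe_eq_coe_finsetCard] at h1
      exact_mod_cast h1
    rw [this, Finset.sum_const, smul_eq_mul]
    exact even_two.mul_left _
  have hmem : h₁.swap ∈ H := by
    rw [hH, Finset.mem_filter, hL, Finset.mem_filter]
    exact ⟨Finset.mem_univ _, Finset.mem_univ _, h₁d ▸ h₁.dart_swap_ne, h₁L⟩
  have heven : Even (H.erase h₁.swap).card := by
    refine even_card_of_involution _ CornerEnd.swap ?_ (fun h _ => h.swap_swap)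
      fun h _ => h.swap_ne
    intro h hh
    rw [Finset.mem_erase, hH, Finset.mem_filter, hL, Finset.mem_filter] at hh ⊢
    obtain ⟨h1, -, -, h2, h3⟩ := hh
    have hne1 : h.swap.dart ≠ d₀ := by
      intro h4
      rcases hD₀ _ h4 with h5 | h5
      · exact h1 (by rw [← h5, CornerEnd.swap_swap])
      · apply h₂L
        rw [← h5, CornerEnd.swap_swap]
        exact h3
    refine ⟨fun h4 => ?_, Finset.mem_univ _, Finset.mem_univ _, hne1, ?_⟩
    · have h5 := congrArg CornerEnd.swap h4
      rw [CornerEnd.swap_swap, CornerEnd.swap_swap] at h5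
      exact h2 (h5 ▸ h₁d)
    · rcases h.linkAdj_swap with h4 | h4
      · exact (hclosed _ _ ⟨h4, hne1, h2⟩).2 h3
      · exact (hclosed _ _ ⟨h4, h2, hne1⟩).1 h3
  rw [Finset.card_erase_of_mem hmem] at heven
  have hpos : 0 < H.card := Finset.card_pos.2 ⟨_, hmem⟩
  obtain ⟨a, ha⟩ := hHcard
  obtain ⟨b, hb⟩ := heven
  omega

theorem IsSurface.isTight [Finite Y.E] [Finite Y.F] (hY : Y.IsSurface) : Y.IsTight where
  valence v := by
    obtain ⟨⟨d, hd⟩, -, h⟩ := hY v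
    have h1 : {h : Y.CornerEnd | h.dart = d}.encard ≠ 0 := by
      rw [encard_cornerEnd, h d hd]
      norm_num
    obtain ⟨x, hx⟩ := Set.nonempty_of_encard_ne_zero h1
    have hx : x.dart = d := hx
    have h2 : ({x.swap.dart, x.dart} : Set Y.Dart) ⊆ {d : Y.Dart | Y.init d = v} := by
      rintro a (rfl | rfl)
      · exact x.init_swap.trans (hx ▸ hd)
      · exact hx ▸ hd
    have h3 := Set.encard_le_encard h2
    rwa [Set.encard_pair x.dart_swap_ne] at h3
  conn v := (hY v).2.1
  noCut := hY.noCutVertex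
  hits d := ((hY (Y.init d)).2.2 d rfl).ge

end BranchedComplex

namespace BranchedComplex

open CombGraph Filter

variable {X Y Z : BranchedComplex}

/-! ### Surfaces have no tripods -/

/-- A connected multigraph, with vertex set `B` and edges `k` joining `e k true` to `e k false`, has
at most two half-edges leaving it if the number of ends of edges at `B` is at most twice the number
of vertices. -/
theorem false_of_three_leaving {L K : Type} [Finite K] {B : Set L} (hB : B.Finite)
    (e : K → Bool → L) (hcard : Nat.card {x : K × Bool // e x.1 x.2 ∈ B} ≤ 2 * Nat.card B)
    (hconn : ∀ B₁ ⊆ B, B₁.Nonempty → (∀ k, e k true ∈ B → e k false ∈ B →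
      (e k true ∈ B₁ ↔ e k false ∈ B₁)) → B ⊆ B₁)
    {k₁ k₂ k₃ : K} (h12 : k₁ ≠ k₂) (h13 : k₁ ≠ k₃) (h23 : k₂ ≠ k₃)
    (h1 : ¬ (e k₁ true ∈ B ↔ e k₁ false ∈ B)) (h2 : ¬ (e k₂ true ∈ B ↔ e k₂ false ∈ B))
    (h3 : ¬ (e k₃ true ∈ B ↔ e k₃ false ∈ B)) : False := by
  classical
  have := hB.to_subtype
  let G : SimpleGraph B :=
    { Adj := fun l l' => l ≠ l' ∧ ∃ k s, e k s = l ∧ e k (!s) = l'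
      symm := ⟨fun l l' h => ⟨h.1.symm, by
        obtain ⟨k, s, h1, h2⟩ := h.2
        exact ⟨k, !s, h2, by rwa [Bool.not_not]⟩⟩⟩
      loopless := ⟨fun l h => h.1 rfl⟩ }
  have hne : Nonempty B := by
    by_cases h : e k₁ true ∈ B
    · exact ⟨_, h⟩
    · by_cases h' : e k₁ false ∈ B
      · exact ⟨_, h'⟩
      · exact absurd (iff_of_false h h') h1
  have hG : G.Connected := by
    refine SimpleGraph.Connected.mk (fun l₀ l => ?_)
    have := hconn {l | ∃ h : l ∈ B, G.Reachable l₀ ⟨l, h⟩} (fun l h => h.1) ⟨l₀.1, l₀.2, .refl _⟩ ?_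
      l.2
    · exact this.2
    · intro k ht hf
      have key : ∀ s (hs : e k s ∈ B) (hs' : e k (!s) ∈ B), G.Reachable ⟨e k s, hs⟩ ⟨e k (!s), hs'⟩ := by
        intro s hs hs'
        by_cases heq : e k s = e k (!s)
        · have : (⟨e k s, hs⟩ : B) = ⟨e k (!s), hs'⟩ := Subtype.ext heq
          rw [this]
        · exact SimpleGraph.Adj.reachable ⟨fun h => heq (congrArg Subtype.val h), k, s, rfl, rfl⟩
      constructor
      · rintro ⟨_, h⟩
        exact ⟨hf, h.trans (key true ht hf)⟩
      · rintro ⟨_, h⟩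
        exact ⟨ht, h.trans (key false hf ht)⟩
  have hcard' := hG.card_vert_le_card_edgeSet_add_one
  -- every edge of the simple graph comes from some `k`
  have hedge : ∀ x : G.edgeSet, ∃ k, ∃ (h : e k true ∈ B) (h' : e k false ∈ B),
      s((⟨e k true, h⟩ : B), ⟨e k false, h'⟩) = x.1 := by
    rintro ⟨x, hx⟩
    induction x using Sym2.ind with | _ l l'
    obtain ⟨-, k, s, hk1, hk2⟩ := hx
    cases s
    · refine ⟨k, by rw [show e k true = l' from hk2]; exact l'.2, hk1 ▸ l.2, ?_⟩
      rw [Sym2.eq_swap]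
      exact congrArg₂ (fun a b => s(a, b)) (Subtype.ext hk1) (Subtype.ext hk2)
    · refine ⟨k, hk1 ▸ l.2, by rw [show e k false = l' from hk2]; exact l'.2, ?_⟩
      exact congrArg₂ (fun a b => s(a, b)) (Subtype.ext hk1) (Subtype.ext hk2)
  choose κ hκt hκf hκ using hedge
  have hκinj : Function.Injective κ := by
    intro x y hxy
    apply Subtype.ext
    rw [← hκ x, ← hκ y]
    simp only [hxy]
  -- the three leaving edges have an end in `B`
  have hleave : ∀ k, ¬ (e k true ∈ B ↔ e k false ∈ B) → ∃ s, e k s ∈ B ∧ e k (!s) ∉ B := by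
    intro k h
    by_cases h' : e k true ∈ B
    · exact ⟨true, h', fun h'' => h (iff_of_true h' h'')⟩
    · refine ⟨false, ?_, h'⟩
      by_contra h''
      exact h (iff_of_false h' h'')
  obtain ⟨s₁, hs₁, hs₁'⟩ := hleave k₁ h1
  obtain ⟨s₂, hs₂, hs₂'⟩ := hleave k₂ h2
  obtain ⟨s₃, hs₃, hs₃'⟩ := hleave k₃ h3
  let T : Finset (K × Bool) := {(k₁, s₁), (k₂, s₂), (k₃, s₃)}
  have hT : T.card = 3 := by
    refine Finset.card_eq_three.2 ⟨_, _, _, ?_, ?_, ?_, rfl⟩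
    · exact fun h => h12 (congrArg Prod.fst h)
    · exact fun h => h13 (congrArg Prod.fst h)
    · exact fun h => h23 (congrArg Prod.fst h)
  have hTB : ∀ x ∈ T, e x.1 x.2 ∈ B ∧ e x.1 (!x.2) ∉ B := by
    intro x hx
    simp only [T, Finset.mem_insert, Finset.mem_singleton] at hx
    rcases hx with rfl | rfl | rfl
    exacts [⟨hs₁, hs₁'⟩, ⟨hs₂, hs₂'⟩, ⟨hs₃, hs₃'⟩]
  let F : G.edgeSet × Bool ⊕ T → {x : K × Bool // e x.1 x.2 ∈ B} := Sum.elim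
    (fun x => ⟨(κ x.1, x.2), by
      rcases x with ⟨x, s⟩
      cases s
      exacts [hκf x, hκt x]⟩)
    (fun x => ⟨x.1, (hTB x.1 x.2).1⟩)
  have hF : Function.Injective F := by
    have hLR : ∀ x t, F (Sum.inl x) ≠ F (Sum.inr t) := by
      rintro ⟨x, s⟩ ⟨t, ht⟩ h
      have h' : (κ x, s) = t := congrArg Subtype.val h
      subst h'
      apply (hTB _ ht).2
      cases s
      exacts [hκt x, hκf x]
    rintro (⟨x, s⟩ | t) (⟨x', s'⟩ | t') h
    · have h' : (κ x, s) = (κ x', s') := congrArg Subtype.val h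
      rw [Prod.mk.injEq] at h'
      rw [hκinj h'.1, h'.2]
    · exact absurd h (hLR _ _)
    · exact absurd h.symm (hLR _ _)
    · have h' : (F (Sum.inr t)).1 = (F (Sum.inr t')).1 := congrArg Subtype.val h
      exact congrArg Sum.inr (Subtype.ext h')
  have hle := Nat.card_le_card_of_injective F hF
  rw [Nat.card_sum, Nat.card_prod, Nat.card_eq_fintype_card (α := Bool), Fintype.card_bool,
    Nat.card_eq_fintype_card (α := T), Fintype.card_coe, hT] at hle
  omega

/-- From the depth `N` on, membership in `c` is constant beyond every vertex of the universal
cover. -/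
def ConstFrom (Y : BranchedComplex) (y : Y.V) (c : Set (FreeGroup Y.E)) (N : ℕ) : Prop :=
  ∀ l m, Y.RWalk y (l ++ m) → N ≤ l.length → (FreeGroup.mk l ∈ c ↔ FreeGroup.mk (l ++ m) ∈ c)

theorem ConstFrom.treeInv [Finite Y.E] {y : Y.V} {c : Set (FreeGroup Y.E)} {N : ℕ}
    (h : Y.ConstFrom y c N) : Y.TreeInv y c := by
  intro d
  refine ((List.finite_length_le Y.Dart N).image FreeGroup.mk).subset ?_
  rintro g ⟨h1, h2⟩
  obtain ⟨r, h3, h4, rfl⟩ := exists_reduced h1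
  have hr : Y.RWalk y r := ⟨h4, _, h3⟩
  refine ⟨r, ?_, rfl⟩
  change r.length ≤ N
  by_contra h5
  push Not at h5
  apply h2
  by_cases h6 : ∀ a, r.getLast? = some a → d ≠ Y.flip a
  · rw [← mk_concat]
    exact h _ _ ((rwalk_concat hr h3).2 ⟨rfl, h6⟩) h5.le
  · push Not at h6
    obtain ⟨a, h7, rfl⟩ := h6
    obtain ⟨m, rfl⟩ := List.getLast?_eq_some_iff.1 h7
    have h8 : FreeGroup.mk (m ++ [a]) * FreeGroup.mk [Y.flip a] = FreeGroup.mk m := by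
      rw [mk_concat, mk_flip, mul_inv_cancel_right]
    rw [h8]
    rw [List.length_append, List.length_singleton] at h5
    exact (h _ _ hr (by omega)).symm

/-- The vertex `m` of the universal cover is the point closest to the root of a lift of the boundary
of `f`, which passes through `m` at the corner `k`. -/
def IsApex (Y : BranchedComplex) (y : Y.V) (m : List Y.Dart) (f : Y.F) (k : ℤ) : Prop :=
  Y.RWalk y (m ++ [Y.bd f k]) ∧ Y.RWalk y (m ++ [Y.flip (Y.bd f (k - 1))])

theorem IsApex.mem {y : Y.V} {m : List Y.Dart} {f : Y.F} {k : ℤ} (h : Y.IsApex y m f k) :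
    FreeGroup.mk m * (Y.bdPath f k)⁻¹ ∈ Y.pathClass y (Y.init (Y.bd f 0)) := by
  obtain ⟨⟨-, v, h⟩, -⟩ := h
  exact mul_mem_pathClass (IsWalk.concat_iff.1 h).1.mem (inv_mem_pathClass (bdPath_mem f k))

/-- Every line has an apex: the corner at which its distance from the root is minimal. -/
theorem exists_isApex {y : Y.V} (a : Y.Line y) : ∃ (m : List Y.Dart) (f : Y.F) (j : Fin (Y.len f))
    (h : Y.IsApex y m f (j : ℕ)), a = Quotient.mk _ ⟨f, _, h.mem⟩ := by
  induction a using Quotient.inductionOn with | _ a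
  obtain ⟨f, p, hp⟩ := a
  have hL : ∀ n, ∃ l, Y.IsWalk y l (Y.init (Y.bd f n)) ∧ FreeGroup.IsReduced l ∧
      FreeGroup.mk l = p * Y.bdPath f n := fun n =>
    exists_reduced (mul_mem_pathClass hp (bdPath_mem f n))
  choose L hL1 hL2 hL3 using hL
  obtain ⟨k, hk⟩ : ∃ k, ∀ n, (L k).length ≤ (L n).length :=
    ⟨_, fun n => Function.argmin_le (fun n => (L n).length) n⟩
  have hRW : ∀ n, Y.RWalk y (L n) := fun n => ⟨hL2 n, _, hL1 n⟩
  have short : ∀ n m, FreeGroup.mk m = p * Y.bdPath f n → Y.RWalk y m → (L k).length ≤ m.length := by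
    intro n m h1 h2
    have := mk_injOn_rwalk y h2 (hRW n) (h1.trans (hL3 n).symm)
    rw [this]
    exact hk n
  have hap : Y.IsApex y (L k) f k := by
    constructor
    · refine (rwalk_concat (hRW k) (hL1 k)).2 ⟨rfl, fun a ha h => ?_⟩
      obtain ⟨m, hm⟩ := List.getLast?_eq_some_iff.1 ha
      have h1 := short (k + 1) m (by
        rw [bdPath_succ, ← mul_assoc, ← hL3 k, hm, h, mk_concat, mk_flip, mul_inv_cancel_right])
        (by have := hRW k; rw [hm] at this; exact this.of_prefix)
      rw [hm] at h1
      simp at h1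
    · refine (rwalk_concat (hRW k) (hL1 k)).2 ⟨LinkAdj.init_eq ⟨f, k, rfl, rfl⟩, fun a ha h => ?_⟩
      obtain ⟨m, hm⟩ := List.getLast?_eq_some_iff.1 ha
      have h2 : a = Y.bd f (k - 1) := (CombGraph.flip_injective h).symm
      have h1 := short (k - 1) m (by
        have h3 := hL3 k
        have h4 := bdPath_succ f (k - 1)
        rw [sub_add_cancel] at h4
        rw [h4, hm, mk_concat, h2, ← mul_assoc] at h3
        exact mul_right_cancel h3)
        (by have := hRW k; rw [hm] at this; exact this.of_prefix)
      rw [hm] at h1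
      simp at h1
  obtain ⟨t, ht⟩ := (Int.modEq_iff_dvd).1 (bdPos_cast f k)
  have hap' : Y.IsApex y (L k) f ((bdPos f k : ℕ) : ℤ) := by
    unfold IsApex
    rw [bd_bdPos, bd_congr f ((bdPos_cast f k).sub_right 1)]
    exact hap
  refine ⟨L k, f, bdPos f k, hap', line_eq_iff.2 ⟨rfl, t, ?_⟩⟩
  change FreeGroup.mk (L k) * (Y.bdPath f ((bdPos f k : ℕ) : ℤ))⁻¹ = p * Y.bdLoop f ^ t
  have h5 : k = t * Y.len f + ((bdPos f k : ℕ) : ℤ) := by linarith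
  rw [hL3 k]
  nth_rewrite 1 [h5]
  rw [bdPath_mul_len_add]
  group

theorem bdRev_succ (f : Y.F) (i : ℤ) (n : ℕ) :
    Y.bdRev f i (n + 1) = Y.bdRev f i n ++ [Y.flip (Y.bd f (i - n - 1))] := by
  unfold bdRev
  have h1 : i - ((n + 1 : ℕ) : ℤ) = i - n - 1 := by push_cast; ring
  rw [h1, bdList_succ', sub_add_cancel, ← List.singleton_append, FreeGroup.invRev_append]
  rfl

theorem bdRev_add (f : Y.F) (i : ℤ) (m n : ℕ) :
    Y.bdRev f i (m + n) = Y.bdRev f i m ++ Y.bdRev f (i - m) n := by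
  induction n with
  | zero => simp [bdRev, bdList_zero]
  | succ n ih =>
    rw [← add_assoc, bdRev_succ, ih, bdRev_succ, List.append_assoc]
    push_cast
    rw [← sub_sub]

theorem IsApex.eventually_top {y : Y.V} {c : Set (FreeGroup Y.E)} {N : ℕ} (hc : Y.ConstFrom y c N)
    {m : List Y.Dart} {f : Y.F} {k : ℤ} (h : Y.IsApex y m f k) :
    ∀ᶠ n in atTop, (FreeGroup.mk m * (Y.bdPath f k)⁻¹ * Y.bdPath f n ∈ c ↔
      FreeGroup.mk (m ++ Y.bdList f k (N - m.length)) ∈ c) := by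
  refine (eventually_ge_atTop (k + (N - m.length : ℕ))).mono fun n hn => ?_
  obtain ⟨t, ht⟩ := Int.le.dest hn
  have h1 := h.1.forward (N - m.length + t)
  rw [← ht, add_assoc, ← Nat.cast_add, bdPath_forward]
  rw [bdList_add, ← List.append_assoc] at h1 ⊢
  refine (hc _ _ h1 ?_).symm
  rw [List.length_append, length_bdList]
  omega

theorem IsApex.eventually_bot {y : Y.V} {c : Set (FreeGroup Y.E)} {N : ℕ} (hc : Y.ConstFrom y c N)
    {m : List Y.Dart} {f : Y.F} {k : ℤ} (h : Y.IsApex y m f k) :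
    ∀ᶠ n in atBot, (FreeGroup.mk m * (Y.bdPath f k)⁻¹ * Y.bdPath f n ∈ c ↔
      FreeGroup.mk (m ++ Y.bdRev f k (N - m.length)) ∈ c) := by
  refine (eventually_le_atBot (k - (N - m.length : ℕ))).mono fun n hn => ?_
  obtain ⟨t, ht⟩ := Int.le.dest hn
  have h1 := h.2.backward (N - m.length + t)
  have h2 : n = k - ((N - m.length + t : ℕ) : ℤ) := by push_cast; omega
  rw [h2, bdPath_backward]
  rw [bdRev_add, ← List.append_assoc] at h1 ⊢
  refine (hc _ _ h1 ?_).symm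
  rw [List.length_append, length_bdRev]
  omega

/-- The corners at depth less than `N` at which a line turns around, that is, the lines that do not
stay beyond a single vertex of depth `N`. -/
abbrev Apex (Y : BranchedComplex) (y : Y.V) (N : ℕ) : Type :=
  {κ : List Y.Dart × Σ f : Y.F, Fin (Y.len f) //
    κ.1.length < N ∧ Y.IsApex y κ.1 κ.2.1 (κ.2.2 : ℕ)}

/-- The vertices of depth `N` through which the two ends of a line leave. -/
def Apex.exit {y : Y.V} {N : ℕ} (κ : Y.Apex y N) (s : Bool) : List Y.Dart :=
  if s then κ.1.1 ++ Y.bdList κ.1.2.1 (κ.1.2.2 : ℕ) (N - κ.1.1.length)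
  else κ.1.1 ++ Y.bdRev κ.1.2.1 (κ.1.2.2 : ℕ) (N - κ.1.1.length)

/-- The traversal of the last edge of `κ.exit s` by the line. -/
def Apex.exitEnd {y : Y.V} {N : ℕ} (κ : Y.Apex y N) (s : Bool) : Y.CornerEnd :=
  if s then (⟨κ.1.2.1, bdPos κ.1.2.1 ((κ.1.2.2 : ℕ) + (N - κ.1.1.length : ℕ) - 1)⟩, true)
  else (⟨κ.1.2.1, bdPos κ.1.2.1 ((κ.1.2.2 : ℕ) - (N - κ.1.1.length : ℕ))⟩, false)

theorem Apex.rwalk_exit {y : Y.V} {N : ℕ} (κ : Y.Apex y N) (s : Bool) :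
    Y.RWalk y (κ.exit s) := by
  cases s
  · exact κ.2.2.2.backward _
  · exact κ.2.2.1.forward _

theorem Apex.length_exit {y : Y.V} {N : ℕ} (κ : Y.Apex y N) (s : Bool) :
    (κ.exit s).length = N := by
  have := κ.2.1
  cases s
  · simp only [exit, Bool.false_eq_true, if_false, List.length_append, length_bdRev]
    omega
  · simp only [exit, if_true, List.length_append, length_bdList]
    omega

theorem Apex.getLast?_exit {y : Y.V} {N : ℕ} (κ : Y.Apex y N) (s : Bool) :
    (κ.exit s).getLast? = some (κ.exitEnd s).dart := by
  obtain ⟨⟨m, f, j⟩, hlt, hap⟩ := κ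
  obtain ⟨n, hn⟩ : ∃ n, N - m.length = n + 1 := ⟨N - m.length - 1, by
    have : m.length < N := hlt
    omega⟩
  cases s
  · change (m ++ Y.bdRev f (j : ℕ) (N - m.length)).getLast? =
      some (Y.flip (Y.bd f (bdPos f ((j : ℕ) - (N - m.length : ℕ)) : ℕ)))
    rw [bd_bdPos, hn, bdRev_succ, ← List.append_assoc, List.getLast?_concat]
    push_cast
    rw [← sub_sub]
  · change (m ++ Y.bdList f (j : ℕ) (N - m.length)).getLast? =
      some (Y.bd f (bdPos f ((j : ℕ) + (N - m.length : ℕ) - 1) : ℕ))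
    rw [bd_bdPos, hn, bdList_succ, ← List.append_assoc, List.getLast?_concat]
    push_cast
    rw [← add_assoc, add_sub_cancel_right]

/-- Two corners of a face from which the boundary arrives at the same end cannot lie at different
depths if the deeper one is an apex: otherwise a boundary edge at the deeper corner would lead back
to the root. -/
theorem not_apex_beyond {y : Y.V} {m m' : List Y.Dart} {f : Y.F} {j j' : ℤ} {n n' : ℕ}
    (h' : Y.IsApex y m' f j') (hlt : m.length < m'.length) (s : Bool)
    (h1 : if s then m ++ Y.bdList f j n = m' ++ Y.bdList f j' n' ∧ j + n ≡ j' + n' [ZMOD Y.len f]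
      else m ++ Y.bdRev f j n = m' ++ Y.bdRev f j' n' ∧ j - n ≡ j' - n' [ZMOD Y.len f]) :
    False := by
  obtain ⟨a, ha⟩ : ∃ a, m'.length = m.length + (a + 1) :=
    ⟨m'.length - m.length - 1, by omega⟩
  cases s
  · obtain ⟨h1, h2⟩ := h1
    have hn : n = a + 1 + n' := by
      have := congrArg List.length h1
      simp only [List.length_append, length_bdRev] at this
      omega
    subst hn
    rw [bdRev_add, ← List.append_assoc] at h1
    obtain ⟨h3, -⟩ := List.append_inj' h1 (by rw [length_bdRev, length_bdRev])
    obtain ⟨-, v, hv⟩ := id h'.1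
    have h4 := (rwalk_concat h'.1.of_prefix (IsWalk.concat_iff.1 hv).1).1 h'.1
    rw [← h3, bdRev_succ, ← List.append_assoc] at h4
    refine h4.2 _ List.getLast?_concat ?_
    rw [CombGraph.flip_flip]
    refine bd_congr f ?_
    have h5 := h2.add_right (n' : ℤ)
    push_cast at h5
    rw [sub_add_cancel] at h5
    refine h5.symm.trans (congrArg (fun x : ℤ => x % Y.len f) ?_)
    ring
  · obtain ⟨h1, h2⟩ := h1
    have hn : n = a + 1 + n' := by
      have := congrArg List.length h1
      simp only [List.length_append, length_bdList] at this
      omega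
    subst hn
    rw [bdList_add, ← List.append_assoc] at h1
    obtain ⟨h3, -⟩ := List.append_inj' h1 (by rw [length_bdList, length_bdList])
    obtain ⟨-, v, hv⟩ := id h'.2
    have h4 := (rwalk_concat h'.2.of_prefix (IsWalk.concat_iff.1 hv).1).1 h'.2
    rw [← h3, bdList_succ, ← List.append_assoc] at h4
    refine h4.2 _ List.getLast?_concat (congrArg Y.flip (bd_congr f ?_))
    have h5 := h2.sub_right ((n' : ℤ) + 1)
    push_cast at h5
    have h6 : j' + n' - (n' + 1) = j' - 1 := by ring
    rw [h6] at h5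
    refine h5.symm.trans (congrArg (fun x : ℤ => x % Y.len f) ?_)
    ring

/-- A line is determined by one of its ends and by the traversal of an edge near this end. -/
theorem Apex.exit_injective {y : Y.V} {N : ℕ} {κ κ' : Y.Apex y N} {s s' : Bool}
    (h : κ.exit s = κ'.exit s') (h' : κ.exitEnd s = κ'.exitEnd s') : κ = κ' ∧ s = s' := by
  obtain rfl : s = s' := by
    have := congrArg Prod.snd h'
    cases s <;> cases s' <;> simp [exitEnd] at this <;> rfl
  refine ⟨?_, rfl⟩
  obtain ⟨⟨m, f, j⟩, hlt, hap⟩ := κ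
  obtain ⟨⟨m', f', j'⟩, hlt', hap'⟩ := κ'
  obtain rfl : f = f' := by
    have := congrArg (fun x => x.1.1) h'
    cases s <;> exact this
  have hlt : m.length < N := hlt
  have hlt' : m'.length < N := hlt'
  have key : if s then m ++ Y.bdList f (j : ℕ) (N - m.length) =
        m' ++ Y.bdList f (j' : ℕ) (N - m'.length) ∧
        ((j : ℕ) : ℤ) + (N - m.length : ℕ) ≡ (j' : ℕ) + (N - m'.length : ℕ) [ZMOD Y.len f]
      else m ++ Y.bdRev f (j : ℕ) (N - m.length) = m' ++ Y.bdRev f (j' : ℕ) (N - m'.length) ∧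
        ((j : ℕ) : ℤ) - (N - m.length : ℕ) ≡ (j' : ℕ) - (N - m'.length : ℕ) [ZMOD Y.len f] := by
    cases s
    · refine ⟨h, ?_⟩
      have h1 : bdPos f (((j : ℕ) : ℤ) - (N - m.length : ℕ)) =
          bdPos f (((j' : ℕ) : ℤ) - (N - m'.length : ℕ)) := by
        simpa [exitEnd] using h'
      have h2 := bdPos_cast f (((j : ℕ) : ℤ) - (N - m.length : ℕ))
      rw [h1] at h2
      exact h2.symm.trans (bdPos_cast f _)
    · refine ⟨h, ?_⟩
      have h1 : bdPos f (((j : ℕ) : ℤ) + (N - m.length : ℕ) - 1) =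
          bdPos f (((j' : ℕ) : ℤ) + (N - m'.length : ℕ) - 1) := by
        simpa [exitEnd] using h'
      have h2 := bdPos_cast f (((j : ℕ) : ℤ) + (N - m.length : ℕ) - 1)
      rw [h1] at h2
      simpa using (h2.symm.trans (bdPos_cast f _)).add_right 1
  have key' : if s then m' ++ Y.bdList f (j' : ℕ) (N - m'.length) =
        m ++ Y.bdList f (j : ℕ) (N - m.length) ∧
        ((j' : ℕ) : ℤ) + (N - m'.length : ℕ) ≡ (j : ℕ) + (N - m.length : ℕ) [ZMOD Y.len f]
      else m' ++ Y.bdRev f (j' : ℕ) (N - m'.length) = m ++ Y.bdRev f (j : ℕ) (N - m.length) ∧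
        ((j' : ℕ) : ℤ) - (N - m'.length : ℕ) ≡ (j : ℕ) - (N - m.length : ℕ) [ZMOD Y.len f] := by
    cases s <;> exact ⟨key.1.symm, key.2.symm⟩
  -- the apexes have the same depth, since neither can lie beyond the other
  rcases lt_trichotomy m.length m'.length with hl | hl | hl
  · exact (not_apex_beyond hap' hl s key).elim
  · obtain rfl : m = m' := by
      cases s
      · exact (List.append_inj key.1 hl).1
      · exact (List.append_inj key.1 hl).1
    have hj : j = j' := by
      refine fin_eq_of_modEq ?_
      cases s
      · simpa using key.2.add_right ((N - m.length : ℕ) : ℤ)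
      · exact Int.ModEq.add_right_cancel' _ key.2
    subst hj
    rfl
  · exact (not_apex_beyond hap hl s key').elim

/-- The preimage of a set of vertices of depth `N` under truncation. -/
def beyond (Y : BranchedComplex) (y : Y.V) (N : ℕ) (B : Set (List Y.Dart)) : Set (FreeGroup Y.E) :=
  {g | ∃ r, Y.RWalk y r ∧ FreeGroup.mk r = g ∧ r.take N ∈ B}

theorem mem_beyond {y : Y.V} {N : ℕ} {B : Set (List Y.Dart)} {r : List Y.Dart}
    (h : Y.RWalk y r) : FreeGroup.mk r ∈ Y.beyond y N B ↔ r.take N ∈ B := by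
  constructor
  · rintro ⟨r', h1, h2, h3⟩
    rwa [mk_injOn_rwalk y h1 h h2] at h3
  · exact fun h' => ⟨r, h, rfl, h'⟩

theorem constFrom_beyond (y : Y.V) (N : ℕ) (B : Set (List Y.Dart)) :
    Y.ConstFrom y (Y.beyond y N B) N := by
  intro l m h hl
  rw [mem_beyond h, mem_beyond h.of_prefix, List.take_append_of_le_length hl]

/-- In a finite surface, an indecomposable set of vertices of the universal cover splits at most two
lines: beyond a large depth it consists of half-trees, each of which is left by exactly two ends
of lines. The half-trees of an indecomposable set are connected by lines, which uses up all
but two of these ends. -/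
theorem IsSurface.not_hasTripodAt [Finite Y.V] [Finite Y.E] [Finite Y.F] (hY : Y.IsSurface) :
    ¬ Y.HasTripodAt := by
  classical
  rintro ⟨y, S, hS, ⟨a₁, a₂, a₃, h12, h13, h23, hs₁, hs₂, hs₃⟩, hdec⟩
  obtain ⟨c, hc⟩ := Assoc.exists_of_almostInv hS (one_mem_pathClass y)
  obtain ⟨N₀, hN₀⟩ := hc.treeInv.exists_depth
  obtain ⟨N, hNpos, hN⟩ : ∃ N, 0 < N ∧ Y.ConstFrom y c N :=
    ⟨N₀ + 1, by omega, fun l m h hl => hN₀ l m h (by omega)⟩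
  set B : Set (List Y.Dart) := {l | Y.RWalk y l ∧ l.length = N ∧ FreeGroup.mk l ∈ c} with hB
  have hBfin : B.Finite := (List.finite_length_eq Y.Dart N).subset fun l hl => hl.2.1
  have hexitB : ∀ (κ : Y.Apex y N) s, κ.exit s ∈ B ↔ FreeGroup.mk (κ.exit s) ∈ c := fun κ s =>
    ⟨fun h => h.2.2, fun h => ⟨κ.rwalk_exit s, κ.length_exit s, h⟩⟩
  have hKfin : Finite (Y.Apex y N) :=
    (((List.finite_length_lt Y.Dart N).prod (Set.finite_univ (α := Σ f : Y.F, Fin (Y.len f)))).subset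
      fun κ hκ => ⟨hκ.1, trivial⟩ : {κ : List Y.Dart × Σ f : Y.F, Fin (Y.len f) |
        κ.1.length < N ∧ Y.IsApex y κ.1 κ.2.1 (κ.2.2 : ℕ)}.Finite).to_subtype
  -- which lines are split can be read off at the exits
  have hsplit : ∀ {S' : Set (Y.pi1 y)} {c' : Set (FreeGroup Y.E)}, Assoc S' y 1 c' →
      Y.ConstFrom y c' N → ∀ m f (j : Fin (Y.len f)) (h : Y.IsApex y m f (j : ℕ)),
      (IsSplitBy (Y.lineStab y (Quotient.mk _ ⟨f, _, h.mem⟩)) S' ↔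
        ¬ (FreeGroup.mk (m ++ Y.bdList f (j : ℕ) (N - m.length)) ∈ c' ↔
          FreeGroup.mk (m ++ Y.bdRev f (j : ℕ) (N - m.length)) ∈ c')) := by
    intro S' c' hc' hN' m f j h
    rw [hc'.isSplitBy_iff, inv_one, one_mul]
    unfold LineSplit
    rw [eventually_iff_const (h.eventually_top hN'), eventually_iff_const (h.eventually_bot hN')]
  have hdeep : ∀ {m : List Y.Dart} {f} {k : ℤ}, ¬ m.length < N →
      m ++ Y.bdList f k (N - m.length) = m ∧ m ++ Y.bdRev f k (N - m.length) = m := by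
    intro m f k h
    rw [Nat.sub_eq_zero_of_le (not_lt.1 h)]
    simp [bdRev, bdList_zero]
  have hapex : ∀ a, IsSplitBy (Y.lineStab y a) S → ∃ κ : Y.Apex y N,
      a = Quotient.mk _ ⟨κ.1.2.1, _, κ.2.2.mem⟩ ∧ ¬ (κ.exit true ∈ B ↔ κ.exit false ∈ B) := by
    intro a ha
    obtain ⟨m, f, j, h, rfl⟩ := exists_isApex a
    replace ha := (hsplit hc hN m f j h).1 ha
    by_cases hm : m.length < N
    · refine ⟨⟨(m, ⟨f, j⟩), hm, h⟩, rfl, ?_⟩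
      rw [hexitB, hexitB]
      exact ha
    · rw [(hdeep hm).1, (hdeep hm).2] at ha
      exact absurd Iff.rfl ha
  obtain ⟨κ₁, rfl, hk₁⟩ := hapex a₁ hs₁
  obtain ⟨κ₂, rfl, hk₂⟩ := hapex a₂ hs₂
  obtain ⟨κ₃, rfl, hk₃⟩ := hapex a₃ hs₃
  refine false_of_three_leaving hBfin Apex.exit ?_ ?_ (fun h => h12 (by rw [h]))
    (fun h => h13 (by rw [h])) (fun h => h23 (by rw [h])) hk₁ hk₂ hk₃
  · -- each half-tree is left by two ends of lines
    have := hBfin.to_subtype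
    have := Fintype.ofFinite B
    have htwo : ∀ l : B, Nat.card {h : Y.CornerEnd // l.1.getLast? = some h.dart} = 2 := by
      rintro ⟨l, -, hl, -⟩
      have h0 : l ≠ [] := by
        rintro rfl
        exact hNpos.ne hl
      have h1 := (encard_cornerEnd (l.getLast h0)).trans ((hY _).2.2 _ rfl)
      have h2 : {h : Y.CornerEnd | l.getLast? = some h.dart} =
          {h : Y.CornerEnd | h.dart = l.getLast h0} := by
        ext h
        rw [Set.mem_ofPred_eq, List.getLast?_eq_getLast_of_ne_nil h0, Option.some.injEq]
        exact eq_comm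
      have h3 : {h : Y.CornerEnd | l.getLast? = some h.dart}.ncard = 2 := by
        rw [h2, Set.ncard, h1]
        rfl
      exact h3
    have h1 : Nat.card (Σ l : B, {h : Y.CornerEnd // l.1.getLast? = some h.dart}) =
        2 * Nat.card B := by
      rw [Nat.card_sigma, Finset.sum_congr rfl fun l _ => htwo l]
      simp [mul_comm]
    rw [← h1]
    refine Nat.card_le_card_of_injective
      (fun x => ⟨⟨_, x.2⟩, ⟨x.1.1.exitEnd x.1.2, x.1.1.getLast?_exit x.1.2⟩⟩) ?_
    rintro ⟨⟨κ, s⟩, h⟩ ⟨⟨κ', s'⟩, h'⟩ heq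
    have e1 : κ.exit s = κ'.exit s' := congrArg (fun x => x.1.1) heq
    have e2 : κ.exitEnd s = κ'.exitEnd s' := congrArg (fun x => x.2.1) heq
    obtain ⟨rfl, rfl⟩ := Apex.exit_injective e1 e2
    rfl
  · -- a union of components would decompose `S`
    intro B₁ hB₁ ⟨l₀, hl₀⟩ hclosed
    have hc₁ := Assoc.of_treeInv (constFrom_beyond y N B₁).treeInv
    have hinf : ∀ l ∈ B, {g | (∃ v, g ∈ Y.pathClass y v) ∧
        g ∈ c ∩ {g | ∃ r, Y.RWalk y r ∧ FreeGroup.mk r = g ∧ r.take N = l}}.Infinite := by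
      rintro l ⟨h1, h2, h3⟩
      have h0 : l ≠ [] := by
        rintro rfl
        exact hNpos.ne h2
      refine ((h1.infinite_beyond hY.isTight.valence h0).image
        ((mk_injOn_rwalk y).mono fun r hr => hr.1)).mono ?_
      rintro _ ⟨_, ⟨h4, ⟨m, rfl⟩⟩, rfl⟩
      exact ⟨h4.mem, (hN _ _ h4 h2.ge).1 h3, _, h4, rfl, List.take_left' h2⟩
    have hns : ∀ a, ((Y.lineStab y a : Set (Y.pi1 y)) \ S).Finite → ¬ IsSplitBy (Y.lineStab y a)
        (Subtype.val ⁻¹' Y.beyond y N B₁) := by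
      intro a ha
      obtain ⟨m, f, j, h, rfl⟩ := exists_isApex a
      refine fun h5 => (hsplit hc₁ (constFrom_beyond y N B₁) m f j h).1 h5 ?_
      by_cases hm : m.length < N
      · obtain ⟨κ, e1, e2⟩ : ∃ κ : Y.Apex y N,
            κ.exit true = m ++ Y.bdList f (j : ℕ) (N - m.length) ∧
            κ.exit false = m ++ Y.bdRev f (j : ℕ) (N - m.length) :=
          ⟨⟨(m, ⟨f, j⟩), hm, h⟩, rfl, rfl⟩
        rw [Set.sdiff_eq] at ha
        obtain ⟨h1, h2⟩ := (hc.compl.finite_line_iff _).1 ha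
        simp only [inv_one, one_mul, Set.mem_compl_iff, not_not] at h1 h2
        rw [eventually_iff_const (h.eventually_top hN)] at h1
        rw [eventually_iff_const (h.eventually_bot hN)] at h2
        rw [← e1] at h1 ⊢
        rw [← e2] at h2 ⊢
        rw [mem_beyond (κ.rwalk_exit _), mem_beyond (κ.rwalk_exit _),
          List.take_of_length_le (κ.length_exit _).le, List.take_of_length_le (κ.length_exit _).le]
        exact hclosed κ ((hexitB _ _).2 h1) ((hexitB _ _).2 h2)
      · rw [(hdeep hm).1, (hdeep hm).2]
    rcases hdec _ hc₁.almostInv hns with h | h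
    · exfalso
      refine hinf l₀ (hB₁ hl₀) (((hc₁.inter hc).finite_iff.1 h).subset ?_)
      rintro g ⟨h1, h2, r, h3, rfl, h4⟩
      exact ⟨h1, (mem_beyond h3).2 (h4 ▸ hl₀), h2⟩
    · intro l hl
      by_contra hl'
      rw [Set.sdiff_eq] at h
      refine hinf l hl (((hc.inter hc₁.compl).finite_iff.1 h).subset ?_)
      rintro g ⟨h1, h2, r, h3, rfl, h4⟩
      refine ⟨h1, h2, fun h5 => hl' ?_⟩
      rw [mem_beyond h3, h4] at h5
      exact h5

end BranchedComplex

namespace BranchedComplex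

open CombGraph

variable {X Y Z : BranchedComplex}

/-! ### Unfolding at a cut vertex of a link -/

/-- A criterion for a homotopy equivalence of 1-skeleta: there is a homomorphism `θ` in the opposite
direction, and paths `c` from the vertices to the images of a section. -/
theorem Hom.IsGraphEquiv.of_section (φ : Hom Y X) (sec : X.V → Y.V)
    (hsec : ∀ w, φ.vert (sec w) = w) (θ : FreeGroup X.E →* FreeGroup Y.E)
    (hθ : ∀ d, θ (FreeGroup.mk [d]) ∈ Y.pathClass (sec (X.init d)) (sec (X.term d)))
    (hφθ : ∀ d, φ.edgeMap (θ (FreeGroup.mk [d])) = FreeGroup.mk [d])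
    (c : Y.V → FreeGroup Y.E) (hc : ∀ y, c y ∈ Y.pathClass y (sec (φ.vert y)))
    (hφc : ∀ y, φ.edgeMap (c y) = 1)
    (hd : ∀ d, FreeGroup.mk [d] = c (Y.init d) * θ (FreeGroup.mk [φ.dart d]) * (c (Y.term d))⁻¹) :
    φ.IsGraphEquiv := by
  have hθ' : ∀ {u w g}, g ∈ X.pathClass u w → θ g ∈ Y.pathClass (sec u) (sec w) := by
    intro u w g hg
    refine pathClass_induction (P := fun u w g => θ g ∈ Y.pathClass (sec u) (sec w))
      (fun u => ?_) (fun d w g _ ih => ?_) hg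
    · rw [_root_.map_one]
      exact one_mem_pathClass _
    · rw [_root_.map_mul]
      exact mul_mem_pathClass (hθ d) ih
  have hφθ' : ∀ {u w g}, g ∈ X.pathClass u w → φ.edgeMap (θ g) = g := by
    intro u w g hg
    refine pathClass_induction (P := fun u w g => φ.edgeMap (θ g) = g)
      (fun u => ?_) (fun d w g _ ih => ?_) hg
    · rw [_root_.map_one, _root_.map_one]
    · rw [_root_.map_mul, _root_.map_mul, ih, hφθ]
  have hfac : ∀ {u w g}, g ∈ Y.pathClass u w → g = c u * θ (φ.edgeMap g) * (c w)⁻¹ := by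
    intro u w g hg
    refine pathClass_induction (P := fun u w g => g = c u * θ (φ.edgeMap g) * (c w)⁻¹)
      (fun u => ?_) (fun d w g _ ih => ?_) hg
    · simp
    · rw [_root_.map_mul, _root_.map_mul, φ.edgeMap_dart]
      nth_rewrite 1 [hd d, ih]
      group
  refine ⟨fun u v h => ?_, fun w => ⟨sec w, by rw [hsec]; exact CombGraph.Joined.refl w⟩, fun v => ⟨?_, ?_, ?_⟩⟩
  · obtain ⟨g, hg⟩ := joined_iff.1 h
    exact joined_of_mem (mul_mem_pathClass (mul_mem_pathClass (hc u) (hθ' hg))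
      (inv_mem_pathClass (hc v)))
  · exact fun g hg => φ.edgeMap_mem hg
  · intro g hg g' hg' h
    rw [hfac hg, hfac hg', h]
  · intro h hh
    refine ⟨c v * θ h * (c v)⁻¹, ?_, ?_⟩
    · exact mul_mem_pathClass (mul_mem_pathClass (hc v) (hθ' hh)) (inv_mem_pathClass (hc v))
    · rw [_root_.map_mul, _root_.map_mul, _root_.map_inv, hφc, hφθ' hh]
      simp

/-- A set `D` of edges at the initial vertex of `d₀` which is separated by `d₀` from the other edges
in the link of this vertex. -/
structure IsSide (Y : BranchedComplex) (d₀ : Y.Dart) (D : Set Y.Dart) : Prop where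
  init_eq : ∀ d ∈ D, Y.init d = Y.init d₀
  notMem : d₀ ∉ D
  adj : ∀ a b, Y.LinkAdj a b → a ≠ d₀ → b ≠ d₀ → (a ∈ D ↔ b ∈ D)

section Unfold

open Classical in
/-- The initial vertices of the oriented edges after splitting the initial vertex of `d₀` in two.
The new vertex is `none`; it carries the edges in `D` and a copy of `d₀`, whose underlying edge is
`none`. -/
noncomputable def unfoldInit (Y : BranchedComplex) (d₀ : Y.Dart) (D : Set Y.Dart) :
    Option Y.E × Bool → Option Y.V
  | (some e, b) => if (e, b) ∈ D then none else some (Y.init (e, b))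
  | (none, b) => if b = d₀.2 then none else if Y.flip d₀ ∈ D then none else some (Y.term d₀)

/-- The graph obtained by splitting the initial vertex of `d₀`. -/
noncomputable def unfoldGraph (Y : BranchedComplex) (d₀ : Y.Dart) (D : Set Y.Dart) : CombGraph where
  V := Option Y.V
  E := Option Y.E
  src e := Y.unfoldInit d₀ D (e, true)
  tgt e := Y.unfoldInit d₀ D (e, false)

variable {d₀ : Y.Dart} {D : Set Y.Dart}

theorem init_unfoldGraph (x : (Y.unfoldGraph d₀ D).Dart) :
    (Y.unfoldGraph d₀ D).init x = Y.unfoldInit d₀ D x := by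
  obtain ⟨e, b⟩ := x
  cases b <;> rfl

/-- The corner `i` of `f` lies on the new sheet. -/
def OnCopy (Y : BranchedComplex) (d₀ : Y.Dart) (D : Set Y.Dart) (f : Y.F) (i : ℤ) : Prop :=
  (Y.bd f i = d₀ ∧ Y.flip (Y.bd f (i - 1)) ∈ D) ∨ (Y.bd f i = Y.flip d₀ ∧ Y.bd f (i + 1) ∈ D)

open Classical in
/-- The lift of the boundary of a face. -/
noncomputable def unfoldBd (Y : BranchedComplex) (d₀ : Y.Dart) (D : Set Y.Dart) (f : Y.F) (i : ℤ) :
    (Y.unfoldGraph d₀ D).Dart :=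
  (if Y.OnCopy d₀ D f i then none else some (Y.bd f i).1, (Y.bd f i).2)

/-- The projection of oriented edges. -/
def unfoldProj (d₀ : Y.Dart) (x : Option Y.E × Bool) : Y.Dart := (x.1.getD d₀.1, x.2)

theorem OnCopy.fst {f : Y.F} {i : ℤ} (h : Y.OnCopy d₀ D f i) : (Y.bd f i).1 = d₀.1 := by
  rcases h with h | h
  · rw [h.1]
  · rw [h.1]; rfl

theorem unfoldProj_bd (f : Y.F) (i : ℤ) :
    unfoldProj d₀ (Y.unfoldBd d₀ D f i) = Y.bd f i := by
  by_cases h : Y.OnCopy d₀ D f i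
  · simp [unfoldBd, unfoldProj, h, ← h.fst]
  · simp [unfoldBd, unfoldProj, h]

theorem unfoldInit_none_not (b : Bool) (hb : b ≠ d₀.2) :
    Y.unfoldInit d₀ D (none, b) = Y.unfoldInit d₀ D (some d₀.1, b) := by
  have h : ((d₀.1, b) : Y.Dart) = Y.flip d₀ := by
    refine Prod.ext rfl ?_
    change b = !d₀.2
    revert hb
    cases b <;> cases d₀.2 <;> simp
  simp only [unfoldInit, if_neg hb]
  rw [h]
  rfl

open Classical in
/-- The initial vertex of an edge that is not a copy of `d₀`. -/
theorem unfoldInit_of_ne {x : Option Y.E × Bool} (h : unfoldProj d₀ x ≠ d₀) :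
    Y.unfoldInit d₀ D x =
      if unfoldProj d₀ x ∈ D then none else some (Y.init (unfoldProj d₀ x)) := by
  obtain ⟨e, b⟩ := x
  cases e with
  | some e => rfl
  | none =>
    have hb : b ≠ d₀.2 := by
      rintro rfl
      exact h rfl
    rw [unfoldInit_none_not b hb]
    rfl

theorem init_unfoldProj (h : Y.IsSide d₀ D) (x : Option Y.E × Bool) :
    Y.init (unfoldProj d₀ x) = (Y.unfoldInit d₀ D x).getD (Y.init d₀) := by
  by_cases hx : unfoldProj d₀ x = d₀
  · obtain ⟨e, b⟩ := x
    cases e with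
    | some e =>
      have hx : (e, b) = d₀ := hx
      subst hx
      simp [unfoldInit, h.notMem, unfoldProj]
    | none =>
      have hb : b = d₀.2 := congrArg Prod.snd hx
      subst hb
      simp [unfoldInit, unfoldProj]
  · rw [unfoldInit_of_ne hx]
    by_cases hD : unfoldProj d₀ x ∈ D
    · simp [hD, h.init_eq _ hD]
    · simp [hD]

theorem unfoldBd_path (h : Y.IsSide d₀ D) (f : Y.F) (i : ℤ) :
    (Y.unfoldGraph d₀ D).term (Y.unfoldBd d₀ D f i) =
      (Y.unfoldGraph d₀ D).init (Y.unfoldBd d₀ D f (i + 1)) := by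
  classical
  have hadj : Y.LinkAdj (Y.flip (Y.bd f i)) (Y.bd f (i + 1)) :=
    ⟨f, i + 1, by rw [add_sub_cancel_right], rfl⟩
  have hne := Y.bd_immersed f i
  unfold CombGraph.term
  rw [init_unfoldGraph, init_unfoldGraph]
  have hpa : unfoldProj d₀ ((Y.unfoldGraph d₀ D).flip (Y.unfoldBd d₀ D f i)) = Y.flip (Y.bd f i) := by
    conv_rhs => rw [← unfoldProj_bd (d₀ := d₀) (D := D)]
    rfl
  have hpb := unfoldProj_bd (d₀ := d₀) (D := D) f (i + 1)
  -- at a corner that uses `d₀`, the copy of `d₀` is chosen on the side of the other edge; at any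
  -- other corner both edges lie on the same side
  by_cases ha : Y.flip (Y.bd f i) = d₀
  · have hb : Y.bd f (i + 1) ≠ d₀ := fun hb => hne (hb.trans ha.symm)
    rw [unfoldInit_of_ne (x := Y.unfoldBd d₀ D f (i + 1)) (by rwa [hpb]), hpb]
    have ha' : Y.bd f i = Y.flip d₀ := CombGraph.flip_eq_iff.1 ha
    have hon : Y.OnCopy d₀ D f i ↔ Y.bd f (i + 1) ∈ D := by
      unfold OnCopy
      simp [ha', CombGraph.flip_ne]
    by_cases hD : Y.bd f (i + 1) ∈ D
    · have : (Y.unfoldGraph d₀ D).flip (Y.unfoldBd d₀ D f i) = (none, d₀.2) := by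
        simp [unfoldBd, hon.2 hD, CombGraph.flip, ha']
        rfl
      rw [this, if_pos hD]
      simp [unfoldInit]
      rfl
    · have : (Y.unfoldGraph d₀ D).flip (Y.unfoldBd d₀ D f i) = (some d₀.1, d₀.2) := by
        simp [unfoldBd, mt hon.1 hD, CombGraph.flip, ha']
        rfl
      rw [this, if_neg hD]
      simp only [unfoldInit, Prod.mk.eta, if_neg h.notMem]
      rw [← hadj.init_eq, ha]
  · rw [unfoldInit_of_ne (x := (Y.unfoldGraph d₀ D).flip (Y.unfoldBd d₀ D f i)) (by rwa [hpa]), hpa]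
    by_cases hb : Y.bd f (i + 1) = d₀
    · have hon : Y.OnCopy d₀ D f (i + 1) ↔ Y.flip (Y.bd f i) ∈ D := by
        unfold OnCopy
        simp [hb, (CombGraph.flip_ne d₀).symm]
      by_cases hD : Y.flip (Y.bd f i) ∈ D
      · have : Y.unfoldBd d₀ D f (i + 1) = (none, d₀.2) := by
          simp [unfoldBd, hon.2 hD, hb]
          rfl
        rw [this, if_pos hD]
        simp [unfoldInit]
        rfl
      · have : Y.unfoldBd d₀ D f (i + 1) = (some d₀.1, d₀.2) := by
          simp [unfoldBd, mt hon.1 hD, hb]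
          rfl
        rw [this, if_neg hD]
        simp only [unfoldInit, Prod.mk.eta, if_neg h.notMem]
        rw [hadj.init_eq, hb]
    · rw [unfoldInit_of_ne (x := Y.unfoldBd d₀ D f (i + 1)) (by rwa [hpb]), hpb,
        hadj.init_eq]
      simp only [h.adj _ _ hadj ha hb]
      rfl

/-- The complex obtained by splitting the initial vertex of `d₀`. -/
noncomputable def unfold (Y : BranchedComplex) (d₀ : Y.Dart) (D : Set Y.Dart) (h : Y.IsSide d₀ D) :
    BranchedComplex where
  toCombGraph := Y.unfoldGraph d₀ D
  F := Y.F
  len := Y.len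
  len_pos := Y.len_pos
  bd := Y.unfoldBd d₀ D
  bd_periodic f i := by
    have h1 := Y.bd_periodic f i
    have h2 := Y.bd_periodic f (i + 1)
    have h3 := Y.bd_periodic f (i - 1)
    rw [add_right_comm] at h2
    rw [← add_sub_right_comm] at h3
    have h4 : Y.OnCopy d₀ D f (i + Y.len f) ↔ Y.OnCopy d₀ D f i := by
      unfold OnCopy
      rw [h1, h2, h3]
    classical
    unfold unfoldBd
    rw [h1]
    exact congrArg (fun e => (e, (Y.bd f i).2)) (if_congr h4 rfl rfl)
  bd_path := unfoldBd_path h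
  bd_immersed f i hf := by
    apply Y.bd_immersed f i
    rw [← unfoldProj_bd (d₀ := d₀) (D := D) f i, ← unfoldProj_bd (d₀ := d₀) (D := D) f (i + 1), hf]
    rfl
  area := Y.area
  area_pos := Y.area_pos

variable (h : Y.IsSide d₀ D)

/-- The fold map which identifies the two copies of `d₀` again. -/
noncomputable def unfoldHom : Hom (Y.unfold d₀ D h) Y where
  vert v := Option.getD v (Y.init d₀)
  dart x := unfoldProj d₀ x
  init_dart x := (init_unfoldProj h x).trans (congrArg (fun v => Option.getD v (Y.init d₀))
    (init_unfoldGraph x).symm)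
  dart_flip x := rfl
  face f := f
  mult _ := 1
  mult_pos _ := one_pos
  rev _ := false
  shift _ := 0
  len_eq f := (one_mul _).symm
  area_eq f := (one_mul _).symm
  dart_bd f i := by
    rw [zero_add]
    exact unfoldProj_bd (D := D) f i

theorem init_unfold (x : (Y.unfold d₀ D h).Dart) :
    (Y.unfold d₀ D h).init x = Y.unfoldInit d₀ D x := init_unfoldGraph x

/-- Folding the two copies of `d₀` together is a homotopy equivalence of 1-skeleta, because the copies
share their terminal vertex but have distinct initial vertices. -/
theorem unfoldHom_isFoldEquiv : (unfoldHom h).IsFoldEquiv where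
  vert v := ⟨some v, rfl⟩
  dart d := ⟨(some d.1, d.2), rfl⟩
  faces := ⟨Function.bijective_id, fun _ => rfl⟩
  graph := by
    classical
    let κ : (Y.unfold d₀ D h).Dart → FreeGroup (Y.unfold d₀ D h).E := fun x => FreeGroup.mk [x]
    have hκ : ∀ x, (unfoldHom h).edgeMap (κ x) = FreeGroup.mk [unfoldProj d₀ x] := fun x =>
      Hom.edgeMap_dart _ x
    have hκflip : ∀ x, κ ((Y.unfold d₀ D h).flip x) = (κ x)⁻¹ := fun x => mk_flip x
    -- the path along the two copies joins the new vertex to the old one and becomes trivial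
    let γ : FreeGroup (Y.unfold d₀ D h).E := κ (none, d₀.2) * (κ (some d₀.1, d₀.2))⁻¹
    have hγ_def : γ = κ (none, d₀.2) * (κ (some d₀.1, d₀.2))⁻¹ := rfl
    have hdart : ∀ x : (Y.unfold d₀ D h).Dart, κ x ∈
        (Y.unfold d₀ D h).pathClass (Y.unfoldInit d₀ D x)
          (Y.unfoldInit d₀ D (x.1, !x.2)) := by
      intro x
      have h1 := dart_mem_pathClass x
      rw [init_unfold] at h1
      have h2 : (Y.unfold d₀ D h).term x = Y.unfoldInit d₀ D (x.1, !x.2) := init_unfold h _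
      rwa [h2] at h1
    have hγ : γ ∈ (Y.unfold d₀ D h).pathClass none (some (Y.init d₀)) := by
      have h1 := hdart (none, d₀.2)
      have h2 := hdart (some d₀.1, d₀.2)
      rw [unfoldInit_none_not (!d₀.2) (by simp)] at h1
      have h3 := mul_mem_pathClass h1 (inv_mem_pathClass h2)
      have h4 : ∀ a b, Y.unfoldInit d₀ D (none, d₀.2) = a →
          Y.unfoldInit d₀ D (some d₀.1, d₀.2) = b → γ ∈ (Y.unfold d₀ D h).pathClass a b := by
        rintro _ _ rfl rfl
        exact h3
      exact h4 _ _ (if_pos rfl) (if_neg h.notMem)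
    have hφγ : (unfoldHom h).edgeMap γ = 1 := by
      rw [hγ_def, _root_.map_mul, _root_.map_inv, hκ, hκ]
      exact mul_inv_cancel _
    -- `C` moves from the old vertex to the new one before an edge in `D`, and so `θ` is a section
    let C : Y.Dart → FreeGroup (Y.unfold d₀ D h).E := fun d => if d ∈ D then γ⁻¹ else 1
    have hC : ∀ d, C d ∈ (Y.unfold d₀ D h).pathClass (some (Y.init d))
        (Y.unfoldInit d₀ D (some d.1, d.2)) := by
      intro d
      by_cases hd : d ∈ D
      · simp only [C, if_pos hd, unfoldInit, Prod.mk.eta]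
        rw [h.init_eq d hd]
        exact inv_mem_pathClass hγ
      · simp only [C, if_neg hd, unfoldInit, Prod.mk.eta]
        exact one_mem_pathClass _
    have hφC : ∀ d, (unfoldHom h).edgeMap (C d) = 1 := by
      intro d
      by_cases hd : d ∈ D
      · simp only [C, if_pos hd, _root_.map_inv, hφγ, inv_one]
      · simp only [C, if_neg hd, _root_.map_one]
    let θ : FreeGroup Y.E →* FreeGroup (Y.unfold d₀ D h).E := FreeGroup.lift fun e =>
      C (e, true) * κ (some e, true) * (C (e, false))⁻¹
    have hθ : ∀ d : Y.Dart, θ (FreeGroup.mk [d]) =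
        C d * κ (some d.1, d.2) * (C (Y.flip d))⁻¹ := by
      have h1 : ∀ e, θ (FreeGroup.mk [(e, true)]) =
          C (e, true) * κ (some e, true) * (C (e, false))⁻¹ := fun e => by
        simp only [θ, FreeGroup.lift_mk, List.map_cons, List.map_nil, cond_true, List.prod_singleton]
      rintro ⟨e, b⟩
      cases b
      · have h2 : ((e, false) : Y.Dart) = Y.flip (e, true) := rfl
        have h3 : ((some e, false) : (Y.unfold d₀ D h).Dart) =
          (Y.unfold d₀ D h).flip (some e, true) := rfl
        rw [h2, mk_flip, _root_.map_inv, h1, CombGraph.flip_flip]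
        change _ = C (e, false) * κ (some e, false) * _
        rw [h3, hκflip]
        group
      · exact h1 e
    refine Hom.IsGraphEquiv.of_section _ some (fun _ => rfl) θ (fun d => ?_) (fun d => ?_)
      (fun y : Option Y.V => if y = none then γ else 1) (fun y => ?_) (fun y => ?_) (fun x => ?_)
    · rw [hθ]
      exact mul_mem_pathClass (mul_mem_pathClass (hC d) (hdart (some d.1, d.2)))
        (inv_mem_pathClass (hC (Y.flip d)))
    · rw [hθ, _root_.map_mul, _root_.map_mul, _root_.map_inv, hφC, hφC, hκ]
      simp only [one_mul, inv_one, mul_one]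
      rfl
    · cases y with
      | none =>
        rw [if_pos rfl]
        exact hγ
      | some y =>
        rw [if_neg (Option.some_ne_none y)]
        exact one_mem_pathClass _
    · cases y with
      | none =>
        rw [if_pos rfl]
        exact hφγ
      | some y =>
        rw [if_neg (Option.some_ne_none y)]
        exact _root_.map_one _
    · have alg₁ : ∀ c₁ C₁ k c₂ C₂ : FreeGroup (Y.unfold d₀ D h).E, c₁ * C₁ = 1 → c₂ * C₂ = 1 →
          k = c₁ * (C₁ * k * C₂⁻¹) * c₂⁻¹ := by
        intro c₁ C₁ k c₂ C₂ h1 h2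
        rw [eq_inv_of_mul_eq_one_left h1, eq_inv_of_mul_eq_one_left h2]
        group
      have alg₂ : ∀ C₁ k k' c₂ C₂ : FreeGroup (Y.unfold d₀ D h).E, C₁ = 1 → c₂ * C₂ = 1 →
          k' = k' * k⁻¹ * (C₁ * k * C₂⁻¹) * c₂⁻¹ := by
        intro C₁ k k' c₂ C₂ h1 h2
        rw [h1, eq_inv_of_mul_eq_one_left h2]
        group
      have hinit := init_unfold h x
      have hterm : (Y.unfold d₀ D h).term x = Y.unfoldInit d₀ D (x.1, !x.2) := init_unfold h _
      have hx : (unfoldHom h).dart x = unfoldProj d₀ x := rfl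
      rw [hx, hθ, hinit, hterm]
      set c : Option Y.V → FreeGroup (Y.unfold d₀ D h).E := fun y => if y = none then γ else 1
      have hc : ∀ d : Y.Dart, c (Y.unfoldInit d₀ D (some d.1, d.2)) * C d = 1 := by
        intro d
        by_cases hd : d ∈ D
        · simp [c, C, unfoldInit, hd]
        · simp [c, C, unfoldInit, hd]
      have hc₀ : c (Y.unfoldInit d₀ D (none, d₀.2)) = γ := by
        simp [c, unfoldInit]
      have hc₁ : c (Y.unfoldInit d₀ D (none, !d₀.2)) * C (Y.flip d₀) = 1 := by
        rw [unfoldInit_none_not (!d₀.2) (by simp)]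
        exact hc (Y.flip d₀)
      have hC₀ : C d₀ = 1 := if_neg h.notMem
      obtain ⟨e, b⟩ := x
      cases e with
      | some e => exact alg₁ _ _ _ _ _ (hc (e, b)) (hc (Y.flip (e, b)))
      | none =>
        by_cases hb : b = d₀.2
        · subst hb
          have h1 := alg₂ _ (κ (some d₀.1, d₀.2)) (κ (none, d₀.2)) _ _ hC₀ hc₁
          rw [← hγ_def, ← hc₀] at h1
          exact h1
        · have hb' : b = !d₀.2 := by
            revert hb
            cases b <;> cases d₀.2 <;> simp
          subst hb'
          have h1 := congrArg (·⁻¹) (alg₂ _ (κ (some d₀.1, d₀.2)) (κ (none, d₀.2)) _ _ hC₀ hc₁)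
          rw [← hγ_def, ← hc₀] at h1
          simp only [mul_inv_rev, inv_inv] at h1
          have e1 : κ (none, !d₀.2) = (κ (none, d₀.2))⁻¹ := hκflip (none, d₀.2)
          have e2 : κ (some d₀.1, !d₀.2) = (κ (some d₀.1, d₀.2))⁻¹ := hκflip (some d₀.1, d₀.2)
          have e3 : ((none, !(!d₀.2)) : Option Y.E × Bool) = (none, d₀.2) := by rw [Bool.not_not]
          have e4 : C (Y.flip (Y.flip d₀)) = C d₀ := by rw [CombGraph.flip_flip]
          change κ (none, !d₀.2) = c (Y.unfoldInit d₀ D (none, !d₀.2)) *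
            (C (Y.flip d₀) * κ (some d₀.1, !d₀.2) * (C (Y.flip (Y.flip d₀)))⁻¹) *
            (c (Y.unfoldInit d₀ D (none, !(!d₀.2))))⁻¹
          rw [e1, e2, e3, e4, h1]
          group

theorem two_le_encard {α : Type} {s : Set α} {a b : α} (ha : a ∈ s) (hb : b ∈ s) (hab : a ≠ b) :
    2 ≤ s.encard := by
  rw [← Set.encard_pair hab]
  exact Set.encard_le_encard (by rintro x (rfl | rfl) <;> assumption)

/-- If a link has a cut vertex, then there is a non-trivial unfolding. -/
theorem IsSide.hasUnfolding (h : Y.IsSide d₀ D) (hY : Y.IsFinite) (hval : ∀ v, 2 ≤ Y.valence v)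
    {d d' : Y.Dart} (hd : d ∈ D) (hd' : d' ∉ D) (hne : d' ≠ d₀) (hinit : Y.init d' = Y.init d₀) :
    Y.HasUnfolding := by
  have := hY.1
  have := hY.2.1
  refine ⟨Y.unfold d₀ D h, ⟨inferInstanceAs (Finite (Option Y.V)),
    inferInstanceAs (Finite (Option Y.E)), hY.2.2⟩, fun v => ?_, unfoldHom h,
    Hom.isEssentialEquiv_iff.2 (unfoldHom_isFoldEquiv h), fun hiso => ?_⟩
  · have hmem : ∀ x v, Y.unfoldInit d₀ D x = v → x ∈ {x | (Y.unfold d₀ D h).init x = v} :=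
      fun x v hx => (init_unfold h x).trans hx
    have hsome : ∀ a : Y.Dart, a ∉ D → Y.unfoldInit d₀ D (some a.1, a.2) = some (Y.init a) := by
      intro a ha
      simp [unfoldInit, ha]
    have hinj : ∀ a a' : Y.Dart, a ≠ a' → ((some a.1, a.2) : Option Y.E × Bool) ≠ (some a'.1, a'.2) := by
      intro a a' h1 h2
      simp only [Prod.mk.injEq, Option.some.injEq] at h2
      exact h1 (Prod.ext h2.1 h2.2)
    unfold valence
    cases v with
    | none =>
      refine two_le_encard (hmem (some d.1, d.2) none ?_) (hmem (none, d₀.2) none ?_) ?_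
      · simp [unfoldInit, hd]
      · simp [unfoldInit]
      · exact fun h => Option.some_ne_none _ (congrArg Prod.fst h)
    | some v =>
      by_cases hv : v = Y.init d₀
      · subst hv
        refine two_le_encard (hmem _ _ (hsome d₀ h.notMem))
          (hmem _ _ ((hsome d' hd').trans (congrArg _ hinit))) (hinj _ _ hne.symm)
      · obtain ⟨a, b, ha, hb, hab⟩ := Set.one_lt_encard_iff.1 (lt_of_lt_of_le (by norm_num) (hval v))
        have hnot : ∀ a, Y.init a = v → a ∉ D := fun a ha haD =>
          hv (ha.symm.trans (h.init_eq a haD))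
        refine two_le_encard (hmem _ _ ((hsome a (hnot a ha)).trans (congrArg _ ha)))
          (hmem _ _ ((hsome b (hnot b hb)).trans (congrArg _ hb))) (hinj _ _ hab)
  · have h1 : (none : Option Y.V) = some (Y.init d₀) := hiso.1.1 rfl
    simp at h1

end Unfold

theorem hits_nonempty (hval : ∀ v, 2 ≤ Y.valence v) (hconn : ∀ v, Y.LinkConnected v) (d : Y.Dart) :
    (Y.hits d).Nonempty := by
  rw [← Set.encard_ne_zero]
  intro h0
  obtain ⟨d', h7, h8⟩ := exists_ne_of_two_le_encard (hval (Y.init d)) d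
  have hno : ∀ h : Y.CornerEnd, h.dart ≠ d := by
    intro h hh
    have : {h : Y.CornerEnd | h.dart = d}.encard = 0 := (encard_cornerEnd d).trans h0
    exact (Set.encard_eq_zero.1 this).subset hh
  have := iff_of_eqvGen (P := fun a => a = d) ?_ (hconn _ d d' rfl h7)
  · exact h8 (this.1 rfl)
  · intro a b hab
    obtain ⟨h, rfl, rfl⟩ := hab.exists_cornerEnd
    exact iff_of_false (hno _) (hno _)

/-- A visibly irreducible finite complex is tight. -/
theorem IsVisiblyIrreducible.isTight (hY : Y.IsFinite) (h : Y.IsVisiblyIrreducible) : Y.IsTight := by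
  obtain ⟨h1, h2⟩ := h
  unfold IsVisiblyReducible at h1
  push Not at h1
  obtain ⟨h3, h4, h5⟩ := h1
  have hval : ∀ v, 2 ≤ Y.valence v := fun v => Order.add_one_le_of_lt (h3 v)
  refine ⟨hval, h4, fun d₀ d d' hd hd' hne hne' => ?_, fun d => ?_⟩
  · by_contra hcon
    apply h2
    set r : Y.Dart → Y.Dart → Prop := fun a b => Y.LinkAdj a b ∧ a ≠ d₀ ∧ b ≠ d₀ with hr
    refine IsSide.hasUnfolding (d₀ := d₀) (D := {a | Relation.EqvGen r d a}) ⟨?_, ?_, ?_⟩ hY hval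
      (d := d) (Relation.EqvGen.refl d) hcon hne' hd'
    · intro a ha
      have := iff_of_eqvGen (P := fun a => Y.init a = Y.init d₀)
        (fun a b hab => by rw [hab.1.init_eq]) ha
      exact this.1 hd
    · intro h6
      exact (iff_of_eqvGen (P := fun a => a ≠ d₀)
        (fun a b hab => iff_of_true hab.2.1 hab.2.2) h6).1 hne rfl
    · intro a b hab ha hb
      exact ⟨fun h => .trans _ _ _ h (.rel _ _ ⟨hab, ha, hb⟩),
        fun h => .trans _ _ _ h (.symm _ _ (.rel _ _ ⟨hab, ha, hb⟩))⟩
  · have h6 : (Y.hits d).encard ≠ 0 := Set.encard_ne_zero.2 (hits_nonempty hval h4 d)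
    have h7 : 1 < (Y.hits d).encard :=
      lt_of_le_of_ne (Order.one_le_iff_pos.2 (pos_iff_ne_zero.2 h6)) (h5 d).symm
    exact Order.add_one_le_of_lt h7

end BranchedComplex

namespace BranchedComplex

open CombGraph

variable {X Y Z : BranchedComplex}

/-! ### Covers of the 1-skeleton with lifted faces -/

/-- The data of a complex over `X` whose 1-skeleton is a covering of the 1-skeleton of `X`: an action
of the fundamental group on the fibre `S` over the base vertex and, for each face, a point of the
fibre from which the path that leads to a face of `X` and `mult` times around this face lifts to
a closed path. The paths `tree` identify all fibres with `S`. -/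
structure CoverData {X : BranchedComplex} (M : X.Marking) where
  tree : X.V → FreeGroup X.E
  tree_mem : ∀ v, tree v ∈ X.pathClass M.base v
  S : Type
  act : MulAction M.Grp S
  F : Type
  face : F → X.F
  state : F → S
  mult : F → ℕ
  mult_pos : ∀ f, 0 < mult f
  fixed : ∀ f, M.word (face f) ^ mult f • state f = state f

namespace CoverData

attribute [instance] CoverData.act

variable {M : X.Marking} (D : CoverData M)

open Classical in
/-- The action of the fundamental group, extended by the identity to all words. -/
noncomputable def move (g : FreeGroup X.E) (s : D.S) : D.S :=
  if h : g ∈ X.pi1 M.base then (⟨g, h⟩ : M.Grp) • s else s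

theorem move_coe (g : M.Grp) (s : D.S) : D.move g.1 s = g • s := by
  rw [move, dif_pos g.2]

theorem move_mul {g h : FreeGroup X.E} (hg : g ∈ X.pi1 M.base) (hh : h ∈ X.pi1 M.base) (s : D.S) :
    D.move (g * h) s = D.move g (D.move h s) := by
  rw [move, move, move, dif_pos hg, dif_pos hh, dif_pos (mul_mem hg hh), ← mul_smul]
  rfl

theorem move_one (s : D.S) : D.move 1 s = s := by
  have := D.move_coe 1 s
  rwa [one_smul] at this

/-- The end point of the lift of a path class from `u` to `v` that starts at `(u, s)`. -/
noncomputable def trans (u v : X.V) (p : FreeGroup X.E) (s : D.S) : D.S :=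
  D.move (D.tree v * p⁻¹ * (D.tree u)⁻¹) s

theorem loop_mem {u v : X.V} {p : FreeGroup X.E} (hp : p ∈ X.pathClass u v) :
    D.tree v * p⁻¹ * (D.tree u)⁻¹ ∈ X.pi1 M.base :=
  mul_mem_pathClass (mul_mem_pathClass (D.tree_mem v) (inv_mem_pathClass hp))
    (inv_mem_pathClass (D.tree_mem u))

theorem trans_mul {u v w : X.V} {p q : FreeGroup X.E} (hp : p ∈ X.pathClass u v)
    (hq : q ∈ X.pathClass v w) (s : D.S) : D.trans v w q (D.trans u v p s) = D.trans u w (p * q) s := by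
  unfold trans
  rw [← D.move_mul (D.loop_mem hq) (D.loop_mem hp)]
  congr 1
  group

theorem trans_one (u : X.V) (s : D.S) : D.trans u u 1 s = s := by
  unfold trans
  rw [inv_one, mul_one, mul_inv_cancel, move_one]

/-- The end point of the lift of an oriented edge. -/
noncomputable def step (d : X.Dart) (s : D.S) : D.S :=
  D.trans (X.init d) (X.term d) (FreeGroup.mk [d]) s

theorem step_flip (d : X.Dart) (s : D.S) : D.step (X.flip d) (D.step d s) = s := by
  unfold step
  rw [CombGraph.init_flip, term_flip, D.trans_mul (dart_mem_pathClass d), mk_flip, mul_inv_cancel,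
    trans_one]
  have := dart_mem_pathClass (X.flip d)
  rwa [CombGraph.init_flip, term_flip] at this

/-- The covering graph. -/
noncomputable def graph : CombGraph where
  V := X.V × D.S
  E := X.E × D.S
  src e := (X.src e.1, e.2)
  tgt e := (X.tgt e.1, D.step (e.1, true) e.2)

/-- The lift of an oriented edge that starts at `s`. -/
noncomputable def lift (d : X.Dart) (s : D.S) : D.graph.Dart :=
  ((d.1, if d.2 then s else D.step d s), d.2)

theorem init_lift (d : X.Dart) (s : D.S) : D.graph.init (D.lift d s) = (X.init d, s) := by
  obtain ⟨e, b⟩ := d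
  cases b
  · exact Prod.ext rfl (D.step_flip (e, false) s)
  · rfl

theorem flip_lift (d : X.Dart) (s : D.S) :
    D.graph.flip (D.lift d s) = D.lift (X.flip d) (D.step d s) := by
  obtain ⟨e, b⟩ := d
  cases b
  · rfl
  · exact congrArg (fun s => (((e, s), false) : D.graph.Dart)) (D.step_flip (e, true) s).symm

theorem term_lift (d : X.Dart) (s : D.S) : D.graph.term (D.lift d s) = (X.term d, D.step d s) := by
  unfold CombGraph.term
  rw [flip_lift, init_lift]

/-- The projection of oriented edges. -/
def proj (x : D.graph.Dart) : X.Dart := (x.1.1, x.2)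

theorem lift_proj (x : D.graph.Dart) : D.lift (D.proj x) (D.graph.init x).2 = x := by
  obtain ⟨⟨e, s⟩, b⟩ := x
  cases b
  · exact congrArg (fun s => (((e, s), false) : D.graph.Dart)) (D.step_flip (e, true) s)
  · rfl

theorem init_proj (x : D.graph.Dart) : X.init (D.proj x) = (D.graph.init x).1 := by
  obtain ⟨⟨e, s⟩, b⟩ := x
  cases b <;> rfl

/-- The class of the path of the marking that leads to the corner `i` of a face. -/
def pathTo (M : X.Marking) (f : X.F) (i : ℤ) : FreeGroup X.E :=
  FreeGroup.mk (M.path f) * X.bdPath f i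

theorem pathTo_mem (M : X.Marking) (f : X.F) (i : ℤ) :
    pathTo M f i ∈ X.pathClass M.base (X.init (X.bd f i)) :=
  mul_mem_pathClass (M.isWalk_path f).mem (bdPath_mem f i)

theorem coe_word (M : X.Marking) (f : X.F) : (M.word f : FreeGroup X.E) =
    FreeGroup.mk (M.path f) * X.bdLoop f * (FreeGroup.mk (M.path f))⁻¹ := by
  rw [bdLoop_eq, FreeGroup.inv_mk, FreeGroup.mul_mk, FreeGroup.mul_mk]
  rfl

theorem coe_word_zpow (M : X.Marking) (f : X.F) (n : ℤ) : ((M.word f ^ n : M.Grp) : FreeGroup X.E) =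
    FreeGroup.mk (M.path f) * X.bdLoop f ^ n * (FreeGroup.mk (M.path f))⁻¹ := by
  rw [SubgroupClass.coe_zpow, coe_word, conj_zpow]

theorem pathTo_add (M : X.Marking) (f : X.F) (k i : ℤ) :
    pathTo M f (k * X.len f + i) = (M.word f ^ k : M.Grp) * pathTo M f i := by
  unfold pathTo
  rw [coe_word_zpow, bdPath_mul_len_add]
  group

/-- The point of the fibre at the corner `i` of a lifted face. -/
noncomputable def corner (f : D.F) (i : ℤ) : D.S :=
  D.move (D.tree (X.init (X.bd (D.face f) i)) * (pathTo M (D.face f) i)⁻¹) (D.state f)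

theorem corner_mem (f : X.F) (i : ℤ) :
    D.tree (X.init (X.bd f i)) * (pathTo M f i)⁻¹ ∈ X.pi1 M.base :=
  mul_mem_pathClass (D.tree_mem _) (inv_mem_pathClass (pathTo_mem M f i))

theorem step_corner (f : D.F) (i : ℤ) :
    D.step (X.bd (D.face f) i) (D.corner f i) = D.corner f (i + 1) := by
  unfold step trans corner
  rw [← D.move_mul (D.loop_mem (dart_mem_pathClass _)) (D.corner_mem _ _), X.bd_path]
  congr 1
  unfold pathTo
  rw [bdPath_succ]
  group

theorem corner_add (f : D.F) (k i : ℤ) : D.corner f (k * X.len (D.face f) + i) =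
    D.move (D.tree (X.init (X.bd (D.face f) i)) * (pathTo M (D.face f) i)⁻¹)
      (M.word (D.face f) ^ (-k) • D.state f) := by
  unfold corner
  rw [add_comm, bd_add_mul, add_comm, pathTo_add, ← move_coe, ← D.move_mul (D.corner_mem _ _) (Subtype.prop _)]
  congr 1
  rw [zpow_neg, InvMemClass.coe_inv]
  group

theorem corner_periodic (f : D.F) (i : ℤ) :
    D.corner f (i + (D.mult f * X.len (D.face f) : ℕ)) = D.corner f i := by
  rw [add_comm]
  push_cast
  rw [corner_add, zpow_neg, zpow_natCast]
  nth_rewrite 1 [← D.fixed f]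
  rw [inv_smul_smul]
  rfl

/-- The covering graph together with the lifted faces. -/
noncomputable def complex : BranchedComplex where
  toCombGraph := D.graph
  F := D.F
  len f := D.mult f * X.len (D.face f)
  len_pos f := Nat.mul_pos (D.mult_pos f) (X.len_pos _)
  bd f i := D.lift (X.bd (D.face f) i) (D.corner f i)
  bd_periodic f i := by
    rw [corner_periodic, Nat.cast_mul, bd_add_mul]
  bd_path f i := by
    rw [term_lift, init_lift, step_corner, X.bd_path]
  bd_immersed f i h := X.bd_immersed (D.face f) i (congrArg D.proj h)
  area f := D.mult f * X.area (D.face f)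
  area_pos f := Nat.mul_pos (D.mult_pos f) (X.area_pos _)

/-- The projection. -/
noncomputable def hom : Hom D.complex X where
  vert v := v.1
  dart := D.proj
  init_dart := D.init_proj
  dart_flip _ := rfl
  face := D.face
  mult := D.mult
  mult_pos := D.mult_pos
  rev _ := false
  shift _ := 0
  len_eq _ := rfl
  area_eq _ := rfl
  dart_bd f i := by
    rw [zero_add]
    rfl

theorem isGraphImmersion_hom : D.hom.IsGraphImmersion := by
  intro d d' h h'
  rw [← D.lift_proj d, ← D.lift_proj d']
  have h1 : D.graph.init d = D.graph.init d' := h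
  have h2 : D.proj d = D.proj d' := h'
  rw [h1, h2]

theorem exists_lift {u v : X.V} {p : FreeGroup X.E} (hp : p ∈ X.pathClass u v) (s : D.S) :
    ∃ q ∈ D.complex.pathClass (u, s) (v, D.trans u v p s), D.hom.edgeMap q = p := by
  revert s
  refine pathClass_induction (P := fun u v p => ∀ s, ∃ q ∈ D.complex.pathClass (u, s)
    (v, D.trans u v p s), D.hom.edgeMap q = p) (fun u s => ?_) (fun d v p hp ih s => ?_) hp
  · refine ⟨1, ?_, _root_.map_one _⟩
    rw [trans_one]
    exact one_mem_pathClass _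
  · obtain ⟨q, hq, h⟩ := ih (D.step d s)
    obtain ⟨x, hx, hx', hx''⟩ : ∃ x : D.complex.Dart, D.complex.init x = (X.init d, s) ∧
        D.complex.term x = (X.term d, D.step d s) ∧ D.hom.dart x = d :=
      ⟨D.lift d s, D.init_lift d s, D.term_lift d s, rfl⟩
    refine ⟨FreeGroup.mk [x] * q, ?_, ?_⟩
    · have h1 := dart_mem_pathClass x
      rw [hx, hx'] at h1
      have h2 := mul_mem_pathClass h1 hq
      unfold step at h2
      rwa [D.trans_mul (dart_mem_pathClass d) hp] at h2
    · rw [_root_.map_mul, h, Hom.edgeMap_dart, hx'']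

theorem trans_of_mem {x y : D.complex.V} {q : FreeGroup D.complex.E}
    (hq : q ∈ D.complex.pathClass x y) : D.trans x.1 y.1 (D.hom.edgeMap q) x.2 = y.2 := by
  obtain ⟨q', h1, h2⟩ := D.exists_lift (D.hom.edgeMap_mem hq) x.2
  have h3 := D.isGraphImmersion_hom.edgeMap_inj h1 hq h2
  rw [h3] at h1
  exact congrArg Prod.snd (pathClass_end_unique h1 hq)

theorem move_injective {g : FreeGroup X.E} (hg : g ∈ X.pi1 M.base) :
    Function.Injective (D.move g) := by
  intro s t h
  have := congrArg (D.move g⁻¹) h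
  rwa [← D.move_mul (inv_mem hg) hg, ← D.move_mul (inv_mem hg) hg, inv_mul_cancel, move_one,
    move_one] at this

/-- The projection is a branched immersion if no two faces bound the same lift and each face closes
up only after `mult` many turns. -/
theorem isBranchedImmersion_hom (h : ∀ f f' (n : ℤ), D.face f = D.face f' →
    M.word (D.face f) ^ n • D.state f = D.state f' → f' = f ∧ (D.mult f : ℤ) ∣ n) :
    D.hom.IsBranchedImmersion := by
  refine ⟨D.isGraphImmersion_hom, fun (f : D.F) i (f' : D.F) i' h1 h2 h3 => ?_⟩
  have h2 : D.face f = D.face f' := h2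
  have h3 : 0 + i ≡ 0 + i' [ZMOD X.len (D.face f)] := h3
  rw [zero_add, zero_add] at h3
  obtain ⟨n, hn⟩ := Int.modEq_iff_dvd.1 h3.symm
  obtain rfl : i = n * X.len (D.face f') + i' := by
    rw [← h2]
    linear_combination hn
  have h4 : D.corner f (n * X.len (D.face f') + i') = D.corner f' i' := by
    have h5 : (X.init (X.bd (D.face f) (n * X.len (D.face f') + i')),
        D.corner f (n * X.len (D.face f') + i')) =
        (X.init (X.bd (D.face f') i'), D.corner f' i') :=
      (D.init_lift _ _).symm.trans (h1.trans (D.init_lift _ _))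
    exact congrArg Prod.snd h5
  rw [← h2, D.corner_add] at h4
  have h6 : D.corner f' i' = D.move (D.tree (X.init (X.bd (D.face f) i')) *
      (pathTo M (D.face f) i')⁻¹) (D.state f') := by
    rw [h2]
    rfl
  rw [h6] at h4
  obtain ⟨rfl, k, hk⟩ := h f f' (-n) h2 (D.move_injective (D.corner_mem _ _) h4)
  refine ⟨rfl, Int.modEq_iff_dvd.2 ⟨k, ?_⟩⟩
  change _ = ((D.mult f' * X.len (D.face f') : ℕ) : ℤ) * k
  push_cast
  linear_combination (X.len (D.face f') : ℤ) * hk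

end CoverData

end BranchedComplex

namespace BranchedComplex

open CombGraph

variable {X X' Y Z : BranchedComplex}

/-! ### Transporting an immersion along a Nielsen equivalence -/

section Fibre

variable (ψ : Hom Z X) (M : X.Marking)

/-- Two path classes of `X` from images of vertices of `Z` to the base vertex are identified if they
differ by the image of a path class of `Z`. -/
def fibreSetoid : Setoid (Σ z : Z.V, {g // g ∈ X.pathClass (ψ.vert z) M.base}) where
  r a b := ∃ h ∈ Z.pathClass a.1 b.1, a.2.1 = ψ.edgeMap h * b.2.1
  iseqv :=
    { refl := fun a => ⟨1, one_mem_pathClass _, by simp⟩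
      symm := by
        rintro a b ⟨h, h1, h2⟩
        exact ⟨h⁻¹, inv_mem_pathClass h1, by simp [h2]⟩
      trans := by
        rintro a b c ⟨h, h1, h2⟩ ⟨k, h3, h4⟩
        exact ⟨h * k, mul_mem_pathClass h1 h3, by rw [h2, h4, _root_.map_mul, mul_assoc]⟩ }

/-- The fibre over the base vertex of the covering of the 1-skeleton of `X` in which the 1-skeleton
of `Z` embeds as a deformation retract. -/
def Fibre : Type := Quotient (fibreSetoid ψ M)

variable {ψ M}

/-- The point of the fibre given by a path class. -/
def Fibre.mk (z : Z.V) (g : FreeGroup X.E) (hg : g ∈ X.pathClass (ψ.vert z) M.base) : Fibre ψ M :=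
  Quotient.mk (fibreSetoid ψ M) ⟨z, g, hg⟩

theorem Fibre.mk_eq_iff {z z' : Z.V} {g g' : FreeGroup X.E}
    {hg : g ∈ X.pathClass (ψ.vert z) M.base} {hg' : g' ∈ X.pathClass (ψ.vert z') M.base} :
    Fibre.mk z g hg = Fibre.mk z' g' hg' ↔ ∃ h ∈ Z.pathClass z z', g = ψ.edgeMap h * g' :=
  Quotient.eq (r := fibreSetoid ψ M)

theorem Fibre.ind {P : Fibre ψ M → Prop} (h : ∀ z g hg, P (Fibre.mk z g hg)) (s : Fibre ψ M) : P s :=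
  Quotient.inductionOn s fun ⟨z, g, hg⟩ => h z g hg

noncomputable instance : MulAction M.Grp (Fibre ψ M) where
  smul k := Quotient.map (fun a => ⟨a.1, a.2.1 * (k.1)⁻¹,
      mul_mem_pathClass a.2.2 (inv_mem_pathClass k.2)⟩) (by
    rintro a b ⟨h, h1, h2⟩
    exact ⟨h, h1, by
      change a.2.1 * _ = _ * (b.2.1 * _)
      rw [h2, mul_assoc]⟩)
  one_smul s := by
    induction s using Fibre.ind with | _ z g hg
    exact Fibre.mk_eq_iff.2 ⟨1, one_mem_pathClass _, by simp⟩
  mul_smul k l s := by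
    induction s using Fibre.ind with | _ z g hg
    exact Fibre.mk_eq_iff.2 ⟨1, one_mem_pathClass _, by simp [mul_assoc]⟩

theorem Fibre.smul_mk (k : M.Grp) (z : Z.V) (g : FreeGroup X.E)
    (hg : g ∈ X.pathClass (ψ.vert z) M.base) : k • Fibre.mk z g hg =
      Fibre.mk z (g * (k : FreeGroup X.E)⁻¹) (mul_mem_pathClass hg (inv_mem_pathClass k.2)) := rfl

theorem Fibre.mk_congr {z : Z.V} {g g' : FreeGroup X.E} (h : g = g')
    (hg : g ∈ X.pathClass (ψ.vert z) M.base) (hg' : g' ∈ X.pathClass (ψ.vert z) M.base) :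
    Fibre.mk z g hg = Fibre.mk z g' hg' := by
  subst h
  rfl

theorem faceState_mem (f : Z.F) : (CoverData.pathTo M (ψ.face f) (ψ.shift f))⁻¹ ∈
    X.pathClass (ψ.vert (Z.init (Z.bd f 0))) M.base := by
  have h := inv_mem_pathClass (CoverData.pathTo_mem M (ψ.face f) (ψ.corner f 0))
  rw [ψ.init_bd_corner] at h
  rwa [ψ.corner_eq, mul_zero, add_zero] at h

variable (ψ M)

/-- The starting point of the lift of the boundary of a face of `X` which bounds the given face of
`Z`. -/
def faceState (f : Z.F) : Fibre ψ M := Fibre.mk _ _ (faceState_mem f)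

variable {ψ M}

theorem word_zpow_smul_faceState (f : Z.F) {n : ℤ} (h : (ψ.mult f : ℤ) ∣ n) :
    M.word (ψ.face f) ^ n • faceState ψ M f = faceState ψ M f := by
  obtain ⟨k, rfl⟩ := h
  refine Fibre.mk_eq_iff.2 ⟨Z.bdLoop f ^ (-ψ.sgn f * k), bdLoop_zpow_mem f _, ?_⟩
  rw [map_zpow, ψ.edgeMap_bdLoop, CoverData.coe_word_zpow]
  have e1 : ∀ a b : FreeGroup X.E, a⁻¹ * b * a = a⁻¹ * b * (a⁻¹)⁻¹ := fun a b => by group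
  rw [e1, conj_zpow, ← zpow_mul]
  have e2 : ψ.sgn f * ψ.mult f * (-ψ.sgn f * k) = -(ψ.mult f * k) := by
    have := ψ.sgn_mul_self f
    linear_combination (-(ψ.mult f : ℤ) * k) * this
  rw [e2]
  unfold CoverData.pathTo
  group

/-- If `ψ` is a branched immersion, then different faces of `Z` have different lifts, and each
lift closes up only after `mult` many turns. -/
theorem Hom.IsBranchedImmersion.eq_of_faceState (hψ : ψ.IsBranchedImmersion) {f f' : Z.F} {n : ℤ}
    (hf : ψ.face f = ψ.face f')
    (h : M.word (ψ.face f) ^ n • faceState ψ M f = faceState ψ M f') :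
    f' = f ∧ (ψ.mult f : ℤ) ∣ n := by
  obtain ⟨p, h1, h2⟩ := Fibre.mk_eq_iff.1 h
  replace h2 : (CoverData.pathTo M (ψ.face f) (ψ.shift f))⁻¹ *
      ((M.word (ψ.face f) ^ n : M.Grp) : FreeGroup X.E)⁻¹ =
        ψ.edgeMap p * (CoverData.pathTo M (ψ.face f') (ψ.shift f'))⁻¹ := h2
  rw [← hf] at h2
  have h3 : ψ.edgeMap p = (X.bdPath (ψ.face f) (ψ.shift f))⁻¹ *
      X.bdPath (ψ.face f) (-n * X.len (ψ.face f) + ψ.shift f') := by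
    rw [← mul_inv_eq_iff_eq_mul] at h2
    rw [← h2, CoverData.coe_word_zpow, bdPath_mul_len_add]
    unfold CoverData.pathTo
    group
  set i : ℤ := ψ.sgn f * (-n * X.len (ψ.face f) + ψ.shift f' - ψ.shift f) with hi
  have h4 : ψ.corner f i = -n * X.len (ψ.face f) + ψ.shift f' := by
    rw [ψ.corner_eq, hi, ← mul_assoc, ψ.sgn_mul_self]
    ring
  have h5 := ψ.edgeMap_bdPath f i
  rw [h4, ψ.corner_eq, mul_zero, add_zero, ← h3] at h5
  have h6 := hψ.isGraphImmersion.edgeMap_inj (bdPath_mem f i) h1 h5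
  have h7 : Z.init (Z.bd f i) = Z.init (Z.bd f' 0) := by
    have := bdPath_mem f i
    rw [h6] at this
    exact pathClass_end_unique this h1
  obtain ⟨rfl, h8⟩ := hψ.2 f' 0 f i h7.symm hf.symm (by
    rw [h4, ψ.corner_eq, mul_zero, add_zero, ← hf]
    exact (Int.modEq_iff_dvd).2 ⟨-n, by ring⟩)
  refine ⟨rfl, ?_⟩
  obtain ⟨k, hk⟩ := Int.modEq_iff_dvd.1 h8
  rw [ψ.len_eq] at hk
  have hl : (X.len (ψ.face f') : ℤ) ≠ 0 := by exact_mod_cast (X.len_pos _).ne'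
  refine ⟨-ψ.sgn f' * k, mul_right_cancel₀ hl ?_⟩
  rw [hi] at hk
  push_cast at hk
  have := ψ.sgn_mul_self f'
  linear_combination (-ψ.sgn f') * hk + (-n * X.len (ψ.face f')) * this

end Fibre

/-- An isomorphism of the branched group pairs of two marked complexes. -/
structure GroupPairIso (M : X.Marking) (M' : X'.Marking) where
  grp : M.Grp ≃* M'.Grp
  cosets : M.Cosets ≃ M'.Cosets
  smul : ∀ g a, cosets (g • a) = grp g • cosets a
  area : ∀ a, M'.cosetArea (cosets a) = M.cosetArea a

theorem Marking.word_zpow_injective (M : X.Marking) (f : X.F) :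
    Function.Injective fun n : ℤ => M.word f ^ n := by
  intro m n h
  have h1 := congrArg Subtype.val h
  simp only [CoverData.coe_word_zpow] at h1
  exact bdLoop_zpow_injective f (mul_left_cancel (mul_right_cancel h1))

/-- The coset of the neutral element. -/
def Marking.coset (M : X.Marking) (f : X.F) : M.Cosets := ⟨f, ((1 : M.Grp) : M.Grp ⧸ _)⟩

theorem Marking.exists_coset (M : X.Marking) (a : M.Cosets) : ∃ f, ∃ g : M.Grp, a = g • M.coset f := by
  obtain ⟨f, q⟩ := a
  obtain ⟨g, rfl⟩ := QuotientGroup.mk_surjective q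
  refine ⟨f, g, ?_⟩
  change (⟨f, (g : M.Grp ⧸ _)⟩ : M.Cosets) = ⟨f, ((g * 1 : M.Grp) : M.Grp ⧸ _)⟩
  rw [mul_one]

theorem Marking.smul_coset_eq_iff (M : X.Marking) {f f' : X.F} {g g' : M.Grp} :
    g • M.coset f = g' • M.coset f' ↔ f = f' ∧ ∃ n : ℤ, g' = g * M.word f ^ n := by
  have e : ∀ f (g : M.Grp), g • M.coset f = ⟨f, (g : M.Grp ⧸ _)⟩ := by
    intro f g
    change (⟨f, ((g * 1 : M.Grp) : M.Grp ⧸ _)⟩ : M.Cosets) = _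
    rw [mul_one]
  rw [e, e]
  constructor
  · intro h
    obtain rfl : f = f' := congrArg Sigma.fst h
    refine ⟨rfl, ?_⟩
    have h1 := eq_of_heq (Sigma.mk.inj h).2
    obtain ⟨n, hn⟩ := QuotientGroup.eq.1 h1
    exact ⟨n, by
      have hn : M.word f ^ n = g⁻¹ * g' := hn
      rw [hn, mul_inv_cancel_left]⟩
  · rintro ⟨rfl, n, rfl⟩
    congr 1
    exact QuotientGroup.eq.2 ⟨n, by simp⟩

namespace GroupPairIso

variable {M : X.Marking} {M' : X'.Marking} (I : GroupPairIso M M')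

theorem exists_face (f : X.F) : ∃ f', ∃ k : M'.Grp, I.cosets (M.coset f) = k • M'.coset f' :=
  M'.exists_coset _

/-- The face of `X'` that corresponds to a face of `X`. -/
noncomputable def face (f : X.F) : X'.F := (I.exists_face f).choose

/-- The element that conjugates the boundary words of corresponding faces, up to orientation. -/
noncomputable def conj (f : X.F) : M'.Grp := (I.exists_face f).choose_spec.choose

theorem cosets_coset (f : X.F) : I.cosets (M.coset f) = I.conj f • M'.coset (I.face f) :=
  (I.exists_face f).choose_spec.choose_spec

theorem face_injective {f f' : X.F} (h : I.face f = I.face f') : f = f' := by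
  have h1 : I.cosets (I.grp.symm (I.conj f' * (I.conj f)⁻¹) • M.coset f) =
      I.cosets ((1 : M.Grp) • M.coset f') := by
    rw [I.smul, I.smul, I.grp.apply_symm_apply, I.cosets_coset, I.cosets_coset, h, smul_smul,
      inv_mul_cancel_right, _root_.map_one, one_smul]
  exact (M.smul_coset_eq_iff.1 (I.cosets.injective h1)).1

theorem area_face (f : X.F) : X'.area (I.face f) = X.area f := by
  have := I.area (M.coset f)
  rw [I.cosets_coset] at this
  exact this

/-- The boundary word of a face is mapped to a generator of an infinite cyclic subgroup that is conjugate
to the one generated by the corresponding word, and so the two are conjugate up to inversion. -/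
theorem grp_word (f : X.F) : ∃ ε : ℤ, ε * ε = 1 ∧
    I.grp (M.word f) = I.conj f * M'.word (I.face f) ^ ε * (I.conj f)⁻¹ := by
  have h1 : ∃ n : ℤ, I.grp (M.word f) = I.conj f * M'.word (I.face f) ^ n * (I.conj f)⁻¹ := by
    have h : (1 : M.Grp) • M.coset f = M.word f • M.coset f :=
      M.smul_coset_eq_iff.2 ⟨rfl, 1, by simp⟩
    have h' := congrArg I.cosets h
    rw [I.smul, I.smul, I.cosets_coset, _root_.map_one, smul_smul, smul_smul, one_mul] at h'
    obtain ⟨-, n, hn⟩ := M'.smul_coset_eq_iff.1 h'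
    exact ⟨n, eq_mul_inv_of_mul_eq hn⟩
  have h2 : ∃ n : ℤ, I.grp (M.word f) ^ n = I.conj f * M'.word (I.face f) * (I.conj f)⁻¹ := by
    have h : I.cosets ((1 : M.Grp) • M.coset f) =
        I.cosets (I.grp.symm (I.conj f * M'.word (I.face f) * (I.conj f)⁻¹) • M.coset f) := by
      rw [I.smul, I.smul, I.cosets_coset, I.grp.apply_symm_apply, smul_smul, smul_smul]
      exact M'.smul_coset_eq_iff.2 ⟨rfl, 1, by simp⟩
    obtain ⟨-, n, hn⟩ := M.smul_coset_eq_iff.1 (I.cosets.injective h)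
    refine ⟨n, ?_⟩
    rw [one_mul] at hn
    rw [← map_zpow, ← hn, I.grp.apply_symm_apply]
  obtain ⟨n, hn⟩ := h1
  obtain ⟨m, hm⟩ := h2
  rw [hn, conj_zpow, ← zpow_mul] at hm
  have h3 := mul_left_cancel (mul_right_cancel hm)
  have h4 : n * m = 1 := M'.word_zpow_injective (I.face f) (h3.trans (zpow_one _).symm)
  refine ⟨n, ?_, hn⟩
  rcases Int.eq_one_or_neg_one_of_mul_eq_one h4 with rfl | rfl <;> rfl

theorem grp_word_zpow (f : X.F) : ∃ ε : ℤ, ε * ε = 1 ∧ ∀ n : ℤ,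
    I.grp (M.word f ^ (ε * n)) = I.conj f * M'.word (I.face f) ^ n * (I.conj f)⁻¹ := by
  obtain ⟨ε, hε, h⟩ := I.grp_word f
  refine ⟨ε, hε, fun n => ?_⟩
  rw [map_zpow, h, conj_zpow, ← zpow_mul, ← mul_assoc, hε, one_mul]

/-- The action of the fundamental group of `X'` on the fibre. -/
noncomputable abbrev fibreAct (ψ : Hom Z X) : MulAction M'.Grp (Fibre ψ M) :=
  MulAction.compHom _ I.grp.symm.toMonoidHom

/-- The boundaries of corresponding faces act on the fibre in the same way, up to inversion and
conjugation. -/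
theorem symm_word_zpow_smul {ψ : Hom Z X} (f : X.F) : ∃ ε : ℤ, ε * ε = 1 ∧
    ∀ (n : ℤ) (s : Fibre ψ M), I.grp.symm (M'.word (I.face f) ^ n) • I.grp.symm (I.conj f)⁻¹ • s =
      I.grp.symm (I.conj f)⁻¹ • M.word f ^ (ε * n) • s := by
  obtain ⟨ε, hε, h⟩ := I.grp_word_zpow f
  refine ⟨ε, hε, fun n s => ?_⟩
  rw [smul_smul, smul_smul, ← _root_.map_mul]
  congr 1
  rw [MulEquiv.symm_apply_eq, _root_.map_mul, h, MulEquiv.apply_symm_apply, mul_assoc,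
    inv_mul_cancel_left]

open Classical in
/-- A path from the base vertex to `v`, which is constant if `v` is the base vertex. -/
noncomputable def _root_.BranchedComplex.IsConnected.tree (h : X.IsConnected) (b v : X.V) :
    FreeGroup X.E :=
  if v = b then 1 else (joined_iff.1 (h.2 b v)).choose

theorem _root_.BranchedComplex.IsConnected.tree_mem (h : X.IsConnected) (b v : X.V) :
    h.tree b v ∈ X.pathClass b v := by
  unfold IsConnected.tree
  split_ifs with hv
  · rw [hv]
    exact one_mem_pathClass b
  · exact (joined_iff.1 (h.2 b v)).choose_spec

theorem _root_.BranchedComplex.IsConnected.tree_self (h : X.IsConnected) (b : X.V) :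
    h.tree b b = 1 := if_pos rfl

/-- The covering of `X'` that corresponds to the covering of `X` defined by `ψ`, with a face for each
face of `Z`. -/
noncomputable def coverData (hX' : X'.IsConnected) (ψ : Hom Z X) : CoverData M' where
  tree := hX'.tree M'.base
  tree_mem := hX'.tree_mem M'.base
  S := Fibre ψ M
  act := I.fibreAct ψ
  F := Z.F
  face f := I.face (ψ.face f)
  state f := I.grp.symm (I.conj (ψ.face f))⁻¹ • faceState ψ M f
  mult := ψ.mult
  mult_pos := ψ.mult_pos
  fixed f := by
    obtain ⟨ε, hε, h⟩ := I.symm_word_zpow_smul (ψ := ψ) (ψ.face f)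
    have h1 := h (ψ.mult f) (faceState ψ M f)
    rw [word_zpow_smul_faceState f ⟨ε, mul_comm _ _⟩, zpow_natCast] at h1
    exact h1

theorem coverData_symm_smul (hX' : X'.IsConnected) {ψ : Hom Z X} (k : M'.Grp)
    (s : Fibre ψ M) :
    (I.coverData hX' ψ).trans M'.base M'.base k s = (I.grp.symm k⁻¹ • s : Fibre ψ M) := by
  unfold CoverData.trans
  have h : (I.coverData hX' ψ).tree M'.base = 1 := hX'.tree_self _
  rw [h, inv_one, mul_one, one_mul]
  exact (I.coverData hX' ψ).move_coe k⁻¹ s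

theorem isBranchedImmersion_coverData (hX' : X'.IsConnected) {ψ : Hom Z X}
    (hψ : ψ.IsBranchedImmersion) : (I.coverData hX' ψ).hom.IsBranchedImmersion := by
  refine (I.coverData hX' ψ).isBranchedImmersion_hom fun f f' n h1 h2 => ?_
  replace h1 := I.face_injective h1
  obtain ⟨ε, hε, h⟩ := I.symm_word_zpow_smul (ψ := ψ) (ψ.face f)
  have h3 := h n (faceState ψ M f)
  have h4 : I.grp.symm (M'.word (I.face (ψ.face f)) ^ n) • I.grp.symm (I.conj (ψ.face f))⁻¹ •
    faceState ψ M f = I.grp.symm (I.conj (ψ.face f'))⁻¹ • faceState ψ M f' := h2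
  rw [h3, ← h1] at h4
  obtain ⟨h5, k, hk⟩ := hψ.eq_of_faceState h1 (smul_left_cancel _ h4)
  refine ⟨h5, ε * k, ?_⟩
  change n = ψ.mult f * (ε * k)
  linear_combination ε * hk - n * hε

/-- The complex over `X'` is path equivalent to the given complex over `X`. -/
theorem nonempty_pathEquiv_coverData (hX : X.IsConnected) (hX' : X'.IsConnected) {ψ : Hom Z X}
    (hψ : ψ.IsBranchedImmersion) : Nonempty (PathEquiv Z (I.coverData hX' ψ).complex) := by
  let D := I.coverData hX' ψ
  have hinj := D.isGraphImmersion_hom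
  let g : Z.V → FreeGroup X.E := fun z => (hX.tree M.base (ψ.vert z))⁻¹
  have hg : ∀ z, g z ∈ X.pathClass (ψ.vert z) M.base := fun z =>
    inv_mem_pathClass (hX.tree_mem M.base (ψ.vert z))
  let vert : Z.V → D.complex.V := fun z => (M'.base, Fibre.mk z (g z) (hg z))
  have mem : ∀ {z₁ z₂ h}, h ∈ Z.pathClass z₁ z₂ →
      (g z₁)⁻¹ * ψ.edgeMap h * g z₂ ∈ X.pi1 M.base := fun {z₁ z₂ h} hh =>
    mul_mem_pathClass (mul_mem_pathClass (inv_mem_pathClass (hg z₁)) (ψ.edgeMap_mem hh)) (hg z₂)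
  -- a path from the point over `z` moves the right factor of the class
  have lift : ∀ z (k : M.Grp) (hk : g z * k ∈ X.pathClass (ψ.vert z) M.base),
      ∃ q ∈ D.complex.pathClass (vert z) (M'.base, Fibre.mk z (g z * k) hk),
        D.hom.edgeMap q = I.grp k := by
    intro z k hk
    obtain ⟨q, h1, h2⟩ := D.exists_lift (mem_pi1.1 (I.grp k).2) (Fibre.mk z (g z) (hg z))
    refine ⟨q, ?_, h2⟩
    rw [I.coverData_symm_smul hX', map_inv, I.grp.symm_apply_apply, Fibre.smul_mk] at h1
    exact (congrArg (fun s => q ∈ D.complex.pathClass (vert z) (M'.base, s))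
      (Fibre.mk_congr (by simp) _ hk)).mp h1
  have ex : ∀ z₁ z₂ h (hh : h ∈ Z.pathClass z₁ z₂), ∃ q, q ∈ D.complex.pathClass (vert z₁) (vert z₂) ∧
      D.hom.edgeMap q = I.grp ⟨_, mem hh⟩ := by
    intro z₁ z₂ h hh
    obtain ⟨q, h1, h2⟩ := lift z₁ ⟨_, mem hh⟩ (mul_mem_pathClass (hg z₁) (mem hh))
    refine ⟨q, ?_, h2⟩
    have h3 : Fibre.mk z₁ (g z₁ * ((g z₁)⁻¹ * ψ.edgeMap h * g z₂))
        (mul_mem_pathClass (hg z₁) (mem hh)) = Fibre.mk (M := M) z₂ (g z₂) (hg z₂) :=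
      Fibre.mk_eq_iff.2 ⟨h, hh, by group⟩
    rwa [h3] at h1
  choose! map hmap hmap' using ex
  have key : ∀ {z₁ z₂ h q}, (hh : h ∈ Z.pathClass z₁ z₂) →
      q ∈ D.complex.pathClass (vert z₁) (vert z₂) → D.hom.edgeMap q = I.grp ⟨_, mem hh⟩ →
      map z₁ z₂ h = q := fun {z₁ z₂ h q} hh hq h1 =>
    hinj.edgeMap_inj (hmap _ _ _ hh) hq ((hmap' _ _ _ hh).trans h1.symm)
  refine ⟨⟨vert, map, fun z₁ z₂ => ⟨fun h hh => hmap _ _ _ hh, ?_, ?_⟩, ?_, ?_, Equiv.refl _, ?_, ?_⟩⟩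
  · intro h hh h' hh' e
    have e1 := (hmap' _ _ _ hh).symm.trans ((congrArg D.hom.edgeMap e).trans (hmap' _ _ _ hh'))
    have e2 := congrArg Subtype.val (I.grp.injective (Subtype.ext e1))
    exact hψ.isGraphImmersion.edgeMap_inj hh hh' (mul_left_cancel (mul_right_cancel e2))
  · intro q hq
    have h1 := D.trans_of_mem hq
    obtain ⟨k, hk⟩ : ∃ k, I.grp k = ⟨D.hom.edgeMap q, D.hom.edgeMap_mem hq⟩ := I.grp.surjective _
    have h2 : D.hom.edgeMap q = I.grp k := by rw [hk]
    rw [h2] at h1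
    have h3 : (I.coverData hX' ψ).trans M'.base M'.base (I.grp k) (Fibre.mk z₁ (g z₁) (hg z₁)) =
      Fibre.mk z₂ (g z₂) (hg z₂) := h1
    rw [I.coverData_symm_smul hX', map_inv, I.grp.symm_apply_apply, Fibre.smul_mk] at h3
    obtain ⟨h, hh, e⟩ := Fibre.mk_eq_iff.1 h3
    refine ⟨h, hh, key hh hq ?_⟩
    rw [h2]
    congr 2
    refine Subtype.ext ?_
    change (k : FreeGroup X.E) = (g z₁)⁻¹ * ψ.edgeMap h * g z₂
    rw [mul_assoc, ← e]
    simp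
  · intro u v w h h' hh hh'
    refine key (mul_mem_pathClass hh hh') (mul_mem_pathClass (hmap _ _ _ hh) (hmap _ _ _ hh')) ?_
    rw [_root_.map_mul, hmap' _ _ _ hh, hmap' _ _ _ hh', ← Subgroup.coe_mul, ← _root_.map_mul]
    congr 2
    refine Subtype.ext ?_
    change _ = (g u)⁻¹ * ψ.edgeMap (h * h') * g w
    simp [mul_assoc]
  · rintro ⟨v, s⟩
    obtain ⟨q, hq, -⟩ := D.exists_lift (inv_mem_pathClass (hX'.tree_mem M'.base v)) s
    generalize D.trans v M'.base _ s = t at hq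
    induction t using Fibre.ind with | _ z k hk
    obtain ⟨q', hq', -⟩ := lift z ⟨(g z)⁻¹ * k, mul_mem_pathClass (inv_mem_pathClass (hg z)) hk⟩
      (by simpa using hk)
    refine ⟨z, (joined_of_mem hq').trans (CombGraph.Joined.symm ?_)⟩
    exact (congrArg (fun s => D.complex.Joined _ (M'.base, s))
      (Fibre.mk_congr (by simp) hk _)).mp (joined_of_mem hq)
  · intro f
    change ψ.mult f * X'.area (I.face (ψ.face f)) = Z.area f
    rw [I.area_face, ψ.area_eq]
  · intro f
    obtain ⟨ε, hε, hw⟩ := I.grp_word_zpow (ψ.face f)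
    let g₀ := (CoverData.pathTo M (ψ.face f) (ψ.shift f))⁻¹
    let a : M.Grp := ⟨(g (Z.init (Z.bd f 0)))⁻¹ * g₀,
      mul_mem_pathClass (inv_mem_pathClass (hg _)) (faceState_mem f)⟩
    have hk : g (Z.init (Z.bd f 0)) * (a * I.grp.symm (I.conj (ψ.face f)) : M.Grp) =
        g₀ * ((I.grp.symm (I.conj (ψ.face f))⁻¹ : M.Grp) : FreeGroup X.E)⁻¹ := by
      rw [Subgroup.coe_mul, map_inv]
      simp [a, mul_assoc]
    have hk' : g₀ * ((I.grp.symm (I.conj (ψ.face f))⁻¹ : M.Grp) : FreeGroup X.E)⁻¹ ∈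
        X.pathClass (ψ.vert (Z.init (Z.bd f 0))) M.base :=
      mul_mem_pathClass (faceState_mem f) (inv_mem_pathClass (Subtype.prop _))
    obtain ⟨q₁, h1, h2⟩ := lift _ (a * I.grp.symm (I.conj (ψ.face f))) (by rwa [hk])
    rw [_root_.map_mul, I.grp.apply_symm_apply] at h2
    obtain ⟨q₂, h3, h4⟩ := D.exists_lift (CoverData.pathTo_mem M' (I.face (ψ.face f)) 0) (D.state f)
    have h1' : q₁ ∈ D.complex.pathClass (vert (Z.init (Z.bd f 0))) (M'.base, D.state f) :=
      (congrArg (fun s => q₁ ∈ D.complex.pathClass (vert (Z.init (Z.bd f 0))) (M'.base, s))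
        (Fibre.mk_congr hk _ hk')).mp h1
    have h5 : D.trans M'.base (X'.init (X'.bd (I.face (ψ.face f)) 0))
        (CoverData.pathTo M' (I.face (ψ.face f)) 0) (D.state f) = D.corner f 0 := by
      unfold CoverData.trans
      have h : D.tree M'.base = 1 := hX'.tree_self _
      rw [h, inv_one, mul_one]
      rfl
    rw [h5] at h3
    have h3' : q₂ ∈ D.complex.pathClass (M'.base, D.state f)
        (D.complex.init (D.complex.bd f 0)) :=
      (congrArg (fun v => q₂ ∈ D.complex.pathClass (M'.base, D.state f) v)
        (D.init_lift _ _).symm).mp h3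
    have h6 := mul_mem_pathClass h1' h3'
    refine ⟨q₁ * q₂, h6, ε * ψ.sgn f, by
      have := ψ.sgn_mul_self f
      linear_combination (ψ.sgn f * ψ.sgn f) * hε + this, ?_⟩
    have h7 : D.hom.edgeMap (D.complex.bdLoop f) =
        X'.bdLoop (I.face (ψ.face f)) ^ (ψ.mult f : ℤ) := by
      have h := D.hom.edgeMap_bdLoop f
      have h8 : D.hom.sgn f = 1 := rfl
      have h9 : D.hom.shift f = 0 := rfl
      rw [h8, h9, bdPath_zero, one_mul, inv_one, one_mul, mul_one] at h
      exact h
    refine key (bdLoop_mem f) (mul_mem_pathClass (mul_mem_pathClass h6 (@bdLoop_zpow_mem D.complex f _))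
      (inv_mem_pathClass h6)) ?_
    have h8 : (⟨_, mem (bdLoop_mem f)⟩ : M.Grp) =
        a * M.word (ψ.face f) ^ (ε * (ε * ψ.sgn f * ψ.mult f)) * a⁻¹ := by
      refine Subtype.ext ?_
      have h9 : ε * (ε * ψ.sgn f * ψ.mult f) = ψ.sgn f * ψ.mult f := by
        linear_combination (ψ.sgn f * ψ.mult f) * hε
      rw [h9, Subgroup.coe_mul, Subgroup.coe_mul, CoverData.coe_word_zpow, InvMemClass.coe_inv]
      change (g (Z.init (Z.bd f 0)))⁻¹ * ψ.edgeMap (Z.bdLoop f) * g (Z.init (Z.bd f 0)) =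
        (g (Z.init (Z.bd f 0)))⁻¹ * g₀ * _ * ((g (Z.init (Z.bd f 0)))⁻¹ * g₀)⁻¹
      rw [ψ.edgeMap_bdLoop]
      simp only [g₀, CoverData.pathTo]
      group
    have hl : ∀ b : FreeGroup D.complex.E,
        D.hom.edgeMap b = X'.bdLoop (I.face (ψ.face f)) ^ (ψ.mult f : ℤ) →
        D.hom.edgeMap (q₁ * q₂ * b ^ (ε * ψ.sgn f) * (q₁ * q₂)⁻¹) = I.grp (a * M.word (ψ.face f) ^
          (ε * (ε * ψ.sgn f * ψ.mult f)) * a⁻¹) := by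
      intro b hb
      rw [_root_.map_mul, _root_.map_mul, _root_.map_mul, _root_.map_inv, _root_.map_mul, map_zpow,
        hb, h2, h4, ← zpow_mul, _root_.map_mul I.grp, _root_.map_mul I.grp, hw, map_inv I.grp]
      push_cast
      rw [← SubgroupClass.coe_zpow, CoverData.coe_word_zpow]
      simp only [CoverData.pathTo, bdPath_zero]
      have h9 : (ψ.mult f : ℤ) * (ε * ψ.sgn f) = ε * ψ.sgn f * ψ.mult f := by ring
      rw [h9]
      group
    exact (hl _ h7).trans (congrArg (fun k : M.Grp => (I.grp k : FreeGroup X'.E)) h8.symm)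

end GroupPairIso

end BranchedComplex

namespace CombGraph

variable {G : CombGraph}

/-! ### Finite cores -/

theorem eq_or_eq_flip {d d' : G.Dart} (h : d.1 = d'.1) : d = d' ∨ d = G.flip d' := by
  obtain ⟨e, b⟩ := d
  obtain ⟨e', b'⟩ := d'
  obtain rfl : e = e' := h
  cases b <;> cases b' <;> simp [CombGraph.flip]

/-- The classes of words in the given edges. -/
def edgeSpan (S : Set G.E) : Subgroup (FreeGroup G.E) := Subgroup.closure (FreeGroup.of '' S)

theorem mk_singleton_mem_edgeSpan {S : Set G.E} {d : G.Dart} (h : d.1 ∈ S) :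
    FreeGroup.mk [d] ∈ edgeSpan S := by
  have h1 : FreeGroup.of d.1 ∈ edgeSpan S := Subgroup.subset_closure ⟨_, h, rfl⟩
  obtain ⟨e, b⟩ := d
  cases b
  · exact inv_mem h1
  · exact h1

theorem mk_mem_edgeSpan {S : Set G.E} {l : List G.Dart} (h : ∀ d ∈ l, d.1 ∈ S) :
    FreeGroup.mk l ∈ edgeSpan S := by
  induction l with
  | nil => exact one_mem _
  | cons d l ih =>
    rw [mk_cons]
    exact mul_mem (mk_singleton_mem_edgeSpan (h d (by simp))) (ih fun d' h' => h d' (by simp [h']))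

/-- Reduction only deletes letters, and so the reduced word of an element of the subgroup generated by
a set of edges uses only these edges. -/
theorem mem_of_mk_mem_edgeSpan {S : Set G.E} {l : List G.Dart} (hl : FreeGroup.IsReduced l)
    (h : FreeGroup.mk l ∈ edgeSpan S) : ∀ d ∈ l, d.1 ∈ S := by
  classical
  have h1 : ∀ g ∈ edgeSpan S, ∃ m : List G.Dart, (∀ d ∈ m, d.1 ∈ S) ∧ FreeGroup.mk m = g := by
    intro g hg
    induction hg using Subgroup.closure_induction with
    | mem x hx =>
      obtain ⟨e, he, rfl⟩ := hx
      exact ⟨[(e, true)], by simpa using he, rfl⟩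
    | one => exact ⟨[], by simp, rfl⟩
    | mul x y _ _ h1 h2 =>
      obtain ⟨m, h3, rfl⟩ := h1
      obtain ⟨n, h4, rfl⟩ := h2
      exact ⟨m ++ n, fun d hd => (List.mem_append.1 hd).elim (h3 d) (h4 d), FreeGroup.mul_mk.symm⟩
    | inv x _ h1 =>
      obtain ⟨m, h3, rfl⟩ := h1
      refine ⟨FreeGroup.invRev m, fun d hd => ?_, FreeGroup.inv_mk.symm⟩
      simp only [FreeGroup.invRev, List.mem_reverse, List.mem_map] at hd
      obtain ⟨a, ha, rfl⟩ := hd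
      exact h3 a ha
  obtain ⟨m, h2, h3⟩ := h1 _ h
  have h4 : l = FreeGroup.reduce m := by
    rw [← hl.reduce_eq]
    exact (FreeGroup.reduce.sound h3).symm
  intro d hd
  rw [h4] at hd
  exact h2 d ((FreeGroup.Red.sublist FreeGroup.reduce.red).subset hd)

/-- The end points of the given edges. -/
def support (S : Set G.E) : Set G.V := {v | ∃ d : G.Dart, d.1 ∈ S ∧ G.init d = v}

theorem init_mem_support {S : Set G.E} {d : G.Dart} (h : d.1 ∈ S) : G.init d ∈ support S :=
  ⟨d, h, rfl⟩

end CombGraph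

namespace BranchedComplex

open CombGraph

variable {X Y Z C : BranchedComplex}

/-- The subcomplex formed by the given edges, their end points and all faces. -/
def restrict (C : BranchedComplex) (S : Set C.E) (hS : ∀ f i, (C.bd f i).1 ∈ S) :
    BranchedComplex where
  V := support S
  E := S
  src e := ⟨C.src e, (e, true), e.2, rfl⟩
  tgt e := ⟨C.tgt e, (e, false), e.2, rfl⟩
  F := C.F
  len := C.len
  len_pos := C.len_pos
  bd f i := (⟨(C.bd f i).1, hS f i⟩, (C.bd f i).2)
  bd_periodic f i := by simp only [C.bd_periodic]
  bd_path f i := by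
    have h := C.bd_path f i
    have h2 : ∀ d : C.Dart, ∀ hd : d.1 ∈ S, ∀ p,
      (CombGraph.init ⟨support S, S, fun e => ⟨C.src e, (e, true), e.2, rfl⟩,
        fun e => ⟨C.tgt e, (e, false), e.2, rfl⟩⟩ ((⟨d.1, p⟩ : S), d.2) : support S).1 =
        C.init d := by
      rintro ⟨e, b⟩ he p
      cases b <;> rfl
    exact Subtype.ext ((h2 (C.flip (C.bd f i)) (hS f i) (hS f i)).trans
      (h.trans (h2 _ (hS f (i + 1)) (hS f (i + 1))).symm))
  bd_immersed f i h := C.bd_immersed f i (congrArg (fun d => (d.1.1, d.2)) h)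
  area := C.area
  area_pos := C.area_pos

variable {S : Set C.E} {hS : ∀ f i, (C.bd f i).1 ∈ S}

/-- The inclusion of a subcomplex. -/
def restrictHom (hS : ∀ f i, (C.bd f i).1 ∈ S) : Hom (C.restrict S hS) C where
  vert := Subtype.val
  dart d := (d.1.1, d.2)
  init_dart := by
    rintro ⟨e, b⟩
    cases b <;> rfl
  dart_flip _ := rfl
  face := id
  mult _ := 1
  mult_pos _ := one_pos
  rev _ := false
  shift _ := 0
  len_eq _ := (one_mul _).symm
  area_eq _ := (one_mul _).symm
  dart_bd f i := by
    rw [zero_add]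
    rfl

theorem restrictHom_dart_injective : Function.Injective (restrictHom hS).dart := by
  rintro ⟨⟨e, he⟩, b⟩ ⟨⟨e', he'⟩, b'⟩ h
  obtain ⟨rfl, rfl⟩ := Prod.mk.inj h
  rfl

theorem restrictHom_isBranchedImmersion : (restrictHom hS).IsBranchedImmersion := by
  refine ⟨fun d d' _ h => restrictHom_dart_injective h, fun f i f' i' _ h h' => ⟨h, ?_⟩⟩
  have h'' : 0 + i ≡ 0 + i' [ZMOD C.len f] := h'
  rwa [zero_add, zero_add] at h''

theorem exists_walk_restrict {l : List C.Dart} (hl : ∀ d ∈ l, d.1 ∈ S)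
    (u v : (C.restrict S hS).V) (h : C.IsWalk u.1 l v.1) :
    ∃ m, (C.restrict S hS).IsWalk u m v ∧ m.map (restrictHom hS).dart = l := by
  induction l generalizing u with
  | nil => exact ⟨[], Subtype.ext h, rfl⟩
  | cons d l ih =>
    obtain ⟨x, rfl⟩ : ∃ x, (restrictHom hS).dart x = d := ⟨(⟨d.1, hl d (by simp)⟩, d.2), rfl⟩
    obtain ⟨m, h1, rfl⟩ := ih (fun d' h' => hl d' (List.mem_cons_of_mem _ h'))
      ((C.restrict S hS).term x) (by
        have h2 := h.2
        rw [Hom.term_dart] at h2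
        exact h2)
    exact ⟨x :: m, ⟨Subtype.ext (((restrictHom hS).init_dart x).symm.trans h.1), h1⟩, rfl⟩

/-- A set of edges that contains the boundaries of all faces, as well as all reduced edge paths
between its end points. -/
structure IsFull (C : BranchedComplex) (S : Set C.E) : Prop where
  bd_mem : ∀ f i, (C.bd f i).1 ∈ S
  mem : ∀ u ∈ support S, ∀ v ∈ support S, ∀ g ∈ C.pathClass u v, g ∈ edgeSpan S

theorem IsFull.isGraphEquiv (h : C.IsFull S) (hC : ∀ v, ∃ f, C.Joined (C.init (C.bd f 0)) v) :
    (restrictHom h.bd_mem).IsGraphEquiv := by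
  have lift : ∀ (u v : (C.restrict S h.bd_mem).V), ∀ g ∈ C.pathClass u.1 v.1,
      ∃ g' ∈ (C.restrict S h.bd_mem).pathClass u v, (restrictHom h.bd_mem).edgeMap g' = g := by
    intro u v g hg
    obtain ⟨l, h1, h2, rfl⟩ := exists_reduced hg
    obtain ⟨m, h3, rfl⟩ := exists_walk_restrict (hS := h.bd_mem)
      (mem_of_mk_mem_edgeSpan h2 (h.mem u.1 u.2 v.1 v.2 _ hg)) u v h1
    exact ⟨_, h3.mem, (restrictHom h.bd_mem).edgeMap_mk m⟩
  refine ⟨fun u v huv => ?_, fun v => ?_, fun v => ⟨?_, ?_, ?_⟩⟩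
  · obtain ⟨g, hg⟩ := joined_iff.1 huv
    obtain ⟨g', hg', -⟩ := lift u v g hg
    exact joined_of_mem hg'
  · obtain ⟨f, hf⟩ := hC v
    exact ⟨⟨_, init_mem_support (h.bd_mem f 0)⟩, hf⟩
  · exact fun g hg => (restrictHom h.bd_mem).edgeMap_mem hg
  · exact fun g hg g' hg' e =>
      restrictHom_isBranchedImmersion.isGraphImmersion.edgeMap_inj hg hg' e
  · exact fun g hg => lift v v g hg

/-- A vertex of valence at most 1 could be removed, together with its edge. -/
theorem IsFull.sdiff (h : C.IsFull S) {d₀ : C.Dart} (h₀ : d₀.1 ∈ S)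
    (hd : ∀ d : C.Dart, d.1 ∈ S → C.init d = C.init d₀ → d = d₀) : C.IsFull (S \ {d₀.1}) := by
  refine ⟨fun f i => ⟨h.bd_mem f i, fun hi => ?_⟩, fun u hu v hv g hg => ?_⟩
  · rcases eq_or_eq_flip hi with hi | hi
    · have h1 := C.bd_path f (i - 1)
      rw [sub_add_cancel, hi] at h1
      have h2 := hd (C.flip (C.bd f (i - 1))) (h.bd_mem f (i - 1)) h1
      have h3 := C.bd_immersed f (i - 1)
      rw [sub_add_cancel, h2] at h3
      exact h3 hi
    · have h1 := C.bd_path f i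
      rw [hi, term_flip] at h1
      have h2 := hd _ (h.bd_mem f (i + 1)) h1.symm
      have h3 := C.bd_immersed f i
      rw [hi, CombGraph.flip_flip] at h3
      exact h3 h2
  · have hne : ∀ w ∈ support (S \ {d₀.1}), w ≠ C.init d₀ := by
      rintro _ ⟨d, hd1, rfl⟩ h2
      exact hd1.2 (congrArg Prod.fst (hd d hd1.1 h2))
    have hsub : ∀ w ∈ support (S \ {d₀.1}), w ∈ support S := by
      rintro _ ⟨d, hd1, rfl⟩
      exact ⟨d, hd1.1, rfl⟩
    obtain ⟨l, h1, h2, rfl⟩ := exists_reduced hg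
    have h3 := mem_of_mk_mem_edgeSpan h2 (h.mem u (hsub u hu) v (hsub v hv) _ hg)
    refine mk_mem_edgeSpan fun d hdl => ⟨h3 d hdl, fun he => ?_⟩
    -- a reduced path between other vertices cannot turn around at the initial vertex of `d₀`
    obtain ⟨l₁, l₂, rfl⟩ := List.append_of_mem hdl
    obtain ⟨w, h4, h5⟩ := h1.split
    rcases eq_or_eq_flip he with rfl | rfl
    · rcases List.eq_nil_or_concat l₁ with rfl | ⟨l₁, a, rfl⟩
      · exact hne u hu (Eq.trans h4 h5.1.symm)
      · have h6 : a ∈ l₁.concat a ++ d :: l₂ := by simp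
        rw [List.concat_eq_append] at h4 h2 h6
        have h7 := (IsWalk.concat_iff.1 h4).2
        have h8 := hd (C.flip a) (h3 a (by simp)) (h7.trans h5.1.symm)
        rw [List.append_assoc] at h2
        have h9 := (List.isChain_append.1 h2).2.1
        have h10 := (List.isChain_cons_cons.1 h9).1
        exact reducedStep_iff.1 h10 h8.symm
    · cases l₂ with
      | nil =>
        have h6 : C.term (C.flip d₀) = v := h5.2
        rw [term_flip] at h6
        exact hne v hv h6.symm
      | cons a l₂ =>
        have h6 : C.init a = C.term (C.flip d₀) := h5.2.1
        rw [term_flip] at h6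
        have h8 := hd a (h3 a (by simp)) h6
        have h9 := (List.isChain_append.1 h2).2.1
        have h10 := (List.isChain_cons_cons.1 h9).1
        exact reducedStep_iff.1 h10 (by rw [h8, CombGraph.flip_flip])

theorem IsFull.exists_two_le_valence (hfin : S.Finite) (h : C.IsFull S) :
    ∃ (S' : Set C.E) (h' : C.IsFull S'), S'.Finite ∧
      ∀ v, 2 ≤ (C.restrict S' h'.bd_mem).valence v := by
  induction hn : S.ncard using Nat.strong_induction_on generalizing S with | _ n ih
  by_cases H : ∀ d₀ : C.Dart, d₀.1 ∈ S → ∃ d : C.Dart, d.1 ∈ S ∧ C.init d = C.init d₀ ∧ d ≠ d₀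
  · refine ⟨S, h, hfin, ?_⟩
    rintro ⟨_, d₀, h0, rfl⟩
    obtain ⟨d, h1, h2, h3⟩ := H d₀ h0
    have e : ∀ (d : C.Dart) (hd : d.1 ∈ S), C.init d = C.init d₀ →
        (C.restrict S h.bd_mem).init ((⟨d.1, hd⟩ : S), d.2) = (⟨C.init d₀, d₀, h0, rfl⟩ : support S) :=
      fun d hd hd' => Subtype.ext (((restrictHom h.bd_mem).init_dart _).symm.trans hd')
    exact two_le_encard (e d h1 h2) (e d₀ h0 rfl)
      fun h4 => h3 (congrArg (restrictHom h.bd_mem).dart h4)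
  · push Not at H
    obtain ⟨d₀, h0, hd⟩ := H
    exact ih _ (hn ▸ Set.ncard_sdiff_singleton_lt_of_mem h0 hfin) hfin.sdiff (h.sdiff h0 hd) rfl

namespace PathEquiv

/-- A vertex that can be reached by a path in the given edges from the image of a path equivalence. -/
def Reaches (Φ : PathEquiv Z C) (S : Set C.E) (v : C.V) : Prop :=
  ∃ z, ∃ g ∈ C.pathClass (Φ.vert z) v, g ∈ edgeSpan S

theorem Reaches.mul {Φ : PathEquiv Z C} {u v : C.V} (h : Φ.Reaches S u) {g : FreeGroup C.E}
    (hg : g ∈ C.pathClass u v) (hg' : g ∈ edgeSpan S) : Φ.Reaches S v := by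
  obtain ⟨z, k, h1, h2⟩ := h
  exact ⟨z, k * g, mul_mem_pathClass h1 hg, mul_mem h2 hg'⟩

theorem Reaches.of_walk {Φ : PathEquiv Z C} {u v : C.V} (h : Φ.Reaches S u) {l : List C.Dart}
    (hl : C.IsWalk u l v) (hS : ∀ d ∈ l, d.1 ∈ S) {d : C.Dart} (hd : ∃ d' ∈ l, d'.1 = d.1) :
    Φ.Reaches S (C.init d) := by
  induction l generalizing u with
  | nil => simp at hd
  | cons a l ih =>
    obtain ⟨rfl, h2⟩ := hl
    have h3 : Φ.Reaches S (C.term a) :=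
      h.mul (dart_mem_pathClass a) (mk_singleton_mem_edgeSpan (hS a (by simp)))
    obtain ⟨d', h4, h5⟩ := hd
    rcases List.mem_cons.1 h4 with rfl | h4
    · rcases eq_or_eq_flip h5.symm with rfl | rfl
      · exact h
      · exact h3
    · exact ih h3 h2 (fun b hb => hS b (List.mem_cons_of_mem _ hb)) ⟨d', h4, h5⟩

/-- The edges in the images of the edges of `Z` and in the boundaries of the faces, together with
finitely many paths that connect these boundaries to the image of `Z`, form a full set. -/
theorem exists_isFull (Φ : PathEquiv Z C) [Finite Z.E] [Finite Z.F] :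
    ∃ S : Set C.E, S.Finite ∧ C.IsFull S := by
  have hW : ∀ d : Z.Dart, ∃ l, C.IsWalk (Φ.vert (Z.init d)) l (Φ.vert (Z.term d)) ∧
      FreeGroup.mk l = Φ.map (Z.init d) (Z.term d) (FreeGroup.mk [d]) := fun d =>
    (Φ.bijOn _ _).mapsTo (dart_mem_pathClass d)
  have hQ : ∀ f : Z.F, ∃ l, C.IsWalk (Φ.vert (Z.init (Z.bd f 0))) l
      (C.init (C.bd (Φ.face f) 0)) := by
    intro f
    obtain ⟨q, ⟨l, hl, -⟩, -⟩ := Φ.bdMap f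
    exact ⟨l, hl⟩
  choose W hW hW' using hW
  choose Q hQ using hQ
  let B : Z.F → List C.Dart := fun f => C.bdList (Φ.face f) 0 (C.len (Φ.face f))
  let T : List C.Dart → Set C.E := fun l => {e | ∃ d ∈ l, d.1 = e}
  have hT : ∀ l, (T l).Finite := fun l => (l.finite_toSet.image Prod.fst)
  let S : Set C.E := (⋃ d, T (W d)) ∪ (⋃ f, T (Q f)) ∪ ⋃ f, T (B f)
  have hSW : ∀ z, ∀ d ∈ W z, d.1 ∈ S := fun z d hd =>
    Or.inl (Or.inl (Set.mem_iUnion.2 ⟨z, d, hd, rfl⟩))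
  have hSQ : ∀ f, ∀ d ∈ Q f, d.1 ∈ S := fun f d hd =>
    Or.inl (Or.inr (Set.mem_iUnion.2 ⟨f, d, hd, rfl⟩))
  have hSB : ∀ f, ∀ d ∈ B f, d.1 ∈ S := fun f d hd =>
    Or.inr (Set.mem_iUnion.2 ⟨f, d, hd, rfl⟩)
  have base : ∀ z, Φ.Reaches S (Φ.vert z) := fun z => ⟨z, 1, one_mem_pathClass _, one_mem _⟩
  have reach : ∀ v ∈ support S, Φ.Reaches S v := by
    rintro _ ⟨d, (hd | hd) | hd, rfl⟩
    · obtain ⟨z, hz⟩ := Set.mem_iUnion.1 hd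
      exact (base _).of_walk (hW z) (hSW z) hz
    · obtain ⟨f, hf⟩ := Set.mem_iUnion.1 hd
      exact (base _).of_walk (hQ f) (hSQ f) hf
    · obtain ⟨f, hf⟩ := Set.mem_iUnion.1 hd
      exact ((base _).mul (hQ f).mem (mk_mem_edgeSpan (hSQ f))).of_walk
        (isWalk_bdList (Φ.face f) 0 _) (hSB f) hf
  have span : ∀ {z z' : Z.V} {h}, h ∈ Z.pathClass z z' → Φ.map z z' h ∈ edgeSpan S := by
    intro z z' h hh
    refine pathClass_induction (P := fun z z' h => Φ.map z z' h ∈ edgeSpan S) (fun z => ?_)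
      (fun d z h hh ih => ?_) hh
    · rw [Φ.map_one]
      exact one_mem _
    · rw [Φ.map_mul (dart_mem_pathClass d) hh, ← hW']
      exact mul_mem (mk_mem_edgeSpan (hSW d)) ih
  refine ⟨S, ((Set.finite_iUnion fun _ => hT _).union (Set.finite_iUnion fun _ => hT _)).union
    (Set.finite_iUnion fun _ => hT _), ⟨fun f i => ?_, fun u hu v hv g hg => ?_⟩⟩
  · obtain ⟨f, rfl⟩ := Φ.face.surjective f
    have hl : (0 : ℤ) < C.len (Φ.face f) := by exact_mod_cast C.len_pos _
    refine hSB f _ (List.mem_map.2 ⟨(i % C.len (Φ.face f)).toNat, ?_, ?_⟩)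
    · have := Int.emod_lt_of_pos i hl
      rw [List.mem_range]
      omega
    · rw [Int.toNat_of_nonneg (Int.emod_nonneg _ hl.ne'), zero_add]
      exact bd_congr _ (Int.mod_modEq _ _)
  · obtain ⟨z, a, h1, h2⟩ := reach u hu
    obtain ⟨z', b, h3, h4⟩ := reach v hv
    obtain ⟨h, h5, h6⟩ := (Φ.bijOn z z').surjOn
      (mul_mem_pathClass (mul_mem_pathClass h1 hg) (inv_mem_pathClass h3))
    have h7 := span h5
    rw [h6] at h7
    have h8 := mul_mem (mul_mem (inv_mem h2) h7) h4
    simpa [mul_assoc] using h8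

/-- If `Z` is path equivalent to a complex that is immersed in `X`, then it is equivalent to a finite
complex without vertices of valence at most 1 that is immersed in `X`. -/
theorem exists_core (Φ : PathEquiv Z C) (hZ : Z.IsFinite)
    (hj : ∀ z, ∃ f, Z.Joined (Z.init (Z.bd f 0)) z) {ψ : Hom C X} (hψ : ψ.IsBranchedImmersion) :
    ∃ K : BranchedComplex, K.IsFinite ∧ (∀ v, 2 ≤ K.valence v) ∧ PairEquiv Z K ∧
      ∃ ψ' : Hom K X, ψ'.IsBranchedImmersion := by
  obtain ⟨h1, h2, h3⟩ := hZ
  obtain ⟨S, h4, h5⟩ := Φ.exists_isFull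
  obtain ⟨S, h, h6, h7⟩ := h5.exists_two_le_valence h4
  have hC : ∀ v, ∃ f, C.Joined (C.init (C.bd f 0)) v := by
    intro v
    obtain ⟨u, hu⟩ := Φ.essSurj v
    obtain ⟨f, hf⟩ := hj u
    obtain ⟨q, hq, -⟩ := Φ.bdMap f
    obtain ⟨g, hg⟩ := joined_iff.1 hf
    exact ⟨Φ.face f, (joined_of_mem hq).symm.trans
      ((joined_of_mem ((Φ.bijOn _ _).mapsTo hg)).trans hu)⟩
  have hE : Finite S := h6
  refine ⟨C.restrict S h.bd_mem, ⟨?_, hE, Finite.of_equiv _ Φ.face⟩, h7,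
    Φ.pairEquiv.trans (PathEquiv.pairEquiv ((restrictHom h.bd_mem).pathEquiv (h.isGraphEquiv hC)
      ⟨Function.bijective_id, fun _ => rfl⟩)).symm,
    (restrictHom h.bd_mem).comp ψ, restrictHom_isBranchedImmersion.comp hψ⟩
  exact Finite.of_surjective
    (fun d : S × Bool => (⟨_, init_mem_support (G := C.toCombGraph) (d := (d.1.1, d.2)) d.1.2⟩ :
      support S)) (by
    rintro ⟨_, d, hd, rfl⟩
    exact ⟨(⟨d.1, hd⟩, d.2), rfl⟩)

end PathEquiv

end BranchedComplex

namespace BranchedComplex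

open CombGraph

variable {X X' Y Z K : BranchedComplex}

/-! ### Maximal unfoldings -/

/-- A non-trivial fold identifies edges. -/
theorem Hom.IsFoldEquiv.card_lt {φ : Hom Y Z} (h : φ.IsFoldEquiv) (hY : Y.IsFinite)
    (hZ : Z.IsFinite) (hi : ¬ φ.IsIso) : Nat.card Z.E < Nat.card Y.E := by
  have hχ := h.pairEquiv.eulerChar_eq hY hZ
  obtain ⟨h1, h2, -⟩ := hY
  have hcard : ∀ W : BranchedComplex, Nat.card W.Dart = Nat.card W.E * 2 := fun W => by
    rw [Nat.card_prod, Nat.card_eq_fintype_card (α := Bool), Fintype.card_bool]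
  by_contra hlt
  have hle := Nat.card_le_card_of_surjective _ h.dart
  rw [hcard, hcard] at hle
  have hE : Nat.card Y.E = Nat.card Z.E := by omega
  unfold eulerChar at hχ
  have hV : Nat.card Y.V = Nat.card Z.V := by omega
  exact hi ⟨(Nat.bijective_iff_surjective_and_card _).2 ⟨h.vert, hV⟩,
    (Nat.bijective_iff_surjective_and_card _).2 ⟨h.dart, by rw [hcard, hcard, hE]⟩, h.faces.1,
    h.faces.2⟩

/-- The number of edges is bounded by the sum of the lengths of the faces if every edge is
traversed. -/
theorem card_edges_le [Finite Y.F] (h : ∀ d, (Y.hits d).Nonempty) :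
    Nat.card Y.E ≤ Nat.card (Σ f : Y.F, Fin (Y.len f)) := by
  choose p hp using fun e : Y.E => h (e, true)
  refine Nat.card_le_card_of_injective p fun e e' he => ?_
  have key : ∀ e, (Y.bd (p e).1 ((p e).2 : ℕ)).1 = e := by
    intro e
    rcases hp e with h | h <;> rw [h]
    rfl
  rw [← key e, ← key e', he]

theorem Hom.IsFoldEquiv.card_sides {φ : Hom Y Z} (h : φ.IsFoldEquiv) :
    Nat.card (Σ f : Y.F, Fin (Y.len f)) = Nat.card (Σ f : Z.F, Fin (Z.len f)) :=
  Nat.card_congr (Equiv.sigmaCongr (Equiv.ofBijective _ h.faces.1) fun f =>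
    finCongr (by rw [φ.len_eq, h.faces.2, one_mul]; rfl))

/-- A finite complex without vertices of valence at most 1 that is equivalent to a tight complex
becomes visibly irreducible after finitely many unfoldings: none of the unfolded complexes admits a
visible reduction, as this would split the group pair, and so the number of edges is bounded. -/
theorem exists_isVisiblyIrreducible (hY : Y.IsFinite) (ht : Y.IsTight) (hK : K.IsFinite)
    (hval : ∀ v, 2 ≤ K.valence v) (h : PairEquiv Y K) :
    ∃ W : BranchedComplex, W.IsFinite ∧ W.IsVisiblyIrreducible ∧
      ∃ φ : Hom W K, φ.IsFoldEquiv := by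
  have key : ∀ n (W : BranchedComplex) (φ : Hom W K), W.IsFinite → (∀ v, 2 ≤ W.valence v) →
      φ.IsFoldEquiv → Nat.card (Σ f : K.F, Fin (K.len f)) ≤ Nat.card W.E + n →
      ∃ W : BranchedComplex, W.IsFinite ∧ W.IsVisiblyIrreducible ∧
        ∃ φ : Hom W K, φ.IsFoldEquiv := by
    have hred : ∀ (W : BranchedComplex) (φ : Hom W K), W.IsFinite → (∀ v, 2 ≤ W.valence v) →
        φ.IsFoldEquiv → ¬ W.IsVisiblyReducible ∧
          Nat.card W.E ≤ Nat.card (Σ f : K.F, Fin (K.len f)) := by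
      intro W φ hW hv hφ
      have : Finite Y.V := hY.1
      have : Finite Y.E := hY.2.1
      have : Finite W.V := hW.1
      have : Finite W.F := hW.2.2
      have h1 : ¬ W.IsVisiblyReducible := fun hr => ht.not_hasWeakSplitting
        ((h.trans hφ.pairEquiv.symm).hasWeakSplitting (hr.hasWeakSplitting hv))
      refine ⟨h1, ?_⟩
      rw [← hφ.card_sides]
      refine card_edges_le (hits_nonempty hv fun v => ?_)
      by_contra hc
      exact h1 (Or.inr (Or.inl ⟨v, hc⟩))
    -- `n` bounds the number of edges that can still be added
    intro n
    induction n with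
    | zero =>
      intro W φ hW hv hφ hn
      refine ⟨W, hW, ⟨(hred W φ hW hv hφ).1, ?_⟩, φ, hφ⟩
      rintro ⟨W', hW', hv', φ', he, hi⟩
      rw [Hom.isEssentialEquiv_iff] at he
      have h1 := he.card_lt hW' hW hi
      have h2 := (hred W' _ hW' hv' (he.comp hφ)).2
      omega
    | succ n ih =>
      intro W φ hW hv hφ hn
      by_cases hu : W.HasUnfolding
      · obtain ⟨W', hW', hv', φ', he, hi⟩ := hu
        rw [Hom.isEssentialEquiv_iff] at he
        have h1 := he.card_lt hW' hW hi
        exact ih W' _ hW' hv' (he.comp hφ) (by omega)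
      · exact ⟨W, hW, ⟨(hred W φ hW hv hφ).1, hu⟩, φ, hφ⟩
  exact key _ K (Hom.id K) hK hval (Hom.id_isIso K).isFoldEquiv (Nat.le_add_left _ _)

/-! ### Transport of irreducible complexes and surfaces -/

theorem exists_init (hY : ∀ v, 2 ≤ Y.valence v) (v : Y.V) : ∃ d, Y.init d = v := by
  have h1 : {d : Y.Dart | Y.init d = v}.encard ≠ 0 := fun h => by
    have := hY v
    rw [valence, h] at this
    exact absurd this (by norm_num)
  exact Set.encard_ne_zero.1 h1

theorem IsTight.exists_joined (hY : Y.IsTight) (v : Y.V) :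
    ∃ f, Y.Joined (Y.init (Y.bd f 0)) v := by
  obtain ⟨d, rfl⟩ := exists_init hY.valence v
  obtain ⟨⟨f, i⟩, h⟩ := hits_nonempty hY.valence hY.conn d
  refine ⟨f, (joined_of_mem (bdPath_mem f (i : ℕ))).trans ?_⟩
  rcases h with h | h
  · rw [h]
    exact CombGraph.Joined.refl _
  · rw [h, CombGraph.init_flip]
    exact (joined_dart d).symm

theorem Hom.IsFoldEquiv.exists_joined {χ : Hom Y Z} (hχ : χ.IsFoldEquiv)
    (hY : ∀ v, ∃ f, Y.Joined (Y.init (Y.bd f 0)) v) (z : Z.V) :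
    ∃ f, Z.Joined (Z.init (Z.bd f 0)) z := by
  obtain ⟨v, rfl⟩ := hχ.vert z
  obtain ⟨f, hf⟩ := hY v
  have h1 := χ.joined_map hf
  rw [← χ.init_bd_corner] at h1
  exact ⟨χ.face f, (joined_of_mem (bdPath_mem _ _)).trans h1⟩

/-- A tight complex over `X` is equivalent to a visibly irreducible complex over `X'`. -/
theorem GroupPairIso.exists_isVisiblyIrreducible {M : X.Marking} {M' : X'.Marking}
    (I : GroupPairIso M M') (hX : X.IsConnected) (hX' : X'.IsConnected) (hY : Y.IsFinite)
    (ht : Y.IsTight) {χ : Hom Y Z} (hχ : χ.IsFoldEquiv) {ψ : Hom Z X} (hψ : ψ.IsBranchedImmersion) :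
    ∃ W : BranchedComplex, W.IsFinite ∧ W.IsVisiblyIrreducible ∧ PairEquiv Y W ∧
      ∃ φ : Hom W X', φ.IsEssential := by
  have : Finite Y.V := hY.1
  have : Finite Y.E := hY.2.1
  have : Finite Y.F := hY.2.2
  have hE : Finite Z.E := Finite.of_surjective (fun d => (χ.dart d).1) fun e => by
    obtain ⟨d, hd⟩ := hχ.dart (e, true)
    exact ⟨d, congrArg Prod.fst hd⟩
  have hZ : Z.IsFinite :=
    ⟨Finite.of_surjective _ hχ.vert, hE, Finite.of_surjective _ hχ.faces.1.2⟩
  obtain ⟨Φ⟩ := I.nonempty_pathEquiv_coverData hX hX' hψ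
  obtain ⟨K, hK, hval, hZK, ψ', hψ'⟩ := Φ.exists_core hZ (hχ.exists_joined ht.exists_joined)
    (I.isBranchedImmersion_coverData hX' hψ)
  have hYK := hχ.pairEquiv.trans hZK
  obtain ⟨W, hW, hW', φ, hφ⟩ := BranchedComplex.exists_isVisiblyIrreducible hY ht hK hval hYK
  exact ⟨W, hW, hW', hYK.trans hφ.pairEquiv.symm, φ.comp ψ', Hom.isEssential_comp hφ hψ'⟩

theorem Hom.IsEssential.exists_isFoldEquiv {φ : Hom Y X} (h : φ.IsEssential) :
    ∃ (Z : BranchedComplex) (φ₀ : Hom Y Z) (ψ : Hom Z X),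
      φ₀.IsFoldEquiv ∧ ψ.IsBranchedImmersion := by
  obtain ⟨Z, φ₀, ψ, ⟨-, ⟨h1, h2, -⟩, -, -, h3⟩, hg, hf⟩ := h
  exact ⟨Z, φ₀, ψ, ⟨h1, h2, hg, hf⟩, h3⟩

theorem PairEquiv.nonempty_face (h : PairEquiv Y Z) (hY : Nonempty Y.F) : Nonempty Z.F := by
  obtain ⟨-, β, -⟩ := h
  exact hY.map β

theorem NielsenEquiv.symm (h : NielsenEquiv X X') : NielsenEquiv X' X := by
  obtain ⟨M, M', φ, β, h1, h2⟩ := h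
  refine ⟨M', M, φ.symm, β.symm, fun g a => ?_, fun a => ?_⟩
  · rw [Equiv.symm_apply_eq, h1, φ.apply_symm_apply, β.apply_symm_apply]
  · rw [← h2, β.apply_symm_apply]

theorem NielsenEquiv.exists_groupPairIso (h : NielsenEquiv X X') :
    ∃ (M : X.Marking) (M' : X'.Marking), Nonempty (GroupPairIso M M') := by
  obtain ⟨M, M', φ, β, h1, h2⟩ := h
  exact ⟨M, M', ⟨⟨φ, β, h1, h2⟩⟩⟩

theorem NielsenEquiv.exists_irred (h : NielsenEquiv X X') (hX : X.IsConnected)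
    (hX' : X'.IsConnected) (hY : Y ∈ X.Irred) : ∃ W ∈ X'.Irred, W.avgCurvature = Y.avgCurvature := by
  obtain ⟨M, M', ⟨I⟩⟩ := h.exists_groupPairIso
  obtain ⟨hfin, hF, ⟨Y₀, hfin₀, hirr, χ, hχ⟩, φ, hφ⟩ := hY
  obtain ⟨Z, φ₀, ψ, hφ₀, hψ⟩ := hφ.exists_isFoldEquiv
  rw [Hom.isEssentialEquiv_iff] at hχ
  obtain ⟨W, hW, hW', hp, ζ, hζ⟩ := I.exists_isVisiblyIrreducible hX hX' hfin₀
    (hirr.isTight hfin₀) (hχ.comp hφ₀) hψ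
  have hp' := hχ.pairEquiv.symm.trans hp
  exact ⟨W, ⟨hW, hp'.nonempty_face hF, ⟨W, hW, hW', Hom.id W,
    Hom.isEssentialEquiv_iff.2 (Hom.id_isIso W).isFoldEquiv⟩, ζ, hζ⟩,
    (hp'.avgCurvature_eq hfin hW).symm⟩

/-- If an edge of a tight complex is traversed more than twice, then its group pair has a tripod,
which cannot happen for the group pair of a surface. -/
theorem PairEquiv.isSurface (h : PairEquiv Y Z) (hY : Y.IsFinite) (hs : Y.IsSurface)
    (hZ : Z.IsFinite) (ht : Z.IsTight) : Z.IsSurface := by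
  have : Finite Y.V := hY.1
  have : Finite Y.E := hY.2.1
  have : Finite Y.F := hY.2.2
  have : Finite Z.V := hZ.1
  have : Finite Z.E := hZ.2.1
  intro v
  exact ⟨exists_init ht.valence v, ht.conn v, fun d _ => ((ht.hits d).eq_of_not_lt fun hd =>
    hs.not_hasTripodAt (h.hasTripodAt (ht.hasTripodAt hd))).symm⟩

theorem NielsenEquiv.exists_surf (h : NielsenEquiv X X') (hX : X.IsConnected)
    (hX' : X'.IsConnected) (hY : Y ∈ X.Surf) : ∃ W ∈ X'.Surf, W.avgCurvature = Y.avgCurvature := by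
  obtain ⟨M, M', ⟨I⟩⟩ := h.exists_groupPairIso
  obtain ⟨hfin, hF, hs, φ, hφ⟩ := hY
  obtain ⟨Z, φ₀, ψ, hφ₀, hψ⟩ := hφ.exists_isFoldEquiv
  have : Finite Y.E := hfin.2.1
  have : Finite Y.F := hfin.2.2
  obtain ⟨W, hW, hW', hp, ζ, hζ⟩ := I.exists_isVisiblyIrreducible hX hX' hfin hs.isTight hφ₀ hψ
  exact ⟨W, ⟨hW, hp.nonempty_face hF, hp.isSurface hfin hs hW (hW'.isTight hW), ζ, hζ⟩,
    (hp.avgCurvature_eq hfin hW).symm⟩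

end BranchedComplex

theorem mainTheorem8 (X X' : BranchedComplex)
    (hX : X.IsFinite) (hX' : X'.IsFinite) (hXc : X.IsConnected) (hXc' : X'.IsConnected)
    (h : BranchedComplex.NielsenEquiv X X') :
    (X.rhoPlus = X'.rhoPlus ∧ X.rhoMinus = X'.rhoMinus) ∧
    (X.IsIrreducible → X'.IsIrreducible →
      X.sigmaPlus = X'.sigmaPlus ∧ X.sigmaMinus = X'.sigmaMinus) := by
  have hsup : ∀ A B : Set BranchedComplex, (∀ Y ∈ A, ∃ W ∈ B, W.avgCurvature = Y.avgCurvature) →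
      (⨆ Y ∈ A, (Y.avgCurvature : EReal)) ≤ ⨆ Y ∈ B, (Y.avgCurvature : EReal) := by
    refine fun A B hAB => iSup₂_le fun Y hY => ?_
    obtain ⟨W, hW, h⟩ := hAB Y hY
    rw [← h]
    exact le_iSup₂ (f := fun (Y : BranchedComplex) (_ : Y ∈ B) => (Y.avgCurvature : EReal)) W hW
  have hinf : ∀ A B : Set BranchedComplex, (∀ Y ∈ A, ∃ W ∈ B, W.avgCurvature = Y.avgCurvature) →
      (⨅ Y ∈ B, (Y.avgCurvature : EReal)) ≤ ⨅ Y ∈ A, (Y.avgCurvature : EReal) := by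
    refine fun A B hAB => le_iInf₂ fun Y hY => ?_
    obtain ⟨W, hW, h⟩ := hAB Y hY
    rw [← h]
    exact iInf₂_le (f := fun (Y : BranchedComplex) (_ : Y ∈ B) => (Y.avgCurvature : EReal)) W hW
  have hr := fun Y (hY : Y ∈ X.Irred) => h.exists_irred hXc hXc' hY
  have hr' := fun Y (hY : Y ∈ X'.Irred) => h.symm.exists_irred hXc' hXc hY
  have hs := fun Y (hY : Y ∈ X.Surf) => h.exists_surf hXc hXc' hY
  have hs' := fun Y (hY : Y ∈ X'.Surf) => h.symm.exists_surf hXc' hXc hY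
  exact ⟨⟨le_antisymm (hsup _ _ hr) (hsup _ _ hr'), le_antisymm (hinf _ _ hr') (hinf _ _ hr)⟩,
    fun _ _ => ⟨le_antisymm (hsup _ _ hs) (hsup _ _ hs'), le_antisymm (hinf _ _ hs') (hinf _ _ hs)⟩⟩
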